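/- Let $1<\alpha<2$, $0<\rho<1-1/\alpha$, and let $X$ be one of the following two processes. A function $L$ is slowly varying if it is bounded on compact subintervals of $(0,\infty)$ and $L(at)/L(t)\to1$ as $t\to\infty$ for every $a>0$. (i) Taqqu-Levy: $T_1,T_2,\dots$ are i.i.d. positive integer-valued with mean $\mu$, $P(T_1=1)>0$ and $P(T_1\ge n)=L(n)n^{-\alpha}$ for all $n\ge1$, with $L$ slowly varying; $S_0$ is a non-negative integer-valued variable independent of $(T_k)$ with $P(S_0=u)=\mu^{-1}P(T_1\ge u+1)$ for $u\ge0$; $W_0,W_1,\dots$ are i.i.d. with mean zero and finite variance, independent of $(S_0,(T_k))$; $S_{-1}=-1$, $S_k=S_0+T_1+\dots+T_k$ and $X_t=\sum_{k\ge0}W_k\mathbf 1\{S_{k-1}\le t<S_k\}$. Put $U=T_1$, $\eta_k=T_kW_k$, $\xi=W_0$. (ii) Parke: $(\epsilon_s)_{s\in\mathbb Z}$ are i.i.d. with mean zero and finite variance; $(n_s)_{s\in\mathbb Z}$ are i.i.d. non-negative integer-valued, independent of $(\epsilon_s)$, with $P(n_0\ge k)=L(k)k^{-\alpha}$ for all $k\ge1$,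 with $L$ slowly varying; $X_t=\sum_{s\le t}\mathbf 1\{t\le s+n_s\}\,\epsilon_s$. Put $U=n_0$, $\eta_k=n_k\epsilon_k$, $\mu=1$, $\xi=\epsilon_0$. Let $x_j=2\pi j/n$, $D_{n,j}=\sum_{t=1}^nX_te^{\mathrm i t x_j}$, $d_{n,j}=\sum_{k=1}^{\lfloor n/\mu\rfloor}\eta_k e^{\mathrm i\mu k x_j}$ and $\ell(n)=n^{-1/\alpha}\inf\{t>0:P(U>t)<1/n\}$. Let $j=j(n)$ be non-negative integers with $j(n)\le n^\rho$ for all large $n$. Then, in both cases, $$\ell(n)^{-1}n^{-1/\alpha}\,(D_{n,j(n)}-d_{n,j(n)})\longrightarrow0\quad\text{in probability as } n\to\infty .$$ Consequently, if moreover $j(n)\ge1$ for all large $n$, then $\ell(n)^{-1}n^{-1/\alpha}D_{n,j(n)}$ converges in distribution to an $\alpha$-stable law $\nu$ on $\mathbb C$, which is not a point mass unless $\xi=0$ almost surely. Here $\nu$ is $\alpha$-stable if for independent $Z,Z'$ with law $\nu$ and all $a,b>0$ there is $c\in\mathbb C$ such that $aZ+bZ'$ has the law of $(a^\alpha+b^\alpha)^{1/\alpha}Z+c$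 (point masses are allowed). -/

import Mathlib

open MeasureTheory ProbabilityTheory Filter

/-- `L` is slowly varying at infinity: bounded on every compact interval of `(0, ∞)`, and
`L (a t) / L t → 1` as `t → ∞`, for every `a > 0`. -/
def SlowlyVarying (L : ℝ → ℝ) : Prop :=
  (∀ a b : ℝ, 0 < a → ∃ C : ℝ, ∀ t ∈ Set.Icc a b, |L t| ≤ C) ∧
    ∀ a : ℝ, 0 < a → Tendsto (fun t => L (a * t) / L t) atTop (nhds 1)

/-- `P(U ≥ n) = L(n) n ^ (-α)` for all `n ≥ 1`, with `L` slowly varying at infinity. -/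
def RegVarTail {Ω : Type*} [MeasurableSpace Ω] (P : Measure Ω) (U : Ω → ℕ) (α : ℝ) : Prop :=
  ∃ L : ℝ → ℝ, SlowlyVarying L ∧
    ∀ n : ℕ, 1 ≤ n → P.real {ω | n ≤ U ω} = L n * (n : ℝ) ^ (-α)

/-- `inf {t > 0 : P(U > t) < 1 / n}`. -/
noncomputable def tailQuantile {Ω : Type*} [MeasurableSpace Ω] (P : Measure Ω) (U : Ω → ℕ)
    (n : ℕ) : ℝ :=
  sInf {t : ℝ | 0 < t ∧ P.real {ω | t < (U ω : ℝ)} < 1 / (n : ℝ)}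

/-- `ℓ(n) = n ^ (-1 / α) * inf {t > 0 : P(U > t) < 1 / n}`. -/
noncomputable def ell {Ω : Type*} [MeasurableSpace Ω] (P : Measure Ω) (U : Ω → ℕ) (α : ℝ)
    (n : ℕ) : ℝ :=
  (n : ℝ) ^ (-(1 / α)) * tailQuantile P U n

/-- The Fourier frequency `x_j = 2 π j / n`. -/
noncomputable def fourierFreq (n j : ℕ) : ℝ := 2 * Real.pi * j / n

/-- `D_{n,j} = ∑_{t=1}^n X_t e^{i t x_j}`. -/
noncomputable def dft {Ω : Type*} (X : ℤ → Ω → ℝ) (n j : ℕ) (ω : Ω) : ℂ :=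
  ∑ t ∈ Finset.Icc 1 n, (X (t : ℤ) ω : ℂ) * Complex.exp (Complex.I * t * fourierFreq n j)

/-- `d_{n,j} = ∑_{k=1}^{⌊n/μ⌋} η_k e^{i μ k x_j}`. -/
noncomputable def dftApprox {Ω : Type*} (η : ℕ → Ω → ℝ) (μ : ℝ) (n j : ℕ) (ω : Ω) : ℂ :=
  ∑ k ∈ Finset.Icc 1 ⌊(n : ℝ) / μ⌋₊,
    (η k ω : ℂ) * Complex.exp (Complex.I * μ * k * fourierFreq n j)

/-! In the Taqqu-Levy model the interarrival times `T_1, T_2, …` are stored with index shifted by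
one: `T k` is `T_{k+1}`. The sequence `W` starts at `W_0`. -/

/-- Standing assumptions of the Taqqu-Levy model with tail index `α`. -/
structure IsTaqquLevyModel {Ω : Type*} [MeasurableSpace Ω] (P : Measure Ω) (α : ℝ)
    (T : ℕ → Ω → ℕ) (S₀ : Ω → ℕ) (W : ℕ → Ω → ℝ) : Prop where
  measurable_T : ∀ k, Measurable (T k)
  measurable_S₀ : Measurable S₀
  measurable_W : ∀ k, Measurable (W k)
  indep_T : iIndepFun T P
  identDistrib_T : ∀ k, IdentDistrib (T k) (T 0) P P
  T_pos : ∀ k, ∀ᵐ ω ∂P, 0 < T k ω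
  tail_T : RegVarTail P (T 0) α
  T_eq_one : 0 < P {ω | T 0 ω = 1}
  indep_S₀_T : IndepFun S₀ (fun ω k => T k ω) P
  /-- `P(S_0 = u) = P(T_1 ≥ u + 1) / μ`, with `μ = E[T_1]`. -/
  law_S₀ : ∀ u : ℕ,
    P.real {ω | S₀ ω = u} = (∫ ω, (T 0 ω : ℝ) ∂P)⁻¹ * P.real {ω | u + 1 ≤ T 0 ω}
  indep_W : iIndepFun W P
  identDistrib_W : ∀ k, IdentDistrib (W k) (W 0) P P
  sq_integrable_W : MemLp (W 0) 2 P
  mean_W : ∫ ω, W 0 ω ∂P = 0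
  indep_W_S₀_T : IndepFun (fun ω k => W k ω) (fun ω => (S₀ ω, fun k => T k ω)) P

/-- `S_k = S_0 + T_1 + ⋯ + T_k`, the end of the `k`-th regime (`T i` is `T_{i+1}`). -/
def regimeEnd {Ω : Type*} (T : ℕ → Ω → ℕ) (S₀ : Ω → ℕ) (k : ℕ) (ω : Ω) : ℤ :=
  (S₀ ω : ℤ) + ∑ i ∈ Finset.range k, (T i ω : ℤ)

/-- `S_{k-1}`, the start of the `k`-th regime, with `S_{-1} = -1`. -/
def regimeStart {Ω : Type*} (T : ℕ → Ω → ℕ) (S₀ : Ω → ℕ) : ℕ → Ω → ℤ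
  | 0, _ => -1
  | k + 1, ω => regimeEnd T S₀ k ω

open Classical in
/-- `X_t = ∑_{k ≥ 0} W_k 1{S_{k-1} ≤ t < S_k}` (almost surely at most one term is nonzero). -/
noncomputable def taqquLevy {Ω : Type*} (T : ℕ → Ω → ℕ) (S₀ : Ω → ℕ) (W : ℕ → Ω → ℝ)
    (t : ℤ) (ω : Ω) : ℝ :=
  ∑' k : ℕ, if regimeStart T S₀ k ω ≤ t ∧ t < regimeEnd T S₀ k ω then W k ω else 0

/-- `η_k = T_k W_k` for `k ≥ 1`. -/
def taqquLevyEta {Ω : Type*} (T : ℕ → Ω → ℕ) (W : ℕ → Ω → ℝ) (k : ℕ) (ω : Ω) : ℝ :=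
  (T (k - 1) ω : ℝ) * W k ω

/-- Standing assumptions of the Parke model with tail index `α`. -/
structure IsParkeModel {Ω : Type*} [MeasurableSpace Ω] (P : Measure Ω) (α : ℝ)
    (N : ℤ → Ω → ℕ) (ε : ℤ → Ω → ℝ) : Prop where
  measurable_N : ∀ s, Measurable (N s)
  measurable_ε : ∀ s, Measurable (ε s)
  indep_N : iIndepFun N P
  identDistrib_N : ∀ s, IdentDistrib (N s) (N 0) P P
  tail_N : RegVarTail P (N 0) α
  indep_ε : iIndepFun ε P
  identDistrib_ε : ∀ s, IdentDistrib (ε s) (ε 0) P P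
  sq_integrable_ε : MemLp (ε 0) 2 P
  mean_ε : ∫ ω, ε 0 ω ∂P = 0
  indep_N_ε : IndepFun (fun ω s => N s ω) (fun ω s => ε s ω) P

open Classical in
/-- `X_t = ∑_{s ≤ t} g_{s,t} ε_s`, where `g_{s,t} = 1` if `s ≤ t ≤ s + n_s`, and `0` otherwise
(almost surely finitely many terms are nonzero). -/
noncomputable def parke {Ω : Type*} (N : ℤ → Ω → ℕ) (ε : ℤ → Ω → ℝ) (t : ℤ) (ω : Ω) : ℝ :=
  ∑' s : ℤ, if s ≤ t ∧ t ≤ s + (N s ω : ℤ) then ε s ω else 0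

/-- `η_k = n_k ε_k`. -/
def parkeEta {Ω : Type*} (N : ℤ → Ω → ℕ) (ε : ℤ → Ω → ℝ) (k : ℕ) (ω : Ω) : ℝ :=
  (N (k : ℤ) ω : ℝ) * ε (k : ℤ) ω

/-- A probability law `ν` on `ℂ` is stable with index `α`: if `Z, Z'` are independent with law `ν`
then for all `a, b > 0` there is `c` such that `a Z + b Z'` has the law of
`(a ^ α + b ^ α) ^ (1 / α) Z + c`. -/
def IsStableLaw (α : ℝ) (ν : ProbabilityMeasure ℂ) : Prop :=
  ∀ a b : ℝ, 0 < a → 0 < b → ∃ c : ℂ,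
    ((ν : Measure ℂ).prod (ν : Measure ℂ)).map (fun z => (a : ℂ) * z.1 + (b : ℂ) * z.2) =
      (ν : Measure ℂ).map (fun z => (((a ^ α + b ^ α) ^ (1 / α) : ℝ) : ℂ) * z + c)

/-! # Low-frequency Fourier transforms of renewal-type long-memory processes

Let `a_n` be the tail quantile of `U`; the normalisation `ℓ(n)⁻¹ n ^ (-1 / α)` is `1 / a_n`
(`ell_inv_mul`). The tail of `U` is regularly varying, so Potter's bounds give
`n P(U > a_n x) → x ^ (-α)` together with a power majorant (`RegVarTail.tendsto_mul_tail`,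
`RegVarTail.mul_tail_le`). From these come `E[min(U, K a_n)²] = O(a_n² / n)`,
`E[U - min(U, K a_n)] = O(a_n / n)`, `n = o(a_n²)`, and `a_n x_j → 0` when `j ≤ n ^ ρ` with
`ρ < 1 - 1 / α`.

**Approximation.** Both processes are superpositions of blocks, each carrying a centred weight
independent of all block positions. Hence `D - d` is a linear combination of independent centred
weights whose coefficients depend only on the blocks, and by Chebyshev's inequality given the blocks
it is `o(a_n)` in probability as soon as the sum of the squared coefficients is `o(a_n²)` in
expectation on events of probability close to one (`tendstoInMeasure_sum_mul_random`). Off an event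
of small probability all blocks are at most `K a_n` long, which is short compared with the period
`2 π / x_j`; a block lying inside the observation window then contributes its length times the
exponential at its starting time, up to a small relative error (`norm_expBlock_sub_le`).
In the Parke model the `k`-th block starts at time `k`, and only the few blocks that may cross
time `n`, and those started before time `1`, need a separate bound. In the Taqqu-Levy model the
`k`-th block starts at a renewal time, which differs from `μ k` by `O(a_n)` in mean square once the
interarrival times are truncated (`exists_integral_truncDev_sq_le`); the product of this error with
`x_j` tends to zero. The number of renewals up to time `n` differs from `n / μ` by at most
`√(n a_n) = o(n)` with high probability, so the blocks near the end contribute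
`O(√(n a_n) a_n² / n) = o(a_n²)`.

**Limit law.** The variables `η_k = U_k B_k` are i.i.d., so the characteristic function of `d / a_n`
at `u` is a product of values `φ(s_k / a_n)`, where `s_k` is the projection of `u` on the direction
`μ k x_j`. Since `E B = 0`, `n (φ(s / a_n) - 1)` equals an average over `B` of compensated
characteristic functions of `U`; these are integrals of the rescaled tails `n P(U > a_n x)` and
converge, locally uniformly, to the exponent of a stable law (`RegVarTail.tendsto_compChar`). The
angles `μ k x_j`, `k ≤ n / μ`, make `j ≥ 1` turns of the circle with vanishing steps, so the product
converges to the exponential of a circle average (`tendsto_prod_circle`). This limit is continuous,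
hence a characteristic function (`exists_tendstoInDistribution_of_charFun`); its exponent is
homogeneous of degree `α`, so the law is stable, and its real part at `u = 1` is negative unless
`B = 0` almost surely, so the law is not a point mass. Slutsky's lemma transfers the limit from `d`
to `D` (`RegVarTail.exists_stable_limit`). -/

/-! ### Regularly varying tails -/

/-- The tail function `x ↦ P(U > x)`. -/
noncomputable def tail {Ω : Type*} [MeasurableSpace Ω] (P : Measure Ω) (U : Ω → ℕ) (x : ℝ) : ℝ :=
  P.real {ω | x < (U ω : ℝ)}

/-- `G` is a positive nonincreasing function bounded by one, and regularly varying with index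
`-α` at infinity. -/
structure RegVaryingTail (G : ℝ → ℝ) (α : ℝ) : Prop where
  antitone : Antitone G
  pos : ∀ x, 0 < G x
  le_one : ∀ x, G x ≤ 1
  ratio : ∀ c : ℝ, 0 < c → Tendsto (fun x => G (c * x) / G x) atTop (nhds (c ^ (-α)))

section TailFunction

variable {Ω : Type*} [MeasurableSpace Ω] {P : Measure Ω} {U : Ω → ℕ} {α : ℝ}

lemma RegVarTail.ratio_nat (hU : RegVarTail P U α) {p q : ℕ} (hp : 0 < p) (hq : 0 < q) :
    Tendsto (fun m : ℕ => P.real {ω | p * m ≤ U ω} / P.real {ω | q * m ≤ U ω}) atTop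
      (nhds (((p : ℝ) / q) ^ (-α))) := by
  obtain ⟨L, hL, h⟩ := hU
  have hp' : (0 : ℝ) < p := by exact_mod_cast hp
  have hq' : (0 : ℝ) < q := by exact_mod_cast hq
  have h2 := hL.2 ((p : ℝ) / q) (by positivity)
  have h3 : Tendsto (fun m : ℕ => (q : ℝ) * m) atTop atTop :=
    tendsto_natCast_atTop_atTop.const_mul_atTop hq'
  have h4 := (h2.comp h3).mul_const (((p : ℝ) / q) ^ (-α))
  rw [one_mul] at h4
  refine h4.congr' ?_
  filter_upwards [eventually_ge_atTop 1] with m hm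
  have hm' : (0 : ℝ) < m := by exact_mod_cast hm
  rw [h (p * m) (Nat.mul_pos hp hm), h (q * m) (Nat.mul_pos hq hm)]
  have e : (p : ℝ) / q * (q * m) = p * m := by field_simp
  have e2 : ((p : ℝ) / q) ^ (-α) = ((p * m : ℝ)) ^ (-α) / ((q * m : ℝ)) ^ (-α) := by
    rw [← Real.div_rpow (by positivity) (by positivity)]
    congr 1
    field_simp
  simp only [Function.comp, e, e2]
  push_cast
  rw [div_mul_div_comm]

variable [IsProbabilityMeasure P]

lemma tail_antitone : Antitone (tail P U) := fun _ _ h =>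
  measureReal_mono (fun _ hω => lt_of_le_of_lt h hω)

/-- `L(t) / L(t) → 1` forces `L(t) ≠ 0` for large `t`, as `0 / 0 = 0`; hence `U` is unbounded. -/
lemma RegVarTail.pos (hU : RegVarTail P U α) (m : ℕ) : 0 < P.real {ω | m ≤ U ω} := by
  obtain ⟨L, hL, h⟩ := hU
  have h2 := hL.2 1 one_pos
  have hev : ∀ᶠ t : ℝ in atTop, L t ≠ 0 := by
    filter_upwards [h2.eventually (lt_mem_nhds (show (1 / 2 : ℝ) < 1 by norm_num))] with t ht h0
    norm_num [h0] at ht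
  obtain ⟨k, hk, hkm⟩ := ((tendsto_natCast_atTop_atTop.eventually hev).and
    (eventually_ge_atTop (max m 1))).exists
  have hk1 : 1 ≤ k := (le_max_right _ _).trans hkm
  have hpos : P.real {ω | k ≤ U ω} ≠ 0 := by
    rw [h k hk1]
    exact mul_ne_zero hk (Real.rpow_pos_of_pos (by exact_mod_cast hk1) _).ne'
  exact (lt_of_le_of_ne measureReal_nonneg hpos.symm).trans_le
    (measureReal_mono fun ω hω => ((le_max_left _ _).trans hkm).trans hω)

lemma RegVarTail.tail_pos (hU : RegVarTail P U α) (x : ℝ) : 0 < tail P U x := by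
  refine (hU.pos (⌊x⌋₊ + 1)).trans_le (measureReal_mono fun ω hω => ?_)
  have := Nat.lt_floor_add_one x
  have h2 : ((⌊x⌋₊ + 1 : ℕ) : ℝ) ≤ U ω := by exact_mod_cast hω
  push_cast at h2
  simp only [Set.mem_ofPred_eq]
  linarith

/-- The slowly varying factor is only given at integers. The upper bound at a real ratio `c` follows
by monotonicity from a rational ratio `p / q < c`, by comparing `x` with a multiple of `q`. -/
lemma RegVarTail.ratio_lt (hU : RegVarTail P U α) {c b : ℝ} (hc : 0 < c)
    (hb : c ^ (-α) < b) : ∀ᶠ x in atTop, tail P U (c * x) / tail P U x < b := by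
  -- a rational `p / q < c` with `(p / q) ^ (-α) < b`
  have hcont : Tendsto (fun y : ℝ => y ^ (-α)) (nhds c) (nhds (c ^ (-α))) :=
    (Real.continuousAt_rpow_const c (-α) (Or.inl hc.ne')).tendsto
  obtain ⟨δ, hδ, hl2⟩ := Metric.eventually_nhds_iff.1 (hcont.eventually (gt_mem_nhds hb))
  obtain ⟨r, hr1, hr2⟩ := exists_rat_btwn (max_lt hc (sub_lt_self c hδ))
  have hr0 : (0 : ℝ) < r := (le_max_left _ _).trans_lt hr1
  have hrl : c - δ < (r : ℝ) := (le_max_right _ _).trans_lt hr1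
  have hrb : (r : ℝ) ^ (-α) < b := hl2 (by rw [Real.dist_eq, abs_lt]; constructor <;> linarith)
  have hr0' : 0 < r := by exact_mod_cast hr0
  obtain ⟨p, hp⟩ : ∃ p : ℕ, r.num = p := ⟨r.num.toNat, by
    rw [Int.toNat_of_nonneg (Rat.num_nonneg.2 hr0'.le)]⟩
  have hq : 0 < r.den := r.den_pos
  set q := r.den with hqdef
  have hrpq : (r : ℝ) = (p : ℝ) / q := by
    rw [Rat.cast_def, hp]; simp [hqdef]
  have hq' : (0 : ℝ) < q := by exact_mod_cast hq
  have hp0 : 0 < p := by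
    have : (0 : ℝ) < (p : ℝ) := by
      rw [hrpq] at hr0
      by_contra hcon
      have : (p : ℝ) = 0 := le_antisymm (not_lt.1 hcon) (Nat.cast_nonneg _)
      simp [this] at hr0
    exact_mod_cast this
  rw [hrpq] at hrb hr2
  have h1 := (hU.ratio_nat hp0 hq).eventually (gt_mem_nhds hrb)
  have hm : Tendsto (fun x : ℝ => ⌊x / q⌋₊ + 1) atTop atTop :=
    (tendsto_add_atTop_nat 1).comp (tendsto_nat_floor_atTop.comp
      (tendsto_id.atTop_div_const hq'))
  filter_upwards [hm.eventually h1, eventually_ge_atTop (p / (c - (p : ℝ) / q)),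
    eventually_ge_atTop 0] with x hx hx2 hx0
  have hfl : x / q < ((⌊x / q⌋₊ + 1 : ℕ) : ℝ) := by
    push_cast; exact Nat.lt_floor_add_one _
  have hfl2 : ((⌊x / q⌋₊ + 1 : ℕ) : ℝ) ≤ x / q + 1 := by
    push_cast; linarith [Nat.floor_le (show 0 ≤ x / q by positivity)]
  set m := ⌊x / q⌋₊ + 1
  refine lt_of_le_of_lt ?_ hx
  have ha : tail P U (c * x) ≤ P.real {ω | p * m ≤ U ω} := by
    refine measureReal_mono fun ω hω => ?_
    have h5 : (p * m : ℝ) ≤ c * x := by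
      rw [div_le_iff₀ (by linarith)] at hx2
      have : (p * m : ℝ) ≤ p * (x / q + 1) := by gcongr
      refine this.trans ?_
      have : (p : ℝ) * (x / q + 1) = p / q * x + p := by field_simp
      rw [this]; nlinarith
    have h6 : ((p * m : ℕ) : ℝ) < U ω := by
      push_cast; exact h5.trans_lt hω
    exact_mod_cast h6.le
  have hb' : P.real {ω | q * m ≤ U ω} ≤ tail P U x := by
    refine measureReal_mono fun ω hω => ?_
    have h5 : x < q * m := by rwa [div_lt_iff₀' hq'] at hfl
    have h6 : ((q * m : ℕ) : ℝ) ≤ U ω := by exact_mod_cast hω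
    push_cast at h6
    exact h5.trans_le h6
  have := hU.pos (q * m)
  gcongr

lemma RegVarTail.regVaryingTail (hU : RegVarTail P U α) : RegVaryingTail (tail P U) α where
  antitone := tail_antitone
  pos := hU.tail_pos
  le_one x := measureReal_le_one
  ratio c hc := by
    refine tendsto_order.2 ⟨fun b hb => ?_, fun b hb => hU.ratio_lt hc hb⟩
    rcases le_or_gt b 0 with hb0 | hb0
    · exact Eventually.of_forall fun x => hb0.trans_lt (div_pos (hU.tail_pos _) (hU.tail_pos _))
    -- the lower bound is the upper bound for `c⁻¹` at the point `c x`
    have h1 : (c⁻¹) ^ (-α) < b⁻¹ := by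
      rw [Real.inv_rpow hc.le]
      exact (inv_lt_inv₀ (Real.rpow_pos_of_pos hc _) hb0).2 hb
    have h2 := (tendsto_id.const_mul_atTop hc).eventually (hU.ratio_lt (inv_pos.2 hc) h1)
    filter_upwards [h2] with x hx
    simp only [id] at hx
    rw [inv_mul_cancel_left₀ hc.ne', ← inv_div] at hx
    exact (inv_lt_inv₀ (div_pos (hU.tail_pos _) (hU.tail_pos _)) hb0).1 hx

end TailFunction

namespace RegVaryingTail

variable {G : ℝ → ℝ} {α : ℝ}

/-- Potter's upper bound to the right of the reference point. -/
lemma potter_right (hG : RegVaryingTail G α) {γ : ℝ} (hγ0 : 0 ≤ γ) (hγ : γ < α) :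
    ∃ x₀ > 0, ∀ x y, x₀ ≤ x → x ≤ y → G y ≤ 2 ^ γ * (y / x) ^ (-γ) * G x := by
  have h1 : (2 : ℝ) ^ (-α) < 2 ^ (-γ) := Real.rpow_lt_rpow_of_exponent_lt one_lt_two (by linarith)
  obtain ⟨x₀, hx₀⟩ := eventually_atTop.1 ((hG.ratio 2 two_pos).eventually (gt_mem_nhds h1))
  refine ⟨max x₀ 1, by positivity, fun x y hx hxy => ?_⟩
  have hx0 : 0 < x := lt_of_lt_of_le (by positivity) hx
  have step : ∀ k : ℕ, G (2 ^ k * x) ≤ (2 ^ (-γ)) ^ k * G x := by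
    intro k
    induction k with
    | zero => simp
    | succ k ih =>
      have h3 : x₀ ≤ 2 ^ k * x := by
        have : (1 : ℝ) ≤ 2 ^ k := one_le_pow₀ (by norm_num)
        nlinarith [le_max_left x₀ 1]
      have h4 := (div_lt_iff₀ (hG.pos _)).1 (hx₀ _ h3)
      calc G (2 ^ (k + 1) * x) = G (2 * (2 ^ k * x)) := by ring_nf
        _ ≤ 2 ^ (-γ) * G (2 ^ k * x) := h4.le
        _ ≤ 2 ^ (-γ) * ((2 ^ (-γ)) ^ k * G x) := by gcongr
        _ = _ := by ring
  obtain ⟨k, hk1, hk2⟩ := exists_nat_pow_near (x := y / x) (y := 2)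
    (by rwa [one_le_div hx0]) one_lt_two
  calc G y ≤ G (2 ^ k * x) := hG.antitone (by rwa [le_div_iff₀ hx0] at hk1)
    _ ≤ (2 ^ (-γ)) ^ k * G x := step k
    _ ≤ 2 ^ γ * (y / x) ^ (-γ) * G x := by
      refine mul_le_mul_of_nonneg_right ?_ (hG.pos _).le
      have h5 : ((2 : ℝ) ^ (k + 1)) ^ (-γ) ≤ (y / x) ^ (-γ) :=
        Real.rpow_le_rpow_of_nonpos (by have := hx0.trans_le hxy; positivity) hk2.le (by linarith)
      have h6 : ((2 : ℝ) ^ (-γ)) ^ k = 2 ^ γ * ((2 : ℝ) ^ (k + 1)) ^ (-γ) := by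
        rw [← Real.rpow_natCast, ← Real.rpow_natCast, ← Real.rpow_mul (by norm_num),
          ← Real.rpow_mul (by norm_num), ← Real.rpow_add (by norm_num)]
        congr 1; push_cast; ring
      rw [h6]; gcongr

/-- Potter's upper bound to the left of the reference point. -/
lemma potter_left (hG : RegVaryingTail G α) {β : ℝ} (hβ0 : 0 ≤ β) (hβ : α < β) :
    ∃ C > 0, ∃ x₀ > 0, ∀ x y, x₀ ≤ x → 0 < y → y ≤ x → G y ≤ C * (y / x) ^ (-β) * G x := by
  have h1 : (2 : ℝ) ^ (-β) < 2 ^ (-α) := Real.rpow_lt_rpow_of_exponent_lt one_lt_two (by linarith)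
  obtain ⟨x₁, hx₁⟩ := eventually_atTop.1 ((hG.ratio 2 two_pos).eventually (lt_mem_nhds h1))
  set x₀ := max x₁ 1
  have hx₀ : 0 < x₀ := by positivity
  have key : ∀ x y, x₀ ≤ y → y ≤ x → G y ≤ 2 ^ β * (y / x) ^ (-β) * G x := by
    intro x y hy hyx
    have hy0 : 0 < y := hx₀.trans_le hy
    have step : ∀ k : ℕ, (2 ^ (-β)) ^ k * G y ≤ G (2 ^ k * y) := by
      intro k
      induction k with
      | zero => simp
      | succ k ih =>
        have h3 : x₁ ≤ 2 ^ k * y := by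
          have : (1 : ℝ) ≤ 2 ^ k := one_le_pow₀ (by norm_num)
          nlinarith [le_max_left x₁ 1]
        have h4 := (lt_div_iff₀ (hG.pos _)).1 (hx₁ _ h3)
        calc (2 ^ (-β)) ^ (k + 1) * G y = 2 ^ (-β) * ((2 ^ (-β)) ^ k * G y) := by ring
          _ ≤ 2 ^ (-β) * G (2 ^ k * y) := by gcongr
          _ ≤ G (2 * (2 ^ k * y)) := h4.le
          _ = _ := by ring_nf
    obtain ⟨k, hk1, hk2⟩ := exists_nat_pow_near (x := x / y) (y := 2)
      (by rwa [one_le_div hy0]) one_lt_two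
    have h5 : G (2 ^ (k + 1) * y) ≤ G x := hG.antitone (by
      rw [div_lt_iff₀ hy0] at hk2; exact hk2.le)
    have h6 := (step (k + 1)).trans h5
    have h7 : (2 : ℝ) ^ (-β * (k + 1)) * G y ≤ G x := by
      rwa [Real.rpow_mul (by norm_num), ← Nat.cast_succ, Real.rpow_natCast]
    have h8 : (y / x) ^ (-β) = (x / y) ^ β := by
      rw [Real.rpow_neg (by have := hy0.trans_le hyx; positivity),
        ← Real.inv_rpow (by have := hy0.trans_le hyx; positivity), inv_div]
    have h9 : (2 : ℝ) ^ (β * k) ≤ (x / y) ^ β := by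
      rw [mul_comm, Real.rpow_mul (by norm_num), Real.rpow_natCast]
      exact Real.rpow_le_rpow (by positivity) hk1 hβ0
    calc G y = 2 ^ β * 2 ^ (β * k) * ((2 : ℝ) ^ (-β * (k + 1)) * G y) := by
          rw [← mul_assoc, ← Real.rpow_add two_pos, ← Real.rpow_add two_pos]
          rw [show β + β * k + -β * (k + 1) = 0 by ring]; simp
      _ ≤ 2 ^ β * (x / y) ^ β * G x := by
        have := hG.pos y
        have : 0 < x / y := div_pos (hy0.trans_le hyx) hy0
        gcongr
      _ = _ := by rw [h8]
  refine ⟨(G x₀)⁻¹ * 2 ^ β, mul_pos (inv_pos.2 (hG.pos _)) (by positivity), x₀, hx₀,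
    fun x y hx hy hyx => ?_⟩
  have hx0 : 0 < x := hy.trans_le hyx
  have hone : 1 ≤ (G x₀)⁻¹ := (one_le_inv₀ (hG.pos _)).2 (hG.le_one _)
  rcases le_total x₀ y with h | h
  · refine (key x y h hyx).trans ?_
    rw [mul_assoc, mul_assoc, mul_assoc]
    exact le_mul_of_one_le_left (by have := hG.pos x; positivity) hone
  · calc G y ≤ 1 := hG.le_one y
      _ = (G x₀)⁻¹ * G x₀ := (inv_mul_cancel₀ (hG.pos _).ne').symm
      _ ≤ (G x₀)⁻¹ * (2 ^ β * (x₀ / x) ^ (-β) * G x) :=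
        mul_le_mul_of_nonneg_left (key x x₀ le_rfl hx) (inv_nonneg.2 (hG.pos _).le)
      _ ≤ (G x₀)⁻¹ * (2 ^ β * (y / x) ^ (-β) * G x) := by
        have h1 := hG.pos x
        have h2 := inv_nonneg.2 (hG.pos x₀).le
        have : (x₀ / x) ^ (-β) ≤ (y / x) ^ (-β) :=
          Real.rpow_le_rpow_of_nonpos (by positivity) (by gcongr) (by linarith)
        gcongr
      _ = _ := by ring

/-- A global power bound for a regularly varying tail. -/
lemma le_rpow (hG : RegVaryingTail G α) {γ : ℝ} (hγ0 : 0 ≤ γ) (hγ : γ < α) :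
    ∃ C > 0, ∀ x > 0, G x ≤ C * x ^ (-γ) := by
  obtain ⟨x₀, hx₀, h⟩ := hG.potter_right hγ0 hγ
  refine ⟨2 ^ γ * x₀ ^ γ, by positivity, fun x hx => ?_⟩
  rcases le_total x₀ x with hxx | hxx
  · refine (h x₀ x le_rfl hxx).trans ?_
    rw [Real.div_rpow hx.le hx₀.le, Real.rpow_neg hx₀.le, div_inv_eq_mul]
    have h1 := hG.le_one x₀
    calc 2 ^ γ * (x ^ (-γ) * x₀ ^ γ) * G x₀ ≤ 2 ^ γ * (x ^ (-γ) * x₀ ^ γ) * 1 := by gcongr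
      _ = _ := by ring
  · refine (hG.le_one x).trans ?_
    rw [mul_assoc, Real.rpow_neg hx.le, ← div_eq_mul_inv, ← Real.div_rpow hx₀.le hx.le]
    have h1 : (1 : ℝ) ≤ 2 ^ γ := Real.one_le_rpow (by norm_num) hγ0
    have h2 : (1 : ℝ) ≤ (x₀ / x) ^ γ := Real.one_le_rpow (by rwa [one_le_div hx]) hγ0
    nlinarith

lemma tendsto_zero (hG : RegVaryingTail G α) (hα : 0 < α) : Tendsto G atTop (nhds 0) := by
  obtain ⟨C, -, h⟩ := hG.le_rpow (γ := α / 2) (by linarith) (by linarith)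
  have h2 : Tendsto (fun x : ℝ => C * x ^ (-(α / 2))) atTop (nhds 0) := by
    simpa using (tendsto_rpow_neg_atTop (by linarith : 0 < α / 2)).const_mul C
  refine tendsto_of_tendsto_of_tendsto_of_le_of_le' tendsto_const_nhds h2
    (Eventually.of_forall fun x => (hG.pos x).le) ?_
  filter_upwards [eventually_gt_atTop 0] with x hx using h x hx

end RegVaryingTail

/-! ### The normalising quantile -/

section Quantile

variable {Ω : Type*} [MeasurableSpace Ω] {P : Measure Ω} {U : Ω → ℕ} {α : ℝ}

lemma one_div_le_tail {n : ℕ} {t : ℝ} (ht : 0 < t) (h : t < tailQuantile P U n) :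
    1 / (n : ℝ) ≤ tail P U t := by
  by_contra hcon
  exact (csInf_le (⟨0, fun x hx => hx.1.le⟩ : BddBelow {t : ℝ | 0 < t ∧
    P.real {ω | t < (U ω : ℝ)} < 1 / (n : ℝ)}) ⟨ht, not_le.1 hcon⟩).not_gt h

lemma tailQuantile_nonneg (n : ℕ) : 0 ≤ tailQuantile P U n :=
  Real.sInf_nonneg fun _ hx => hx.1.le

lemma tailQuantile_le {n : ℕ} {t : ℝ} (ht : 0 < t) (h : tail P U t < 1 / (n : ℝ)) :
    tailQuantile P U n ≤ t :=
  csInf_le ⟨0, fun _ hx => hx.1.le⟩ ⟨ht, h⟩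

lemma tail_eq_of_floor_eq {x y : ℝ} (hx : 0 ≤ x) (hy : 0 ≤ y) (h : ⌊x⌋₊ = ⌊y⌋₊) :
    tail P U x = tail P U y := by
  unfold tail
  congr 1
  ext ω
  simp only [Set.mem_ofPred_eq]
  rw [← Nat.floor_lt hx, ← Nat.floor_lt hy, h]

variable [IsProbabilityMeasure P] (hU : RegVarTail P U α) (hα : 0 < α)
include hU hα

lemma RegVarTail.quantile_set_nonempty {n : ℕ} (hn : 1 ≤ n) :
    {t : ℝ | 0 < t ∧ P.real {ω | t < (U ω : ℝ)} < 1 / (n : ℝ)}.Nonempty := by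
  have hn' : (0 : ℝ) < n := by exact_mod_cast hn
  have h := (hU.regVaryingTail.tendsto_zero hα).eventually
    (gt_mem_nhds (show (0 : ℝ) < 1 / n by positivity))
  obtain ⟨t, ht, ht0⟩ := (h.and (eventually_gt_atTop 0)).exists
  exact ⟨t, ht0, ht⟩

/-- Since `U` is integer valued, its tail is constant on `[m, m + 1)`, so the infimum defining the
quantile may be used as if it were attained. -/
lemma RegVarTail.tail_quantile_le {n : ℕ} (hn : 1 ≤ n) :
    tail P U (tailQuantile P U n) ≤ 1 / n := by
  have h0 := tailQuantile_nonneg (P := P) (U := U) n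
  set a := tailQuantile P U n with ha
  have h1 : a < ⌊a⌋₊ + 1 := Nat.lt_floor_add_one a
  obtain ⟨t, ht, hta⟩ := exists_lt_of_csInf_lt (hU.quantile_set_nonempty hα hn) h1
  have hat : a ≤ t := csInf_le ⟨0, fun _ hx => hx.1.le⟩ ht
  have : tail P U a = tail P U t := by
    refine tail_eq_of_floor_eq h0 ht.1.le (le_antisymm (Nat.floor_mono hat) ?_)
    exact Nat.lt_succ_iff.1 ((Nat.floor_lt ht.1.le).2 (by push_cast; exact hta))
  rw [this]
  exact ht.2.le

lemma RegVarTail.tendsto_quantile : Tendsto (tailQuantile P U) atTop atTop := by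
  refine tendsto_atTop.2 fun M => ?_
  have h1 : Tendsto (fun n : ℕ => 1 / (n : ℝ)) atTop (nhds 0) := tendsto_one_div_atTop_nhds_zero_nat
  filter_upwards [h1.eventually (gt_mem_nhds (hU.tail_pos M)), eventually_ge_atTop 1] with n hn h1
  refine le_csInf (hU.quantile_set_nonempty hα h1) fun t ht => ?_
  by_contra hcon
  exact absurd (ht.2.trans hn) (not_lt.2 (tail_antitone (not_le.1 hcon).le))

/-- The tail at the quantile is asymptotic to `1 / n`: regular variation bounds its jump. -/
lemma RegVarTail.tendsto_mul_tail_quantile :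
    Tendsto (fun n : ℕ => n * tail P U (tailQuantile P U n)) atTop (nhds 1) := by
  have hG := hU.regVaryingTail
  have hle : ∀ᶠ n : ℕ in atTop, n * tail P U (tailQuantile P U n) ≤ 1 := by
    filter_upwards [eventually_ge_atTop 1] with n hn
    have hn' : (0 : ℝ) < n := by exact_mod_cast hn
    have := hU.tail_quantile_le hα hn
    rwa [le_div_iff₀' hn'] at this
  refine tendsto_order.2 ⟨fun b hb => ?_, fun b hb => hle.mono fun n h => h.trans_lt hb⟩
  have hc : Tendsto (fun e : ℝ => e ^ α) (nhdsWithin 1 (Set.Iio 1)) (nhds 1) := by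
    have := (Real.continuousAt_rpow_const (1 : ℝ) α (Or.inl one_ne_zero)).tendsto
    rw [Real.one_rpow] at this
    exact this.mono_left nhdsWithin_le_nhds
  -- the tail at `e a_n < a_n` is at least `1 / n`, for `e < 1` with `e ^ α > b`
  obtain ⟨e, he, he1, he0⟩ := ((hc.eventually (lt_mem_nhds hb)).and
    ((eventually_mem_nhdsWithin (a := (1 : ℝ)) (s := Set.Iio 1)).and
      (mem_nhdsWithin_of_mem_nhds (lt_mem_nhds (show (0 : ℝ) < 1 by norm_num))))).exists
  simp only [Set.mem_Iio] at he1
  have he0' : (0 : ℝ) < e := he0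
  have hr := (hG.ratio e he0').inv₀ (Real.rpow_pos_of_pos he0' _).ne'
  rw [Real.rpow_neg he0'.le, inv_inv] at hr
  have hr2 := (hr.comp (hU.tendsto_quantile hα)).eventually (lt_mem_nhds he)
  filter_upwards [hr2, eventually_ge_atTop 1, (hU.tendsto_quantile hα).eventually_gt_atTop 0]
    with n h1 hn ha
  have hn' : (0 : ℝ) < n := by exact_mod_cast hn
  simp only [Function.comp, inv_div] at h1
  have h2 : 1 / (n : ℝ) ≤ tail P U (e * tailQuantile P U n) :=
    one_div_le_tail (by positivity) (by nlinarith)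
  refine h1.trans_le ?_
  rw [div_le_iff₀ (hG.pos _)]
  rw [div_le_iff₀' hn'] at h2
  have := hG.pos (tailQuantile P U n)
  nlinarith

/-- Vague convergence of the rescaled tails: `n P(U > a_n x) → x ^ (-α)`. -/
lemma RegVarTail.tendsto_mul_tail {x : ℝ} (hx : 0 < x) :
    Tendsto (fun n : ℕ => n * tail P U (tailQuantile P U n * x)) atTop (nhds (x ^ (-α))) := by
  have h1 := (hU.tendsto_mul_tail_quantile hα).mul
    ((hU.regVaryingTail.ratio x hx).comp (hU.tendsto_quantile hα))
  rw [one_mul] at h1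
  refine h1.congr fun n => ?_
  have := (hU.tail_pos (tailQuantile P U n)).ne'
  simp only [Function.comp]
  rw [mul_comm x]
  field_simp

/-- Domination of the rescaled tails `n P(U > a_n x)`, uniformly in `x > 0` and large `n`. -/
lemma RegVarTail.mul_tail_le {β γ : ℝ} (hβ : α < β) (hγ0 : 0 ≤ γ) (hγ : γ < α) :
    ∃ C > 0, ∀ᶠ n : ℕ in atTop, ∀ x > 0,
      n * tail P U (tailQuantile P U n * x) ≤ C * (x ^ (-β) + x ^ (-γ)) := by
  have hG := hU.regVaryingTail
  obtain ⟨C₁, hC₁, x₁, hx₁, h1⟩ := hG.potter_left (hα.trans hβ).le hβ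
  obtain ⟨x₂, hx₂, h2⟩ := hG.potter_right hγ0 hγ
  refine ⟨C₁ + 2 ^ γ, by positivity, ?_⟩
  filter_upwards [eventually_ge_atTop 1,
    (hU.tendsto_quantile hα).eventually_ge_atTop (max x₁ x₂)] with n hn ha x hx
  have hn' : (0 : ℝ) < n := by exact_mod_cast hn
  set a := tailQuantile P U n with haq
  have ha0 : 0 < a := hx₁.trans_le ((le_max_left _ _).trans ha)
  have hle := hU.tail_quantile_le hα hn
  rw [← haq, le_div_iff₀' hn'] at hle
  have hxb : 0 ≤ x ^ (-β) := by positivity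
  have hxg : 0 ≤ x ^ (-γ) := by positivity
  have h2g : (0 : ℝ) ≤ 2 ^ γ := by positivity
  rcases le_total x 1 with hx1 | hx1
  · have h3 := h1 a (a * x) ((le_max_left _ _).trans ha) (by positivity) (by nlinarith)
    rw [mul_div_cancel_left₀ _ ha0.ne'] at h3
    calc n * tail P U (a * x) ≤ n * (C₁ * x ^ (-β) * tail P U a) := by gcongr
      _ = (C₁ * x ^ (-β)) * (n * tail P U a) := by ring
      _ ≤ (C₁ * x ^ (-β)) * 1 := by gcongr
      _ ≤ _ := by nlinarith [mul_nonneg hC₁.le hxg, mul_nonneg h2g hxg, mul_nonneg h2g hxb]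
  · have h3 := h2 a (a * x) ((le_max_right _ _).trans ha) (by nlinarith)
    rw [mul_div_cancel_left₀ _ ha0.ne'] at h3
    calc n * tail P U (a * x) ≤ n * (2 ^ γ * x ^ (-γ) * tail P U a) := by gcongr
      _ = (2 ^ γ * x ^ (-γ)) * (n * tail P U a) := by ring
      _ ≤ (2 ^ γ * x ^ (-γ)) * 1 := by gcongr
      _ ≤ _ := by nlinarith [mul_nonneg hC₁.le hxg, mul_nonneg hC₁.le hxb, mul_nonneg h2g hxb]

/-- `n = o(a_n²)`: block counts of order `n` are negligible on the scale of second moments. -/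
lemma RegVarTail.tendsto_div_quantile_sq (hα2 : α < 2) :
    Tendsto (fun n : ℕ => (n : ℝ) / tailQuantile P U n ^ 2) atTop (nhds 0) := by
  have hG := hU.regVaryingTail
  obtain ⟨C, hC, x₁, hx₁, h1⟩ := hG.potter_left (β := (α + 2) / 2) (by linarith) (by linarith)
  have hlim : Tendsto (fun n : ℕ => (C / tail P U 1) *
      tailQuantile P U n ^ (-(2 - (α + 2) / 2))) atTop (nhds 0) := by
    simpa using ((tendsto_rpow_neg_atTop (show 0 < 2 - (α + 2) / 2 by linarith)).comp
      (hU.tendsto_quantile hα)).const_mul (C / tail P U 1)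
  refine tendsto_of_tendsto_of_tendsto_of_le_of_le' tendsto_const_nhds hlim
    (Eventually.of_forall fun n => by positivity) ?_
  filter_upwards [eventually_ge_atTop 1,
    (hU.tendsto_quantile hα).eventually_ge_atTop (max x₁ 1)] with n hn ha
  have hn' : (0 : ℝ) < n := by exact_mod_cast hn
  set a := tailQuantile P U n with haq
  have ha0 : 0 < a := hx₁.trans_le ((le_max_left _ _).trans ha)
  have hle := hU.tail_quantile_le hα hn
  rw [← haq, le_div_iff₀' hn'] at hle
  have h3 := h1 a 1 ((le_max_left _ _).trans ha) one_pos ((le_max_right _ _).trans ha)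
  have hp := hG.pos 1
  have e1 : (1 / a) ^ (-((α + 2) / 2)) = a ^ ((α + 2) / 2) := by
    rw [one_div, Real.inv_rpow ha0.le, Real.rpow_neg ha0.le, inv_inv]
  have e2 : a ^ (-(2 - (α + 2) / 2)) = a ^ ((α + 2) / 2) / a ^ 2 := by
    rw [neg_sub, Real.rpow_sub ha0]; norm_num
  rw [e1] at h3
  rw [e2, div_mul_div_comm, div_le_div_iff₀ (by positivity) (by positivity)]
  have h4 : n * tail P U 1 ≤ C * a ^ ((α + 2) / 2) := by
    calc n * tail P U 1 ≤ n * (C * a ^ ((α + 2) / 2) * tail P U a) := by gcongr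
      _ = (C * a ^ ((α + 2) / 2)) * (n * tail P U a) := by ring
      _ ≤ (C * a ^ ((α + 2) / 2)) * 1 := by gcongr
      _ = _ := by ring
  calc (n : ℝ) * (tail P U 1 * a ^ 2) = (n * tail P U 1) * a ^ 2 := by ring
    _ ≤ _ := by gcongr

lemma RegVarTail.tendsto_quantile_mul_rpow {s : ℝ} (hs : 1 / α < s) :
    Tendsto (fun n : ℕ => tailQuantile P U n * (n : ℝ) ^ (-s)) atTop (nhds 0) := by
  have hG := hU.regVaryingTail
  have hs0 : 0 < s := (by positivity : 0 < 1 / α).trans hs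
  have hs1 : s⁻¹ < α := by rwa [one_div, inv_lt_comm₀ hα hs0] at hs
  obtain ⟨γ, hγ1, hγ2⟩ := exists_between hs1
  have hγ0 : 0 < γ := (inv_pos.2 hs0).trans hγ1
  obtain ⟨C, hC, h1⟩ := hG.le_rpow hγ0.le hγ2
  have hγs : γ⁻¹ < s := (inv_lt_comm₀ hγ0 hs0).2 hγ1
  have hlim : Tendsto (fun n : ℕ => (2 * C) ^ γ⁻¹ * (n : ℝ) ^ (-(s - γ⁻¹))) atTop (nhds 0) := by
    simpa using ((tendsto_rpow_neg_atTop (show 0 < s - γ⁻¹ by linarith)).comp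
      tendsto_natCast_atTop_atTop).const_mul ((2 * C) ^ γ⁻¹)
  refine tendsto_of_tendsto_of_tendsto_of_le_of_le' tendsto_const_nhds hlim
    (Eventually.of_forall fun n => mul_nonneg (tailQuantile_nonneg n) (by positivity)) ?_
  filter_upwards [eventually_ge_atTop 1] with n hn
  have hn' : (0 : ℝ) < n := by exact_mod_cast hn
  have ht : 0 < (2 * C * n) ^ γ⁻¹ := by positivity
  have h2 : tailQuantile P U n ≤ (2 * C * n) ^ γ⁻¹ := by
    refine tailQuantile_le ht ((h1 _ ht).trans_lt ?_)
    rw [← Real.rpow_mul (by positivity), mul_neg, inv_mul_cancel₀ hγ0.ne', Real.rpow_neg_one,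
      ← div_eq_mul_inv, div_lt_div_iff₀ (by positivity) hn']
    nlinarith [mul_pos hC hn']
  calc tailQuantile P U n * (n : ℝ) ^ (-s) ≤ (2 * C * n) ^ γ⁻¹ * (n : ℝ) ^ (-s) := by gcongr
    _ = (2 * C) ^ γ⁻¹ * (n : ℝ) ^ (-(s - γ⁻¹)) := by
      rw [Real.mul_rpow (by positivity) hn'.le, mul_assoc, ← Real.rpow_add hn']
      congr 2; ring

omit hα in
lemma RegVarTail.integrable (hUm : Measurable U) (hα1 : 1 < α) :
    Integrable (fun ω => (U ω : ℝ)) P := by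
  have hα : 0 < α := one_pos.trans hα1
  obtain ⟨γ, hγ1, hγ2⟩ := exists_between hα1
  obtain ⟨C, hC, h1⟩ := hU.regVaryingTail.le_rpow (one_pos.trans hγ1).le hγ2
  have hm : Measurable fun ω => (U ω : ℝ) := measurable_from_top.comp hUm
  refine ⟨hm.aestronglyMeasurable, ?_⟩
  rw [hasFiniteIntegral_iff_ofReal (Eventually.of_forall fun ω => by positivity),
    lintegral_eq_lintegral_meas_lt P (Eventually.of_forall fun ω => by positivity) hm.aemeasurable]
  have hsplit : Set.Ioi (0 : ℝ) = Set.Ioc 0 1 ∪ Set.Ioi 1 := by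
    rw [Set.Ioc_union_Ioi_eq_Ioi zero_le_one]
  rw [hsplit]
  refine (lintegral_union_le _ _ _).trans_lt (ENNReal.add_lt_top.2 ⟨?_, ?_⟩)
  · refine (setLIntegral_mono (g := fun _ => 1) measurable_const fun t _ => prob_le_one).trans_lt ?_
    simp
  · have hi : IntegrableOn (fun t : ℝ => C * t ^ (-γ)) (Set.Ioi 1) :=
      (integrableOn_Ioi_rpow_of_lt (by linarith) one_pos).const_mul C
    have h3 := hi.2
    rw [hasFiniteIntegral_iff_ofReal] at h3
    · refine (setLIntegral_mono' measurableSet_Ioi fun t ht => ?_).trans_lt h3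
      rw [← ofReal_measureReal]
      exact ENNReal.ofReal_le_ofReal (h1 t (one_pos.trans ht))
    · filter_upwards [ae_restrict_mem measurableSet_Ioi] with t ht
      have : 0 < t := one_pos.trans ht
      simp only [Pi.zero_apply]
      positivity

end Quantile

/-! ### Truncated moments -/

section TruncatedMoments

variable {Ω : Type*} [MeasurableSpace Ω] {P : Measure Ω} [IsProbabilityMeasure P] {U : Ω → ℕ}
  {α : ℝ}

lemma RegVarTail.tail_le (hU : RegVarTail P U α) {β γ : ℝ} (hα : 0 < α) (hβ : α < β)
    (hγ0 : 0 ≤ γ) (hγ : γ < α) :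
    ∃ C > 0, ∀ᶠ n : ℕ in atTop, ∀ t > 0, tail P U t ≤
      C / n * ((t / tailQuantile P U n) ^ (-β) + (t / tailQuantile P U n) ^ (-γ)) := by
  obtain ⟨C, hC, h⟩ := hU.mul_tail_le hα hβ hγ0 hγ
  refine ⟨C, hC, ?_⟩
  filter_upwards [h, eventually_ge_atTop 1, (hU.tendsto_quantile hα).eventually_gt_atTop 0]
    with n h hn ha t ht
  have hn' : (0 : ℝ) < n := by exact_mod_cast hn
  have := h (t / tailQuantile P U n) (by positivity)
  rw [mul_div_cancel₀ _ ha.ne'] at this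
  rwa [div_mul_eq_mul_div, le_div_iff₀' hn']

/-- The layer-cake formula for a truncated second moment, with a majorant of the tail. -/
lemma integral_truncated_sq_le (hUm : Measurable U) {b : ℝ} (hb : 0 ≤ b) {g : ℝ → ℝ}
    (hg : ∀ t ∈ Set.Ioc 0 b, tail P U t * (2 * t) ≤ g t) (hg0 : ∀ t ∈ Set.Ioc 0 b, 0 ≤ g t)
    (hgi : IntervalIntegrable g volume 0 b) :
    ∫ ω, (min (U ω : ℝ) b) ^ 2 ∂P ≤ ∫ t in (0 : ℝ)..b, g t := by
  have hm : Measurable fun ω => min (U ω : ℝ) b :=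
    (measurable_from_top.comp hUm : Measurable fun ω => (U ω : ℝ)).min measurable_const
  have h0 : ∀ ω, 0 ≤ min (U ω : ℝ) b := fun ω => le_min (Nat.cast_nonneg _) hb
  have hint : 0 ≤ ∫ t in (0 : ℝ)..b, g t := by
    rw [intervalIntegral.integral_of_le hb]
    exact setIntegral_nonneg measurableSet_Ioc hg0
  rw [integral_eq_lintegral_of_nonneg_ae (Eventually.of_forall fun ω => by positivity)
    (hm.pow_const 2).aestronglyMeasurable]
  refine ENNReal.toReal_le_of_le_ofReal hint ?_
  have h1 := lintegral_comp_eq_lintegral_meas_lt_mul P (f := fun ω => min (U ω : ℝ) b)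
    (g := fun t => 2 * t) (Eventually.of_forall h0) hm.aemeasurable
    (fun t _ => (continuous_const.mul continuous_id).intervalIntegrable _ _)
    ((ae_restrict_iff' measurableSet_Ioi).2 (Eventually.of_forall fun t ht => by
      simp only [Set.mem_Ioi] at ht; positivity))
  have h2 : ∀ x : ℝ, ∫ t in (0 : ℝ)..x, 2 * t = x ^ 2 := fun x => by
    rw [intervalIntegral.integral_const_mul, integral_id]; ring
  simp_rw [h2] at h1
  rw [h1, intervalIntegral.integral_of_le hb, ofReal_integral_eq_lintegral_ofReal
    ((intervalIntegrable_iff_integrableOn_Ioc_of_le hb).1 hgi)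
    ((ae_restrict_iff' measurableSet_Ioc).2 (Eventually.of_forall hg0)),
    ← lintegral_indicator measurableSet_Ioi, ← lintegral_indicator measurableSet_Ioc]
  refine lintegral_mono fun t => ?_
  by_cases ht : t ∈ Set.Ioc 0 b
  · rw [Set.indicator_of_mem (show t ∈ Set.Ioi (0 : ℝ) from ht.1), Set.indicator_of_mem ht]
    refine le_trans ?_ (ENNReal.ofReal_le_ofReal (hg t ht))
    unfold tail
    rw [ENNReal.ofReal_mul (measureReal_nonneg), ofReal_measureReal]
    gcongr
    exact min_le_left _ _
  · rw [Set.indicator_of_notMem ht]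
    by_cases ht0 : t ∈ Set.Ioi (0 : ℝ)
    · have : {ω | t < min (U ω : ℝ) b} = ∅ := by
        ext ω
        simp only [Set.mem_ofPred_eq, Set.mem_empty_iff_false, iff_false]
        intro h
        exact ht ⟨ht0, (lt_min_iff.1 h).2.le⟩
      rw [Set.indicator_of_mem ht0, this]; simp
    · rw [Set.indicator_of_notMem ht0]

/-- The truncated second moment: `E[min(U, K a_n)²] = O(a_n² / n)`. -/
lemma RegVarTail.truncated_sq (hU : RegVarTail P U α) (hUm : Measurable U) (hα1 : 1 < α)
    (hα2 : α < 2) {K : ℝ} (hK : 0 < K) :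
    ∃ C > 0, ∀ᶠ n : ℕ in atTop, ∫ ω, (min (U ω : ℝ) (K * tailQuantile P U n)) ^ 2 ∂P ≤
      C * (tailQuantile P U n ^ 2 / n) := by
  have hα0 : 0 < α := by linarith
  obtain ⟨β, hβ1, hβ2⟩ := exists_between hα2
  obtain ⟨C, hC, h⟩ := hU.tail_le hα0 hβ1 zero_le_one hα1
  refine ⟨2 * C * (K ^ (2 - β) / (2 - β) + K), by
    have : 0 < 2 - β := by linarith
    positivity, ?_⟩
  filter_upwards [h, eventually_ge_atTop 1, (hU.tendsto_quantile hα0).eventually_gt_atTop 0]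
    with n h hn ha
  set a := tailQuantile P U n
  have hn' : (0 : ℝ) < n := by exact_mod_cast hn
  have hβ3 : 0 < 2 - β := by linarith
  have hi1 : IntervalIntegrable (fun t : ℝ => t ^ (1 - β)) volume 0 (K * a) :=
    intervalIntegral.intervalIntegrable_rpow' (by linarith)
  refine (integral_truncated_sq_le hUm (b := K * a) (by positivity)
    (g := fun t => 2 * C / n * (a ^ β * t ^ (1 - β) + a)) ?_ ?_ ?_).trans (le_of_eq ?_)
  · intro t ht
    have ht0 : 0 < t := ht.1
    calc tail P U t * (2 * t) ≤ C / n * ((t / a) ^ (-β) + (t / a) ^ (-1 : ℝ)) * (2 * t) := by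
          gcongr; exact h t ht0
      _ = _ := by
          rw [Real.div_rpow ht0.le ha.le, Real.rpow_neg ha.le β, Real.rpow_neg_one, div_inv_eq_mul,
            show (1 - β) = -β + 1 by ring, Real.rpow_add ht0, Real.rpow_one]
          field_simp
  · intro t ht
    have ht0 : 0 < t := ht.1
    positivity
  · exact ((hi1.const_mul _).add (intervalIntegrable_const)).const_mul _
  · rw [intervalIntegral.integral_const_mul, intervalIntegral.integral_add (hi1.const_mul _)
      intervalIntegrable_const, intervalIntegral.integral_const_mul,
      integral_rpow (Or.inl (by linarith)), intervalIntegral.integral_const, smul_eq_mul,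
      show 1 - β + 1 = 2 - β by ring, Real.zero_rpow hβ3.ne', Real.mul_rpow hK.le ha.le]
    have : a ^ β * a ^ (2 - β) = a ^ 2 := by
      rw [← Real.rpow_add ha]; norm_num
    calc _ = 2 * C / n * ((a ^ β * a ^ (2 - β)) * K ^ (2 - β) / (2 - β) + K * a * a) := by ring
      _ = _ := by rw [this]; ring

/-- The truncated tail of the mean: `E[U - min(U, K a_n)] = O(a_n / n)`. -/
lemma RegVarTail.integral_sub_truncated (hU : RegVarTail P U α) (hUm : Measurable U) (hα1 : 1 < α)
    {K : ℝ} (hK : 0 < K) :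
    ∃ C > 0, ∀ᶠ n : ℕ in atTop,
      ∫ ω, ((U ω : ℝ) - min (U ω : ℝ) (K * tailQuantile P U n)) ∂P ≤
      C * (tailQuantile P U n / n) := by
  have hα0 : 0 < α := by linarith
  obtain ⟨γ, hγ1, hγ2⟩ := exists_between hα1
  obtain ⟨C, hC, h⟩ := hU.tail_le hα0 (lt_add_one α) (by linarith : 0 ≤ γ) hγ2
  refine ⟨C * (K ^ (-α) / α + K ^ (1 - γ) / (γ - 1)), by
    have : 0 < γ - 1 := by linarith
    positivity, ?_⟩
  filter_upwards [h, eventually_ge_atTop 1, (hU.tendsto_quantile hα0).eventually_gt_atTop 0]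
    with n h hn ha
  set a := tailQuantile P U n
  have hn' : (0 : ℝ) < n := by exact_mod_cast hn
  have hγ3 : 0 < γ - 1 := by linarith
  have hb : 0 < K * a := by positivity
  have hUm' : Measurable fun ω => (U ω : ℝ) := measurable_from_top.comp hUm
  have hm : Measurable fun ω => (U ω : ℝ) - min (U ω : ℝ) (K * a) :=
    hUm'.sub (hUm'.min measurable_const)
  have h0 : ∀ ω, 0 ≤ (U ω : ℝ) - min (U ω : ℝ) (K * a) := fun ω => sub_nonneg.2 (min_le_left _ _)
  rw [integral_eq_lintegral_of_nonneg_ae (Eventually.of_forall h0) hm.aestronglyMeasurable,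
    lintegral_eq_lintegral_meas_lt P (Eventually.of_forall h0) hm.aemeasurable]
  refine ENNReal.toReal_le_of_le_ofReal (by positivity) ?_
  have hi1 : IntegrableOn (fun t : ℝ => (t + K * a) ^ (-(α + 1))) (Set.Ioi 0) := by
    exact integrableOn_add_rpow_Ioi_of_lt (by linarith) (by linarith)
  have hi2 : IntegrableOn (fun t : ℝ => (t + K * a) ^ (-γ)) (Set.Ioi 0) := by
    exact integrableOn_add_rpow_Ioi_of_lt (by linarith) (by linarith)
  have hshift : ∀ f : ℝ → ℝ, ∫ t in Set.Ioi (0 : ℝ), f (t + K * a) = ∫ t in Set.Ioi (K * a), f t := by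
    intro f
    rw [← (measurePreserving_add_right volume (K * a)).setIntegral_preimage_emb
      (measurableEmbedding_addRight (K * a)) f]
    simp
  have hv1 : ∫ t in Set.Ioi (0 : ℝ), (t + K * a) ^ (-(α + 1)) = (K * a) ^ (-α) / α := by
    rw [hshift (fun t : ℝ => t ^ (-(α + 1))), integral_Ioi_rpow_of_lt (by linarith) hb]
    rw [show -(α + 1) + 1 = -α by ring, neg_div_neg_eq]
  have hv2 : ∫ t in Set.Ioi (0 : ℝ), (t + K * a) ^ (-γ) = (K * a) ^ (1 - γ) / (γ - 1) := by
    rw [hshift (fun t : ℝ => t ^ (-γ)), integral_Ioi_rpow_of_lt (by linarith) hb]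
    rw [show -γ + 1 = 1 - γ by ring, ← neg_div_neg_eq, neg_neg, neg_sub]
  have hval : ENNReal.ofReal (C * (K ^ (-α) / α + K ^ (1 - γ) / (γ - 1)) * (a / n)) =
      ∫⁻ t in Set.Ioi (0 : ℝ), ENNReal.ofReal (C / n * (a ^ (α + 1) * (t + K * a) ^ (-(α + 1)) +
        a ^ γ * (t + K * a) ^ (-γ))) := by
    have hi3 := ((hi1.const_mul (a ^ (α + 1))).add (hi2.const_mul (a ^ γ))).const_mul (C / n)
    simp only [Pi.add_apply] at hi3
    rw [← ofReal_integral_eq_lintegral_ofReal hi3,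
      integral_const_mul, integral_add (hi1.const_mul _) (hi2.const_mul _), integral_const_mul,
      integral_const_mul, hv1, hv2, Real.mul_rpow hK.le ha.le, Real.mul_rpow hK.le ha.le]
    · have e1 : a ^ (α + 1) * a ^ (-α) = a := by
        rw [← Real.rpow_add ha]; norm_num
      have e2 : a ^ γ * a ^ (1 - γ) = a := by
        rw [← Real.rpow_add ha]; norm_num
      congr 1
      calc _ = C / n * (K ^ (-α) * a / α + K ^ (1 - γ) * a / (γ - 1)) := by ring
        _ = C / n * (K ^ (-α) * (a ^ (α + 1) * a ^ (-α)) / α +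
            K ^ (1 - γ) * (a ^ γ * a ^ (1 - γ)) / (γ - 1)) := by rw [e1, e2]
        _ = _ := by ring
    · filter_upwards [ae_restrict_mem measurableSet_Ioi] with t ht
      have : 0 < t := ht
      simp only [Pi.zero_apply]
      positivity
  rw [hval]
  refine setLIntegral_mono' measurableSet_Ioi fun t ht => ?_
  have ht0 : 0 < t := ht
  have h3 : P {ω | t < (U ω : ℝ) - min (U ω : ℝ) (K * a)} ≤ ENNReal.ofReal (tail P U (t + K * a)) := by
    unfold tail
    rw [ofReal_measureReal]
    refine measure_mono fun ω hω => ?_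
    simp only [Set.mem_ofPred_eq] at hω ⊢
    rcases min_choice (U ω : ℝ) (K * a) with h4 | h4 <;> rw [h4] at hω <;> linarith
  refine h3.trans (ENNReal.ofReal_le_ofReal ((h _ (by positivity)).trans (le_of_eq ?_)))
  rw [Real.div_rpow (by positivity) ha.le, Real.div_rpow (by positivity) ha.le, Real.rpow_neg ha.le,
    Real.rpow_neg ha.le γ, div_inv_eq_mul, div_inv_eq_mul]
  ring

end TruncatedMoments

/-! ### Random linear combinations of independent centred variables -/

section ConditionalSecondMoment

variable {Ω : Type*} [MeasurableSpace Ω] {P : Measure Ω} [IsProbabilityMeasure P]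
  {ι : Type*} {V : ι → Ω → ℝ} {i₀ : ι}

/-- The variance of a linear combination of independent centred variables of common law. -/
lemma integral_sum_mul_sq (hV : iIndepFun V P) (hVi : ∀ i, IdentDistrib (V i) (V i₀) P P)
    (hV2 : MemLp (V i₀) 2 P) (hV0 : ∫ ω, V i₀ ω ∂P = 0) (F : Finset ι) (r : ι → ℝ) :
    ∫ ω, (∑ i ∈ F, V i ω * r i) ^ 2 ∂P = (∫ ω, V i₀ ω ^ 2 ∂P) * ∑ i ∈ F, r i ^ 2 := by
  have hm : ∀ i, MemLp (V i) 2 P := fun i => (hVi i).symm.memLp_snd hV2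
  have hm' : ∀ i, MemLp (fun ω => V i ω * r i) 2 P := fun i => (hm i).mul_const (r i)
  have h0 : ∀ i, ∫ ω, V i ω ∂P = 0 := fun i => ((hVi i).integral_eq).trans hV0
  have hv := IndepFun.variance_sum (μ := P) (X := fun i ω => V i ω * r i) (s := F)
    (fun i _ => hm' i) (fun i _ j _ hij =>
      (hV.indepFun hij).comp (measurable_id.mul_const (r i)) (measurable_id.mul_const (r j)))
  have hs : (∑ i ∈ F, fun ω => V i ω * r i) = fun ω => ∑ i ∈ F, V i ω * r i := by
    ext ω; simp
  rw [hs, variance_of_integral_eq_zero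
    (memLp_finsetSum F fun i _ => hm' i).aestronglyMeasurable.aemeasurable] at hv
  · rw [hv, Finset.mul_sum]
    refine Finset.sum_congr rfl fun i _ => ?_
    rw [variance_of_integral_eq_zero (hm' i).aestronglyMeasurable.aemeasurable
      (by rw [integral_mul_const, h0, zero_mul])]
    simp_rw [mul_pow]
    rw [integral_mul_const]
    congr 1
    exact ((hVi i).comp (measurable_id.pow_const 2)).integral_eq
  · rw [integral_finsetSum _ fun i _ => (hm' i).integrable (by norm_num)]
    exact Finset.sum_eq_zero fun i _ => by rw [integral_mul_const, h0, zero_mul]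

lemma lintegral_enorm_sum_mul_sq (hV : iIndepFun V P)
    (hVi : ∀ i, IdentDistrib (V i) (V i₀) P P)
    (hV2 : MemLp (V i₀) 2 P) (hV0 : ∫ ω, V i₀ ω ∂P = 0) (F : Finset ι) (r : ι → ℂ) :
    ∫⁻ ω, ENNReal.ofReal (‖∑ i ∈ F, (V i ω : ℂ) * r i‖ ^ 2) ∂P =
      ENNReal.ofReal ((∫ ω, V i₀ ω ^ 2 ∂P) * ∑ i ∈ F, ‖r i‖ ^ 2) := by
  have hm : ∀ i, MemLp (V i) 2 P := fun i => (hVi i).symm.memLp_snd hV2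
  have hsq : ∀ r : ι → ℝ, Integrable (fun ω => (∑ i ∈ F, V i ω * r i) ^ 2) P := fun r =>
    (memLp_finsetSum F fun i _ => (hm i).mul_const (r i)).integrable_sq
  have hn : ∀ ω, ‖∑ i ∈ F, (V i ω : ℂ) * r i‖ ^ 2 =
      (∑ i ∈ F, V i ω * (r i).re) ^ 2 + (∑ i ∈ F, V i ω * (r i).im) ^ 2 := by
    intro ω
    rw [← Complex.normSq_eq_norm_sq, Complex.normSq_apply, Complex.re_sum, Complex.im_sum]
    simp [Complex.mul_re, Complex.mul_im, sq]
  simp_rw [hn]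
  have hadd := (hsq fun i => (r i).re).add (hsq fun i => (r i).im)
  simp only [Pi.add_def] at hadd
  rw [← ofReal_integral_eq_lintegral_ofReal hadd
    (Eventually.of_forall fun ω => by positivity), integral_add (hsq _) (hsq _),
    integral_sum_mul_sq hV hVi hV2 hV0, integral_sum_mul_sq hV hVi hV2 hV0, ← mul_add,
    ← Finset.sum_add_distrib]
  congr 3
  ext i
  rw [← Complex.normSq_eq_norm_sq, Complex.normSq_apply, sq, sq]

variable {E : Type*} [MeasurableSpace E] {Y : Ω → E}

/-- Conditionally on `Y`, a linear combination of independent centred variables with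
coefficients depending on `Y` has second moment `σ² ∑ |c_i(Y)|²`. -/
lemma lintegral_enorm_sum_mul_random_sq (hVm : ∀ i, Measurable (V i)) (hV : iIndepFun V P)
    (hVi : ∀ i, IdentDistrib (V i) (V i₀) P P)
    (hV2 : MemLp (V i₀) 2 P) (hV0 : ∫ ω, V i₀ ω ∂P = 0) (hY : Measurable Y)
    (hVY : IndepFun (fun ω i => V i ω) Y P) (F : Finset ι) {c : ι → E → ℂ}
    (hc : ∀ i, Measurable (c i)) :
    ∫⁻ ω, ENNReal.ofReal (‖∑ i ∈ F, (V i ω : ℂ) * c i (Y ω)‖ ^ 2) ∂P =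
      ∫⁻ ω, ENNReal.ofReal ((∫ ω, V i₀ ω ^ 2 ∂P) * ∑ i ∈ F, ‖c i (Y ω)‖ ^ 2) ∂P := by
  have hVs : Measurable fun ω i => V i ω := measurable_pi_lambda _ hVm
  have hmap := (indepFun_iff_map_prod_eq_prod_map_map hVs.aemeasurable hY.aemeasurable).1 hVY
  have hf : Measurable fun z : (ι → ℝ) × E =>
      ENNReal.ofReal (‖∑ i ∈ F, (z.1 i : ℂ) * c i z.2‖ ^ 2) := by
    refine ENNReal.measurable_ofReal.comp ((Measurable.norm ?_).pow_const 2)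
    refine Finset.measurable_sum _ fun i _ => Measurable.mul ?_ ((hc i).comp measurable_snd)
    exact Complex.measurable_ofReal.comp ((measurable_pi_apply i).comp measurable_fst)
  have hg : Measurable fun y => ENNReal.ofReal ((∫ ω, V i₀ ω ^ 2 ∂P) * ∑ i ∈ F, ‖c i y‖ ^ 2) :=
    ENNReal.measurable_ofReal.comp (measurable_const.mul
      (Finset.measurable_sum _ fun i _ => (hc i).norm.pow_const 2))
  calc ∫⁻ ω, ENNReal.ofReal (‖∑ i ∈ F, (V i ω : ℂ) * c i (Y ω)‖ ^ 2) ∂P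
      = ∫⁻ z, ENNReal.ofReal (‖∑ i ∈ F, (z.1 i : ℂ) * c i z.2‖ ^ 2)
          ∂(P.map fun ω => ((fun i => V i ω), Y ω)) := by
        rw [lintegral_map hf (hVs.prodMk hY)]
    _ = ∫⁻ y, ∫⁻ v, ENNReal.ofReal (‖∑ i ∈ F, (v i : ℂ) * c i y‖ ^ 2)
          ∂(P.map fun ω i => V i ω) ∂(P.map Y) := by
        rw [hmap, lintegral_prod_symm' _ hf]
    _ = ∫⁻ y, ENNReal.ofReal ((∫ ω, V i₀ ω ^ 2 ∂P) * ∑ i ∈ F, ‖c i y‖ ^ 2) ∂(P.map Y) := by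
        refine lintegral_congr fun y => ?_
        have hfy : Measurable fun v : ι → ℝ =>
            ENNReal.ofReal (‖∑ i ∈ F, (v i : ℂ) * c i y‖ ^ 2) := by
          refine ENNReal.measurable_ofReal.comp ((Measurable.norm ?_).pow_const 2)
          exact Finset.measurable_sum _ fun i _ =>
            (Complex.measurable_ofReal.comp (measurable_pi_apply i)).mul_const _
        rw [lintegral_map hfy hVs]
        exact lintegral_enorm_sum_mul_sq hV hVi hV2 hV0 F fun i => c i y
    _ = _ := by rw [lintegral_map hg hY]

/-- Convergence to zero in probability of normalised linear combinations with random coefficients: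
it suffices that, off an event of small probability, the sum of the squared coefficients has small
expectation compared with the square of the normalisation. -/
lemma tendstoInMeasure_sum_mul_random (hVm : ∀ i, Measurable (V i)) (hV : iIndepFun V P)
    (hVi : ∀ i, IdentDistrib (V i) (V i₀) P P)
    (hV2 : MemLp (V i₀) 2 P) (hV0 : ∫ ω, V i₀ ω ∂P = 0) (hY : Measurable Y)
    (hVY : IndepFun (fun ω i => V i ω) Y P) (F : ℕ → Finset ι) {c : ℕ → ι → E → ℂ}
    (hc : ∀ n i, Measurable (c n i)) {a : ℕ → ℝ} (ha : ∀ᶠ n in atTop, 0 < a n)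
    (h : ∀ ε > 0, ∃ (G : ℕ → Set E) (Z : ℕ → Ω → ℝ), (∀ n, MeasurableSet (G n)) ∧
      (∀ᶠ n in atTop, P.real {ω | Y ω ∉ G n} ≤ ε) ∧
      (∀ᶠ n in atTop, Integrable (Z n) P ∧ (∀ ω, 0 ≤ Z n ω) ∧
        ∀ᵐ ω ∂P, Y ω ∈ G n → ∑ i ∈ F n, ‖c n i (Y ω)‖ ^ 2 ≤ Z n ω) ∧
      Tendsto (fun n => (∫ ω, Z n ω ∂P) / a n ^ 2) atTop (nhds 0)) :
    TendstoInMeasure P (fun n ω => (((a n)⁻¹ : ℝ) : ℂ) * ∑ i ∈ F n, (V i ω : ℂ) * c n i (Y ω))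
      atTop (fun _ => 0) := by
  set σ := ∫ ω, V i₀ ω ^ 2 ∂P with hσ
  have hσ0 : 0 ≤ σ := integral_nonneg fun ω => sq_nonneg _
  rw [tendstoInMeasure_iff_measureReal_norm]
  intro η hη
  rw [Metric.tendsto_atTop']
  have hgoal : ∀ ε > 0, ∀ᶠ n in atTop, P.real {ω | η ≤ ‖(((a n)⁻¹ : ℝ) : ℂ) *
      ∑ i ∈ F n, (V i ω : ℂ) * c n i (Y ω) - 0‖} < ε := by
    intro ε hε
    obtain ⟨G, Z, hG, hGε, hZ, hlim⟩ := h (ε / 2) (by linarith)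
    have hlim2 : Tendsto (fun n => (σ / η ^ 2) * ((∫ ω, Z n ω ∂P) / a n ^ 2)) atTop (nhds 0) := by
      simpa using hlim.const_mul (σ / η ^ 2)
    filter_upwards [hGε, hZ, ha, hlim2.eventually (gt_mem_nhds (half_pos hε))]
      with n hGε ⟨hZi, hZ0, hZ⟩ ha hlt
    have hsub : {ω | η ≤ ‖(((a n)⁻¹ : ℝ) : ℂ) * ∑ i ∈ F n, (V i ω : ℂ) * c n i (Y ω) - 0‖} ⊆
        {ω | Y ω ∉ G n} ∪ {ω | ENNReal.ofReal ((η * a n) ^ 2) ≤ ENNReal.ofReal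
          (‖∑ i ∈ F n, (V i ω : ℂ) * (G n).indicator (c n i) (Y ω)‖ ^ 2)} := by
      intro ω hω
      by_cases hy : Y ω ∈ G n
      · refine Or.inr (ENNReal.ofReal_le_ofReal ?_)
        simp only [Set.mem_ofPred_eq, sub_zero, norm_mul, Complex.norm_real, norm_inv,
          Real.norm_eq_abs, abs_of_pos ha] at hω
        rw [← div_eq_inv_mul, le_div_iff₀ ha] at hω
        simp_rw [Set.indicator_of_mem hy]
        gcongr
      · exact Or.inl hy
    have hc' : ∀ i, Measurable ((G n).indicator (c n i)) := fun i => (hc n i).indicator (hG n)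
    have hcheb : P.real {ω | ENNReal.ofReal ((η * a n) ^ 2) ≤ ENNReal.ofReal
        (‖∑ i ∈ F n, (V i ω : ℂ) * (G n).indicator (c n i) (Y ω)‖ ^ 2)} ≤
        (σ / η ^ 2) * ((∫ ω, Z n ω ∂P) / a n ^ 2) := by
      have hpos : 0 < (η * a n) ^ 2 := by positivity
      have hm : Measurable fun ω => ENNReal.ofReal
          (‖∑ i ∈ F n, (V i ω : ℂ) * (G n).indicator (c n i) (Y ω)‖ ^ 2) := by
        refine ENNReal.measurable_ofReal.comp ((Measurable.norm ?_).pow_const 2)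
        exact Finset.measurable_sum _ fun i _ =>
          (Complex.measurable_ofReal.comp (hVm i)).mul ((hc' i).comp hY)
      have h1 := meas_ge_le_lintegral_div (μ := P) hm.aemeasurable
        (ENNReal.ofReal_pos.2 hpos).ne' ENNReal.ofReal_ne_top
      rw [lintegral_enorm_sum_mul_random_sq hVm hV hVi hV2 hV0 hY hVY (F n) hc'] at h1
      have h2 : ∫⁻ ω, ENNReal.ofReal (σ * ∑ i ∈ F n, ‖(G n).indicator (c n i) (Y ω)‖ ^ 2) ∂P ≤
          ENNReal.ofReal (σ * ∫ ω, Z n ω ∂P) := by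
        rw [← integral_const_mul, ofReal_integral_eq_lintegral_ofReal (hZi.const_mul σ)
          (Eventually.of_forall fun ω => mul_nonneg hσ0 (hZ0 ω))]
        refine lintegral_mono_ae ?_
        filter_upwards [hZ] with ω hω
        refine ENNReal.ofReal_le_ofReal (mul_le_mul_of_nonneg_left ?_ hσ0)
        by_cases hy : Y ω ∈ G n
        · simp_rw [Set.indicator_of_mem hy]
          exact hω hy
        · simp_rw [Set.indicator_of_notMem hy]
          simpa using hZ0 ω
      have hi0 : 0 ≤ ∫ ω, Z n ω ∂P := integral_nonneg hZ0
      refine ENNReal.toReal_le_of_le_ofReal (by positivity) (h1.trans ?_)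
      refine (ENNReal.div_le_div_right h2 _).trans (le_of_eq ?_)
      rw [← ENNReal.ofReal_div_of_pos hpos, mul_pow]
      congr 1
      rw [div_mul_div_comm]
    calc _ ≤ _ := measureReal_mono hsub
      _ ≤ _ := measureReal_union_le _ _
      _ < ε := by linarith
  intro ε hε
  obtain ⟨N, hN⟩ := eventually_atTop.1 (hgoal ε hε)
  refine ⟨N, fun n hn => ?_⟩
  rw [Real.dist_eq, sub_zero, abs_of_nonneg measureReal_nonneg]
  exact hN n hn.le

end ConditionalSecondMoment

/-! ### Exponential sums over blocks of consecutive times -/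

/-- The exponential sum `∑ e ^ {i t x}` over the times `1 ≤ t ≤ n` with `s ≤ t < e`. -/
noncomputable def expBlock (x : ℝ) (n : ℕ) (s e : ℤ) : ℂ :=
  ∑ t ∈ Finset.Icc (1 : ℤ) n, if s ≤ t ∧ t < e then Complex.exp (Complex.I * t * x) else 0

lemma norm_exp_I_mul_mul (y x : ℝ) : ‖Complex.exp (Complex.I * y * x)‖ = 1 := by
  rw [mul_assoc, ← Complex.ofReal_mul, Complex.norm_exp_I_mul_ofReal]

lemma norm_exp_I_mul_int_mul (t : ℤ) (x : ℝ) : ‖Complex.exp (Complex.I * t * x)‖ = 1 := by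
  simpa using norm_exp_I_mul_mul t x

lemma norm_exp_sub_exp_le (y z : ℝ) {x : ℝ} (hx : 0 ≤ x) :
    ‖Complex.exp (Complex.I * y * x) - Complex.exp (Complex.I * z * x)‖ ≤ |y - z| * x := by
  have h : Complex.exp (Complex.I * y * x) - Complex.exp (Complex.I * z * x) =
      Complex.exp (Complex.I * z * x) *
        (Complex.exp (Complex.I * (((y - z) * x : ℝ) : ℂ)) - 1) := by
    rw [mul_sub, mul_one, ← Complex.exp_add]
    congr 2
    push_cast
    ring
  rw [h, norm_mul, norm_exp_I_mul_mul, one_mul]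
  refine Real.norm_exp_I_mul_ofReal_sub_one_le.trans ?_
  rw [Real.norm_eq_abs, abs_mul, abs_of_nonneg hx]

lemma expBlock_eq (x : ℝ) (n : ℕ) (s e : ℤ) : expBlock x n s e =
    ∑ t ∈ (Finset.Ico s e).filter (fun t : ℤ => 1 ≤ t ∧ t ≤ n), Complex.exp (Complex.I * t * x) := by
  rw [expBlock, ← Finset.sum_filter]
  refine Finset.sum_congr ?_ fun _ _ => rfl
  ext t
  simp only [Finset.mem_filter, Finset.mem_Icc, Finset.mem_Ico]
  tauto

lemma norm_expBlock_le (x : ℝ) (n : ℕ) (s : ℤ) (m : ℕ) : ‖expBlock x n s (s + m)‖ ≤ m := by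
  rw [expBlock_eq]
  refine (norm_sum_le _ _).trans ?_
  simp_rw [norm_exp_I_mul_int_mul]
  rw [Finset.sum_const, nsmul_eq_mul, mul_one]
  exact_mod_cast (Finset.card_filter_le _ _).trans (by simp)

/-- For blocks short compared with `1 / x`, the exponential sum is close to the block length times
its first term; the error `1` accounts for time `0`, which is not observed. -/
lemma norm_expBlock_sub_le {x : ℝ} (hx : 0 ≤ x) {n : ℕ} {s : ℤ} {m : ℕ} (hs : 0 ≤ s)
    (hsm : s + m ≤ n + 1) :
    ‖expBlock x n s (s + m) - m * Complex.exp (Complex.I * s * x)‖ ≤ (m : ℝ) ^ 2 * x + 1 := by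
  have h1 : ‖expBlock x n s (s + m) -
      ∑ t ∈ Finset.Ico s (s + m), Complex.exp (Complex.I * t * x)‖ ≤ 1 := by
    rw [expBlock_eq, ← Finset.sum_filter_add_sum_filter_not (Finset.Ico s (s + m))
      (fun t : ℤ => 1 ≤ t ∧ t ≤ n), sub_add_cancel_left, norm_neg]
    refine (norm_sum_le _ _).trans ?_
    simp_rw [norm_exp_I_mul_int_mul]
    rw [Finset.sum_const, nsmul_eq_mul, mul_one]
    have : (Finset.Ico s (s + m)).filter (fun t : ℤ => ¬ (1 ≤ t ∧ t ≤ n)) ⊆ {0} := by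
      intro t
      simp only [Finset.mem_filter, Finset.mem_Ico, Finset.mem_singleton]
      intro h
      lia
    exact_mod_cast (Finset.card_le_card this).trans (by simp)
  have h2 : ‖∑ t ∈ Finset.Ico s (s + m), Complex.exp (Complex.I * t * x) -
      m * Complex.exp (Complex.I * s * x)‖ ≤ (m : ℝ) ^ 2 * x := by
    have h3 : (m : ℂ) * Complex.exp (Complex.I * s * x) =
        ∑ t ∈ Finset.Ico s (s + m), Complex.exp (Complex.I * s * x) := by
      simp
    rw [h3, ← Finset.sum_sub_distrib]
    refine (norm_sum_le_of_le (n := fun _ => (m : ℝ) * x) _ fun t ht => ?_).trans (le_of_eq ?_)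
    · have h4 := norm_exp_sub_exp_le (t : ℝ) (s : ℝ) hx
      push_cast at h4
      refine h4.trans (mul_le_mul_of_nonneg_right ?_ hx)
      rw [Finset.mem_Ico] at ht
      have h5 : (s : ℝ) ≤ t := by exact_mod_cast ht.1
      have h6 : (t : ℝ) ≤ s + m := by exact_mod_cast ht.2.le
      rw [abs_of_nonneg (by linarith)]
      linarith
    · rw [Finset.sum_const]
      simp
      ring
  calc _ = ‖(expBlock x n s (s + m) -
      ∑ t ∈ Finset.Ico s (s + m), Complex.exp (Complex.I * t * x)) +
      (∑ t ∈ Finset.Ico s (s + m), Complex.exp (Complex.I * t * x) -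
      m * Complex.exp (Complex.I * s * x))‖ := by ring_nf
    _ ≤ _ := (norm_add_le _ _).trans (by linarith)

/-- The Fourier transform of a superposition of block functions. -/
lemma dft_eq_sum_expBlock {Ω ι : Type*} {X : ℤ → Ω → ℝ} {n j : ℕ} {ω : Ω} {F : Finset ι}
    {V : ι → ℝ} {s e : ι → ℤ}
    (hX : ∀ t ∈ Finset.Icc (1 : ℤ) n, X t ω = ∑ i ∈ F, if s i ≤ t ∧ t < e i then V i else 0) :
    dft X n j ω = ∑ i ∈ F, (V i : ℂ) * expBlock (fourierFreq n j) n (s i) (e i) := by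
  have h1 : dft X n j ω = ∑ t ∈ Finset.Icc (1 : ℤ) n,
      (X t ω : ℂ) * Complex.exp (Complex.I * t * fourierFreq n j) := by
    unfold dft
    refine Finset.sum_nbij (fun t : ℕ => (t : ℤ)) ?_ ?_ ?_ ?_
    · intro t ht; simp only [Finset.mem_Icc] at ht ⊢; lia
    · intro a _ b _ h; exact Nat.cast_injective h
    · intro t ht
      simp only [Finset.coe_Icc, Set.mem_Icc] at ht
      exact ⟨t.toNat, by simp only [Finset.coe_Icc, Set.mem_Icc]; lia, by
        simp only; lia⟩
    · intro t _; simp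
  rw [h1]
  simp_rw [expBlock, Finset.mul_sum]
  rw [Finset.sum_comm]
  refine Finset.sum_congr rfl fun t ht => ?_
  rw [hX t ht, Complex.ofReal_sum, Finset.sum_mul]
  refine Finset.sum_congr rfl fun i _ => ?_
  split_ifs <;> simp

lemma fourierFreq_nonneg (n j : ℕ) : 0 ≤ fourierFreq n j := by
  unfold fourierFreq
  positivity

/-! ### Asymptotics of the normalising sequence -/

section Asymptotics

variable {Ω : Type*} [MeasurableSpace Ω] {P : Measure Ω} [IsProbabilityMeasure P] {U : Ω → ℕ}
  {α : ℝ}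

omit [IsProbabilityMeasure P] in
lemma ell_inv_mul {n : ℕ} (hn : 1 ≤ n) :
    (ell P U α n)⁻¹ * (n : ℝ) ^ (-(1 / α)) = (tailQuantile P U n)⁻¹ := by
  have hn' : (0 : ℝ) < n := by exact_mod_cast hn
  have : (n : ℝ) ^ (-(1 / α)) ≠ 0 := (Real.rpow_pos_of_pos hn' _).ne'
  rw [ell, mul_inv]
  field_simp

/-- A typical block, of length comparable with `a_n`, is short compared with the period of the
Fourier frequency as soon as `j n ≤ n ^ ρ` with `ρ < 1 - 1 / α`. -/
lemma RegVarTail.tendsto_quantile_mul_freq (hU : RegVarTail P U α) (hα : 0 < α) {ρ : ℝ}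
    (hρ : ρ < 1 - 1 / α) {j : ℕ → ℕ} (hj : ∀ᶠ n : ℕ in atTop, (j n : ℝ) ≤ (n : ℝ) ^ ρ) :
    Tendsto (fun n : ℕ => tailQuantile P U n * fourierFreq n (j n)) atTop (nhds 0) := by
  have h1 := (hU.tendsto_quantile_mul_rpow hα (s := 1 - ρ) (by linarith)).const_mul (2 * Real.pi)
  rw [mul_zero] at h1
  refine tendsto_of_tendsto_of_tendsto_of_le_of_le' tendsto_const_nhds h1
    (Eventually.of_forall fun n => mul_nonneg (tailQuantile_nonneg n) (fourierFreq_nonneg _ _)) ?_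
  filter_upwards [hj, eventually_ge_atTop 1] with n hj hn
  have hn' : (0 : ℝ) < n := by exact_mod_cast hn
  have h2 : fourierFreq n (j n) ≤ 2 * Real.pi * (n : ℝ) ^ (-(1 - ρ)) := by
    unfold fourierFreq
    rw [neg_sub, Real.rpow_sub hn', Real.rpow_one, ← mul_div_assoc]
    gcongr
  calc _ ≤ tailQuantile P U n * (2 * Real.pi * (n : ℝ) ^ (-(1 - ρ))) :=
        mul_le_mul_of_nonneg_left h2 (tailQuantile_nonneg n)
    _ = _ := by ring

lemma RegVarTail.tendsto_quantile_div (hU : RegVarTail P U α) (hα1 : 1 < α) :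
    Tendsto (fun n : ℕ => tailQuantile P U n / n) atTop (nhds 0) := by
  refine (hU.tendsto_quantile_mul_rpow (by linarith) (s := 1)
    (by rw [div_lt_one (by linarith)]; exact hα1)).congr fun n => ?_
  rw [Real.rpow_neg_one, div_eq_mul_inv]

/-- With probability close to one, none of `O(n)` copies of `U` exceeds a large multiple
of `a_n`. -/
lemma RegVarTail.exists_forall_le (hU : RegVarTail P U α) (hα : 0 < α) {ι : Type*}
    {V : ι → Ω → ℕ} {i₀ : ι}
    (hV : ∀ i, IdentDistrib (V i) (V i₀) P P) (hVU : V i₀ = U)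
    {F : ℕ → Finset ι} (hF : ∀ᶠ n : ℕ in atTop, (F n).card ≤ 2 * n) {ε : ℝ} (hε : 0 < ε) :
    ∃ K > 0, ∀ᶠ n : ℕ in atTop,
      P.real {ω | ¬ ∀ i ∈ F n, (V i ω : ℝ) ≤ K * tailQuantile P U n} ≤ ε := by
  have h1 : Tendsto (fun K : ℝ => 2 * K ^ (-α)) atTop (nhds 0) := by
    simpa using (tendsto_rpow_neg_atTop hα).const_mul 2
  obtain ⟨K, hK, hK0⟩ := ((h1.eventually (gt_mem_nhds hε)).and (eventually_gt_atTop 0)).exists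
  refine ⟨K, hK0, ?_⟩
  filter_upwards [((hU.tendsto_mul_tail hα hK0).const_mul 2).eventually (gt_mem_nhds hK), hF]
    with n hn hF
  have hsub : {ω | ¬ ∀ i ∈ F n, (V i ω : ℝ) ≤ K * tailQuantile P U n} ⊆
      ⋃ i ∈ F n, {ω | K * tailQuantile P U n < (V i ω : ℝ)} := by
    intro ω hω
    simp only [Set.mem_ofPred_eq, not_forall, not_le] at hω
    obtain ⟨i, hi, hlt⟩ := hω
    exact Set.mem_biUnion hi hlt
  have hid : ∀ i, P.real {ω | K * tailQuantile P U n < (V i ω : ℝ)} =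
      tail P U (tailQuantile P U n * K) := by
    intro i
    have := (hV i).measure_mem_eq (s := {k : ℕ | K * tailQuantile P U n < (k : ℝ)})
      (by measurability)
    rw [mul_comm _ K]
    nth_rewrite 2 [← hVU]
    exact congrArg ENNReal.toReal this
  calc _ ≤ _ := measureReal_mono hsub (measure_ne_top _ _)
    _ ≤ ∑ i ∈ F n, P.real {ω | K * tailQuantile P U n < (V i ω : ℝ)} :=
      measureReal_biUnion_finset_le _ _
    _ = (F n).card * tail P U (tailQuantile P U n * K) := by simp [hid]
    _ ≤ (2 * n : ℕ) * tail P U (tailQuantile P U n * K) := by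
      have := (hU.tail_pos (tailQuantile P U n * K)).le
      gcongr
    _ ≤ ε := by push_cast; linarith

end Asymptotics

lemma tendstoInMeasure_add_of_zero {Ω : Type*} [MeasurableSpace Ω] {P : Measure Ω}
    [IsFiniteMeasure P] {f g : ℕ → Ω → ℂ} (hf : TendstoInMeasure P f atTop (fun _ => 0))
    (hg : TendstoInMeasure P g atTop (fun _ => 0)) :
    TendstoInMeasure P (fun n ω => f n ω + g n ω) atTop (fun _ => 0) := by
  rw [tendstoInMeasure_iff_measureReal_norm] at hf hg ⊢
  intro η hη
  have h := (hf (η / 2) (by linarith)).add (hg (η / 2) (by linarith))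
  rw [add_zero] at h
  refine squeeze_zero (fun _ => measureReal_nonneg) (fun n => ?_) h
  refine (measureReal_mono ?_).trans (measureReal_union_le _ _)
  intro ω hω
  simp only [sub_zero, Set.mem_union, Set.mem_ofPred_eq] at hω ⊢
  by_contra hcon
  push Not at hcon
  linarith [norm_add_le (f n ω) (g n ω)]

/-! ### The Parke model -/

section Parke

variable {Ω : Type*} [MeasurableSpace Ω] {P : Measure Ω} [IsProbabilityMeasure P]
  {α : ℝ} {N : ℤ → Ω → ℕ} {ε : ℤ → Ω → ℝ}

/-- Almost surely only finitely many shocks before time `t` survive until time `t`. -/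
lemma IsParkeModel.ae_eventually_lt (h : IsParkeModel P α N ε) (hα1 : 1 < α) (t : ℤ) :
    ∀ᵐ ω ∂P, ∀ᶠ m : ℕ in atTop, N (t - m) ω < m := by
  obtain ⟨γ, hγ1, hγ2⟩ := exists_between hα1
  obtain ⟨C, hC, hle⟩ := h.tail_N.regVaryingTail.le_rpow (one_pos.trans hγ1).le hγ2
  have hP : ∀ m : ℕ, P {ω | ¬ N (t - m) ω < m} = P {ω | m ≤ N 0 ω} := by
    intro m
    have := (h.identDistrib_N (t - m)).measure_mem_eq (s := {k : ℕ | m ≤ k})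
      MeasurableSet.of_discrete
    simp only [not_lt]
    exact this
  have hsum : ∑' m : ℕ, P {ω | ¬ N (t - m) ω < m} ≠ ⊤ := by
    simp_rw [hP]
    have hbd : ∀ m : ℕ, P {ω | m + 1 ≤ N 0 ω} ≤ ENNReal.ofReal (C * ((m + 1 : ℕ) : ℝ) ^ (-γ) * 2 ^ γ) := by
      intro m
      have hm : (0 : ℝ) < ((m + 1 : ℕ) : ℝ) := by positivity
      have h1 := hle (((m + 1 : ℕ) : ℝ) / 2) (by positivity)
      rw [Real.div_rpow hm.le (by norm_num), Real.rpow_neg two_pos.le, div_inv_eq_mul,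
        ← mul_assoc] at h1
      refine le_trans ?_ (ENNReal.ofReal_le_ofReal h1)
      rw [tail, ofReal_measureReal]
      refine measure_mono fun ω hω => ?_
      have h2 : ((m + 1 : ℕ) : ℝ) ≤ N 0 ω := by exact_mod_cast hω
      simp only [Set.mem_ofPred_eq]
      linarith
    have hs : Summable fun m : ℕ => C * ((m + 1 : ℕ) : ℝ) ^ (-γ) * 2 ^ γ :=
      (((Real.summable_nat_rpow.2 (by linarith : -γ < -1)).comp_injective
        (add_left_injective 1)).mul_left C).mul_right _
    rw [tsum_eq_zero_add' ENNReal.summable]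
    refine ENNReal.add_ne_top.2 ⟨measure_ne_top _ _, ne_top_of_le_ne_top ?_ (ENNReal.tsum_le_tsum hbd)⟩
    rw [← ENNReal.ofReal_tsum_of_nonneg (fun m => by positivity) hs]
    exact ENNReal.ofReal_ne_top
  filter_upwards [ae_eventually_notMem hsum] with ω hω
  filter_upwards [hω] with m hm
  simpa using hm

omit [MeasurableSpace Ω] in
lemma parke_eq_sum {ω : Ω} {t₀ n : ℤ} {M : ℕ} (hM : ∀ m : ℕ, M ≤ m → N (t₀ - m) ω < m) {t : ℤ}
    (ht : t₀ ≤ t) (htn : t ≤ n) :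
    parke N ε t ω = ∑ s ∈ Finset.Icc (t₀ - M) n,
      if s ≤ t ∧ t < s + ((N s ω + 1 : ℕ) : ℤ) then ε s ω else 0 := by
  classical
  unfold parke
  rw [tsum_eq_sum (s := Finset.Icc (t₀ - M) n)]
  · refine Finset.sum_congr rfl fun s _ => ?_
    refine if_congr ?_ rfl rfl
    push_cast
    constructor <;> intro h <;> lia
  · intro s hs
    rw [if_neg]
    rintro ⟨h1, h2⟩
    rw [Finset.mem_Icc, not_and_or, not_le, not_le] at hs
    rcases hs with hs | hs
    · have h3 := hM (t₀ - s).toNat (by lia)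
      rw [show t₀ - ((t₀ - s).toNat : ℤ) = s by lia] at h3
      lia
    · lia

lemma IsParkeModel.aemeasurable (h : IsParkeModel P α N ε) (hα1 : 1 < α) (t : ℤ) :
    AEMeasurable (parke N ε t) P := by
  refine aemeasurable_of_tendsto_metrizable_ae atTop (f := fun (M : ℕ) ω =>
    ∑ s ∈ Finset.Icc (t - M) t,
      if s ≤ t ∧ t < s + ((N s ω + 1 : ℕ) : ℤ) then ε s ω else 0) (fun M => ?_) ?_
  · refine Measurable.aemeasurable (Finset.measurable_sum _ fun s _ => ?_)
    refine Measurable.ite ?_ (h.measurable_ε s) measurable_const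
    exact h.measurable_N s (MeasurableSet.of_discrete (s := {k : ℕ | s ≤ t ∧
      t < s + ((k + 1 : ℕ) : ℤ)}))
  · filter_upwards [h.ae_eventually_lt hα1 t] with ω hω
    obtain ⟨M, hM⟩ := eventually_atTop.1 hω
    refine tendsto_atTop_of_eventually_const (i₀ := M) fun i hi => ?_
    exact (parke_eq_sum (fun m hm => hM m (hi.trans hm)) le_rfl le_rfl).symm

lemma IsParkeModel.aemeasurable_dft (h : IsParkeModel P α N ε) (hα1 : 1 < α) (n j : ℕ) :
    AEMeasurable (dft (parke N ε) n j) P := by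
  unfold dft
  exact Finset.aemeasurable_fun_sum _ fun t _ =>
    (Complex.measurable_ofReal.comp_aemeasurable (h.aemeasurable hα1 t)).mul_const _

/-- The error made by replacing the contribution of the shock at time `s` to the Fourier transform
by its contribution to the approximating sum, as a function of the survival times. -/
noncomputable def parkeCoeff (j : ℕ → ℕ) (n : ℕ) (s : ℤ) (N : ℤ → ℕ) : ℂ :=
  expBlock (fourierFreq n (j n)) n s (s + ((N s + 1 : ℕ) : ℤ)) -
    (N s : ℂ) * Complex.exp (Complex.I * s * fourierFreq n (j n))

lemma measurable_parkeCoeff (j : ℕ → ℕ) (n : ℕ) (s : ℤ) : Measurable (parkeCoeff j n s) := by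
  have : parkeCoeff j n s = (fun k : ℕ => expBlock (fourierFreq n (j n)) n s (s + ((k + 1 : ℕ) : ℤ)) -
    (k : ℂ) * Complex.exp (Complex.I * s * fourierFreq n (j n))) ∘ fun N : ℤ → ℕ => N s := rfl
  rw [this]
  exact measurable_from_top.comp (measurable_pi_apply s)

lemma norm_parkeCoeff_sq_le {j : ℕ → ℕ} {n : ℕ} {s : ℤ} {N : ℤ → ℕ} {b : ℝ}
    (hNb : (N s : ℝ) ≤ b) :
    ‖parkeCoeff j n s N‖ ^ 2 ≤ 8 * min (N s : ℝ) b ^ 2 + 2 := by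
  have h1 : ‖parkeCoeff j n s N‖ ≤ 2 * N s + 1 := by
    refine (norm_sub_le _ _).trans ?_
    have h2 := norm_expBlock_le (fourierFreq n (j n)) n s (N s + 1)
    rw [norm_mul, norm_exp_I_mul_int_mul]
    push_cast at h2 ⊢
    simp only [Complex.norm_natCast]
    linarith
  rw [min_eq_left hNb]
  calc _ ≤ (2 * (N s : ℝ) + 1) ^ 2 := by gcongr
    _ ≤ _ := by nlinarith [sq_nonneg (2 * (N s : ℝ) - 1)]

lemma norm_parkeCoeff_sq_le_of_add_le {j : ℕ → ℕ} {n : ℕ} {s : ℤ} {N : ℤ → ℕ} {b : ℝ}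
    (hNb : (N s : ℝ) ≤ b) (hs : 1 ≤ s) (hsb : s + b ≤ n) :
    ‖parkeCoeff j n s N‖ ^ 2 ≤
      4 * (min (N s : ℝ) b ^ 2 + 1) * ((b + 1) * fourierFreq n (j n)) ^ 2 + 8 := by
  set x := fourierFreq n (j n) with hx
  have hx0 : 0 ≤ x := fourierFreq_nonneg _ _
  have hsN : s + ((N s + 1 : ℕ) : ℤ) ≤ n + 1 := by
    have : (s : ℝ) + (N s : ℝ) ≤ n := by linarith
    have h2 : s + (N s : ℤ) ≤ n := by exact_mod_cast this
    push_cast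
    linarith
  have h1 : ‖parkeCoeff j n s N‖ ≤ ((N s : ℝ) + 1) * ((b + 1) * x) + 2 := by
    have h2 := norm_expBlock_sub_le hx0 (by lia : 0 ≤ s) hsN
    have h3 : parkeCoeff j n s N = (expBlock x n s (s + ((N s + 1 : ℕ) : ℤ)) -
        ((N s + 1 : ℕ) : ℂ) * Complex.exp (Complex.I * s * x)) +
        Complex.exp (Complex.I * s * x) := by
      unfold parkeCoeff
      push_cast
      ring
    rw [h3]
    refine (norm_add_le _ _).trans ?_
    rw [norm_exp_I_mul_int_mul]
    have h4 : ((N s + 1 : ℕ) : ℝ) ^ 2 * x ≤ ((N s : ℝ) + 1) * ((b + 1) * x) := by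
      push_cast
      calc ((N s : ℝ) + 1) ^ 2 * x = ((N s : ℝ) + 1) * (((N s : ℝ) + 1) * x) := by ring
        _ ≤ _ := by gcongr
    linarith
  rw [min_eq_left hNb]
  set u := (b + 1) * x
  calc _ ≤ (((N s : ℝ) + 1) * u + 2) ^ 2 := by gcongr
    _ ≤ 2 * (((N s : ℝ) + 1) * u) ^ 2 + 8 := by nlinarith [sq_nonneg (((N s : ℝ) + 1) * u - 2)]
    _ = 2 * ((N s : ℝ) + 1) ^ 2 * u ^ 2 + 8 := by ring
    _ ≤ _ := by
      have : 2 * ((N s : ℝ) + 1) ^ 2 ≤ 4 * ((N s : ℝ) ^ 2 + 1) := by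
        nlinarith [sq_nonneg ((N s : ℝ) - 1)]
      gcongr

lemma card_filter_Icc_lt_add_le (n : ℕ) {b : ℝ} (hb : 0 ≤ b) :
    (((Finset.Icc (1 : ℤ) n).filter fun s : ℤ => (n : ℝ) < s + b).card : ℝ) ≤ b + 1 := by
  have hsub : ((Finset.Icc (1 : ℤ) n).filter fun s : ℤ => (n : ℝ) < s + b) ⊆
      Finset.Icc ((n : ℤ) - ⌊b⌋₊) n := by
    intro s hs
    simp only [Finset.mem_filter, Finset.mem_Icc] at hs ⊢
    refine ⟨?_, hs.1.2⟩
    have h1 := hs.2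
    have h2 : ((n - s : ℤ) : ℝ) < ⌊b⌋₊ + 1 := by
      push_cast
      have := Nat.lt_floor_add_one b
      linarith
    have h3 : (n - s : ℤ) < ⌊b⌋₊ + 1 := by exact_mod_cast h2
    lia
  have h1 : ((Finset.Icc ((n : ℤ) - ⌊b⌋₊) n).card : ℝ) = ⌊b⌋₊ + 1 := by
    rw [Int.card_Icc]
    have : (n + 1 - ((n : ℤ) - ⌊b⌋₊)).toNat = ⌊b⌋₊ + 1 := by lia
    rw [this]
    push_cast
    ring
  calc _ ≤ ((Finset.Icc ((n : ℤ) - ⌊b⌋₊) n).card : ℝ) := by exact_mod_cast Finset.card_le_card hsub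
    _ = ⌊b⌋₊ + 1 := h1
    _ ≤ _ := by linarith [Nat.floor_le hb]

/-- The contribution of the shocks after time `0` to the Fourier transform is approximated in
probability. -/
lemma IsParkeModel.tendstoInMeasure_sum_parkeCoeff (h : IsParkeModel P α N ε) (hα1 : 1 < α)
    (hα2 : α < 2) {ρ : ℝ} (hρ : ρ < 1 - 1 / α) {j : ℕ → ℕ}
    (hj : ∀ᶠ n : ℕ in atTop, (j n : ℝ) ≤ (n : ℝ) ^ ρ) :
    TendstoInMeasure P (fun (n : ℕ) ω => (((tailQuantile P (N 0) n)⁻¹ : ℝ) : ℂ) *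
      ∑ s ∈ Finset.Icc (1 : ℤ) n, (ε s ω : ℂ) * parkeCoeff j n s (fun s => N s ω))
      atTop (fun _ => 0) := by
  have hα0 : 0 < α := by linarith
  have hU := h.tail_N
  set a := tailQuantile P (N 0) with ha
  have hatop : Tendsto a atTop atTop := hU.tendsto_quantile hα0
  have hY : Measurable fun ω s => N s ω := measurable_pi_lambda _ h.measurable_N
  refine tendstoInMeasure_sum_mul_random h.measurable_ε h.indep_ε h.identDistrib_ε
    h.sq_integrable_ε h.mean_ε hY h.indep_N_ε.symm (fun n => Finset.Icc (1 : ℤ) n)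
    (c := parkeCoeff j) (measurable_parkeCoeff j) (hatop.eventually_gt_atTop 0) fun δ hδ => ?_
  obtain ⟨K, hK, hKn⟩ := hU.exists_forall_le hα0 h.identDistrib_N rfl
    (F := fun n : ℕ => Finset.Icc (1 : ℤ) n) (Eventually.of_forall fun n => by simp; lia) hδ
  obtain ⟨C, hC, hCn⟩ := hU.truncated_sq (h.measurable_N 0) hα1 hα2 hK
  -- the truncated survival times and the bound for the sum of squares
  set T : ℕ → ℤ → Ω → ℝ := fun n s ω => min (N s ω : ℝ) (K * a n) with hT
  set x : ℕ → ℝ := fun n => fourierFreq n (j n) with hx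
  -- the second sum is over the shocks that may survive beyond time `n`
  set Z : ℕ → Ω → ℝ := fun n ω =>
    ∑ s ∈ Finset.Icc (1 : ℤ) n, (4 * (T n s ω ^ 2 + 1) * ((K * a n + 1) * x n) ^ 2 + 8) +
    ∑ s ∈ (Finset.Icc (1 : ℤ) n).filter (fun s : ℤ => (n : ℝ) < s + K * a n),
      (8 * T n s ω ^ 2 + 2) with hZ
  have hTm : ∀ n s, Measurable (T n s) := fun n s =>
    (measurable_from_top.comp (h.measurable_N s) : Measurable fun ω => (N s ω : ℝ)).min
      measurable_const
  have hTi : ∀ n s, 0 ≤ a n → Integrable (fun ω => T n s ω ^ 2) P := fun n s han => by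
    refine Integrable.of_bound (C := (K * a n) ^ 2) ((hTm n s).pow_const 2).aestronglyMeasurable
      (Eventually.of_forall fun ω => ?_)
    rw [Real.norm_eq_abs, abs_of_nonneg (sq_nonneg _)]
    have : 0 ≤ T n s ω := le_min (Nat.cast_nonneg _) (by positivity)
    gcongr
    exact min_le_right _ _
  have hTe : ∀ n s, ∫ ω, T n s ω ^ 2 ∂P = ∫ ω, T n 0 ω ^ 2 ∂P := fun n s =>
    ((h.identDistrib_N s).comp (u := fun k : ℕ => min (k : ℝ) (K * a n) ^ 2)
      measurable_from_top).integral_eq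
  have hZi : ∀ n, 0 ≤ a n → Integrable (Z n) P := fun n han => by
    refine (integrable_finsetSum _ fun s _ => ?_).add (integrable_finsetSum _ fun s _ => ?_)
    · exact ((((hTi n s han).add (integrable_const 1)).const_mul 4).mul_const _).add
        (integrable_const 8)
    · exact ((hTi n s han).const_mul 8).add (integrable_const 2)
  have hZint : ∀ n, 0 ≤ a n → ∫ ω, Z n ω ∂P ≤
      n * (4 * (∫ ω, T n 0 ω ^ 2 ∂P + 1) * ((K * a n + 1) * x n) ^ 2 + 8) +
      (K * a n + 1) * (8 * ∫ ω, T n 0 ω ^ 2 ∂P + 2) := fun n han => by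
    have i1 : ∀ s, Integrable (fun ω =>
        4 * (T n s ω ^ 2 + 1) * ((K * a n + 1) * x n) ^ 2 + 8) P := fun s =>
      ((((hTi n s han).add (integrable_const 1)).const_mul 4).mul_const _).add (integrable_const 8)
    have i2 : ∀ s, Integrable (fun ω => 8 * T n s ω ^ 2 + 2) P := fun s =>
      ((hTi n s han).const_mul 8).add (integrable_const 2)
    have e1 : ∀ s, ∫ ω, (4 * (T n s ω ^ 2 + 1) * ((K * a n + 1) * x n) ^ 2 + 8) ∂P =
        4 * (∫ ω, T n 0 ω ^ 2 ∂P + 1) * ((K * a n + 1) * x n) ^ 2 + 8 := fun s => by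
      have j1 : Integrable (fun ω => T n s ω ^ 2 + 1) P := (hTi n s han).add (integrable_const 1)
      rw [integral_add ((j1.const_mul 4).mul_const _) (integrable_const 8), integral_mul_const,
        integral_const_mul, integral_add (hTi n s han) (integrable_const 1), hTe]
      simp
    have e2 : ∀ s, ∫ ω, (8 * T n s ω ^ 2 + 2) ∂P = 8 * ∫ ω, T n 0 ω ^ 2 ∂P + 2 := fun s => by
      rw [integral_add ((hTi n s han).const_mul 8) (integrable_const 2), integral_const_mul, hTe]
      simp
    have h0 : 0 ≤ ∫ ω, T n 0 ω ^ 2 ∂P := integral_nonneg fun ω => sq_nonneg _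
    simp only [hZ]
    rw [integral_add (integrable_finsetSum _ fun s _ => i1 s)
      (integrable_finsetSum _ fun s _ => i2 s), integral_finsetSum _ fun s _ => i1 s,
      integral_finsetSum _ fun s _ => i2 s]
    simp_rw [e1, e2]
    rw [Finset.sum_const, Finset.sum_const, nsmul_eq_mul, nsmul_eq_mul]
    have hc := card_filter_Icc_lt_add_le n (b := K * a n) (by positivity)
    have hc1 : ((Finset.Icc (1 : ℤ) n).card : ℝ) = n := by simp
    rw [hc1]
    gcongr
  refine ⟨fun n => {N | ∀ s ∈ Finset.Icc (1 : ℤ) n, (N s : ℝ) ≤ K * a n}, Z, fun n => ?_, hKn, ?_, ?_⟩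
  · have : {N : ℤ → ℕ | ∀ s ∈ Finset.Icc (1 : ℤ) n, (N s : ℝ) ≤ K * a n} =
        ⋂ s ∈ Finset.Icc (1 : ℤ) n, (fun N : ℤ → ℕ => N s) ⁻¹' {k : ℕ | (k : ℝ) ≤ K * a n} := by
      ext N
      simp
    beta_reduce
    rw [this]
    exact Finset.measurableSet_biInter _ fun s _ => measurable_pi_apply s MeasurableSet.of_discrete
  · filter_upwards [hatop.eventually_ge_atTop 0] with n han
    have hp1 : ∀ ω s, 0 ≤ 4 * (T n s ω ^ 2 + 1) * ((K * a n + 1) * x n) ^ 2 + 8 := fun ω s => by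
      positivity
    have hp2 : ∀ ω s, 0 ≤ 8 * T n s ω ^ 2 + 2 := fun ω s => by positivity
    refine ⟨hZi n han, fun ω => add_nonneg (Finset.sum_nonneg fun s _ => hp1 ω s)
      (Finset.sum_nonneg fun s _ => hp2 ω s), Eventually.of_forall fun ω hω => ?_⟩
    simp only [hZ]
    rw [Finset.sum_filter, ← Finset.sum_add_distrib]
    refine Finset.sum_le_sum fun s hs => ?_
    have hNs := hω s hs
    split_ifs with hcase
    · refine (norm_parkeCoeff_sq_le hNs).trans ?_
      linarith [hp1 ω s]
    · rw [add_zero]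
      exact norm_parkeCoeff_sq_le_of_add_le hNs (Finset.mem_Icc.1 hs).1 (not_lt.1 hcase)
  · have l1 := hU.tendsto_div_quantile_sq hα0 hα2
    have l2 := hU.tendsto_quantile_mul_freq hα0 hρ hj
    have l3 := hU.tendsto_quantile_div hα1
    have l4 : Tendsto (fun n => (a n)⁻¹) atTop (nhds 0) := tendsto_inv_atTop_zero.comp hatop
    have l5 : Tendsto (fun n : ℕ => (n : ℝ)⁻¹) atTop (nhds 0) := tendsto_inv_atTop_nhds_zero_nat
    have hlim : Tendsto (fun n : ℕ => 4 * (C + n / a n ^ 2) * ((K + (a n)⁻¹) * (a n * x n)) ^ 2 +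
        8 * (n / a n ^ 2) + 8 * C * (K * (a n / n) + (n : ℝ)⁻¹) +
        2 * (K * (a n)⁻¹ + (a n)⁻¹ ^ 2)) atTop (nhds 0) := by
      have := ((((l1.const_add C).const_mul 4).mul (((l4.const_add K).mul l2).pow 2)).add
        (l1.const_mul 8)).add (((l3.const_mul K).add l5).const_mul (8 * C)) |>.add
        (((l4.const_mul K).add (l4.pow 2)).const_mul 2)
      simpa using this
    refine tendsto_of_tendsto_of_tendsto_of_le_of_le' tendsto_const_nhds hlim ?_ ?_
    · filter_upwards [hatop.eventually_ge_atTop 0] with n han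
      refine div_nonneg (integral_nonneg fun ω => ?_) (sq_nonneg _)
      have : 0 ≤ K * a n := by positivity
      exact add_nonneg (Finset.sum_nonneg fun s _ => by positivity)
        (Finset.sum_nonneg fun s _ => by positivity)
    · filter_upwards [hatop.eventually_gt_atTop 0, hCn, eventually_ge_atTop 1] with n han hCn hn
      have hn' : (0 : ℝ) < n := by exact_mod_cast hn
      rw [div_le_iff₀ (by positivity)]
      refine (hZint n han.le).trans ?_
      have hx0 : 0 ≤ x n := fourierFreq_nonneg _ _
      calc _ ≤ n * (4 * (C * (a n ^ 2 / n) + 1) * ((K * a n + 1) * x n) ^ 2 + 8) +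
            (K * a n + 1) * (8 * (C * (a n ^ 2 / n)) + 2) := by gcongr
        _ = _ := by field_simp; ring

/-- The Fourier transform of the Parke process is approximated by the weighted sum of the
independent variables `n_k ε_k`. -/
lemma IsParkeModel.tendstoInMeasure_dft_sub (h : IsParkeModel P α N ε) (hα1 : 1 < α)
    (hα2 : α < 2) {ρ : ℝ} (hρ : ρ < 1 - 1 / α) {j : ℕ → ℕ}
    (hj : ∀ᶠ n : ℕ in atTop, (j n : ℝ) ≤ (n : ℝ) ^ ρ) :
    TendstoInMeasure P (fun (n : ℕ) ω => (((tailQuantile P (N 0) n)⁻¹ : ℝ) : ℂ) *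
      (dft (parke N ε) n (j n) ω - dftApprox (parkeEta N ε) 1 n (j n) ω)) atTop (fun _ => 0) := by
  have hα0 : 0 < α := by linarith
  set a := tailQuantile P (N 0) with ha
  have hatop : Tendsto a atTop atTop := h.tail_N.tendsto_quantile hα0
  have hmain := h.tendstoInMeasure_sum_parkeCoeff hα1 hα2 hρ hj
  set S : ℕ → Ω → ℂ := fun n ω => ∑ s ∈ Finset.Icc (1 : ℤ) n,
    (ε s ω : ℂ) * parkeCoeff j n s (fun s => N s ω) with hS
  have hSm : ∀ n, Measurable (S n) := fun n => Finset.measurable_sum _ fun s _ =>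
    (Complex.measurable_ofReal.comp (h.measurable_ε s)).mul
      ((measurable_parkeCoeff j n s).comp (measurable_pi_lambda _ h.measurable_N))
  have hdm : ∀ n, Measurable (dftApprox (parkeEta N ε) 1 n (j n)) := fun n => by
    unfold dftApprox
    refine Finset.measurable_sum _ fun s _ => Measurable.mul_const ?_ _
    refine Complex.measurable_ofReal.comp (Measurable.mul ?_ (h.measurable_ε _))
    exact measurable_from_top.comp (h.measurable_N _)
  have hrest : TendstoInMeasure P (fun (n : ℕ) ω => (((a n)⁻¹ : ℝ) : ℂ) *
      (dft (parke N ε) n (j n) ω - dftApprox (parkeEta N ε) 1 n (j n) ω - S n ω))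
      atTop (fun _ => 0) := by
    refine tendstoInMeasure_of_tendsto_ae (fun n => ?_) ?_
    · exact ((((h.aemeasurable_dft hα1 n (j n)).sub (hdm n).aemeasurable).sub
        (hSm n).aemeasurable).const_mul _).aestronglyMeasurable
    · filter_upwards [h.ae_eventually_lt hα1 1] with ω hω
      obtain ⟨M, hM⟩ := eventually_atTop.1 hω
      have hM1 : ∀ m : ℕ, M + 1 ≤ m → N (1 - m) ω < m := fun m hm => hM m (by lia)
      -- the shocks up to time `0` contribute a bounded amount, whatever the value of `n`
      have hbound : ∀ n : ℕ, ‖dft (parke N ε) n (j n) ω - dftApprox (parkeEta N ε) 1 n (j n) ω -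
          S n ω‖ ≤ ∑ s ∈ Finset.Icc (1 - ((M + 1 : ℕ) : ℤ)) 0, |ε s ω| * (N s ω + 1 : ℕ) := by
        intro n
        have h1 := dft_eq_sum_expBlock (X := parke N ε) (n := n) (j := j n) (ω := ω)
          (F := Finset.Icc (1 - ((M + 1 : ℕ) : ℤ)) n) (V := fun s => ε s ω) (s := fun s => s)
          (e := fun s => s + ((N s ω + 1 : ℕ) : ℤ)) (fun t ht =>
            parke_eq_sum hM1 (Finset.mem_Icc.1 ht).1 (Finset.mem_Icc.1 ht).2)
        have hsplit : Finset.Icc (1 - ((M + 1 : ℕ) : ℤ)) n =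
            Finset.Icc (1 - ((M + 1 : ℕ) : ℤ)) 0 ∪ Finset.Icc 1 (n : ℤ) := by
          ext s
          simp only [Finset.mem_union, Finset.mem_Icc]
          lia
        have hdisj : Disjoint (Finset.Icc (1 - ((M + 1 : ℕ) : ℤ)) 0) (Finset.Icc 1 (n : ℤ)) := by
          rw [Finset.disjoint_left]
          intro s
          simp only [Finset.mem_Icc]
          lia
        rw [hsplit, Finset.sum_union hdisj] at h1
        have h2 : dftApprox (parkeEta N ε) 1 n (j n) ω = ∑ s ∈ Finset.Icc (1 : ℤ) n,
            (ε s ω : ℂ) * ((N s ω : ℂ) * Complex.exp (Complex.I * s * fourierFreq n (j n))) := by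
          unfold dftApprox parkeEta
          rw [div_one, Nat.floor_natCast]
          refine Finset.sum_nbij (fun t : ℕ => (t : ℤ)) ?_ ?_ ?_ ?_
          · intro t ht; simp only [Finset.mem_Icc] at ht ⊢; lia
          · intro a _ b _ h; exact Nat.cast_injective h
          · intro t ht
            simp only [Finset.coe_Icc, Set.mem_Icc] at ht
            exact ⟨t.toNat, by simp only [Finset.coe_Icc, Set.mem_Icc]; lia, by simp only; lia⟩
          · intro t _; push_cast; ring_nf
        have h3 : dft (parke N ε) n (j n) ω - dftApprox (parkeEta N ε) 1 n (j n) ω - S n ω =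
            ∑ s ∈ Finset.Icc (1 - ((M + 1 : ℕ) : ℤ)) 0, (ε s ω : ℂ) *
              expBlock (fourierFreq n (j n)) n s (s + ((N s ω + 1 : ℕ) : ℤ)) := by
          rw [h1, h2, hS]
          simp only [parkeCoeff, mul_sub]
          rw [Finset.sum_sub_distrib]
          ring
        rw [h3]
        refine norm_sum_le_of_le _ fun s _ => ?_
        rw [norm_mul, Complex.norm_real, Real.norm_eq_abs]
        gcongr
        exact norm_expBlock_le _ _ _ _
      refine squeeze_zero_norm (fun n => ?_) (a := fun n => |(a n)⁻¹| *
        ∑ s ∈ Finset.Icc (1 - ((M + 1 : ℕ) : ℤ)) 0, |ε s ω| * (N s ω + 1 : ℕ)) ?_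
      · rw [norm_mul, Complex.norm_real, Real.norm_eq_abs]
        gcongr
        exact hbound n
      · have := (tendsto_inv_atTop_zero.comp hatop).abs.mul_const
          (∑ s ∈ Finset.Icc (1 - ((M + 1 : ℕ) : ℤ)) 0, |ε s ω| * (N s ω + 1 : ℕ))
        simpa using this
  refine TendstoInMeasure.congr_left (fun n => Eventually.of_forall fun ω => ?_)
    (tendstoInMeasure_add_of_zero hmain hrest)
  simp only [hS]
  ring

end Parke

/-! ### Fluctuations of truncated renewal sums -/

/-- The centred sum of the first `m` variables truncated at `b`. -/
noncomputable def truncDev {Ω : Type*} (T : ℕ → Ω → ℕ) (μ b : ℝ) (m : ℕ) (ω : Ω) : ℝ :=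
  ∑ i ∈ Finset.range m, min (T i ω : ℝ) b - μ * m

section TruncDev

variable {Ω : Type*} [MeasurableSpace Ω] {P : Measure Ω} [IsProbabilityMeasure P]
  {α : ℝ} {T : ℕ → Ω → ℕ}

lemma measurable_trunc {U : Ω → ℕ} (hU : Measurable U) (b : ℝ) :
    Measurable fun ω => min (U ω : ℝ) b :=
  (measurable_from_top.comp hU : Measurable fun ω => (U ω : ℝ)).min measurable_const

lemma memLp_trunc {U : Ω → ℕ} (hU : Measurable U) {b : ℝ} (hb : 0 ≤ b) :
    MemLp (fun ω => min (U ω : ℝ) b) 2 P :=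
  MemLp.of_bound (measurable_trunc hU b).aestronglyMeasurable b (Eventually.of_forall fun ω => by
    rw [Real.norm_eq_abs, abs_of_nonneg (le_min (Nat.cast_nonneg _) hb)]
    exact min_le_right _ _)

omit [IsProbabilityMeasure P] in
lemma identDistrib_trunc (hTi : ∀ k, IdentDistrib (T k) (T 0) P P) (b : ℝ) (k : ℕ) :
    IdentDistrib (fun ω => min (T k ω : ℝ) b) (fun ω => min (T 0 ω : ℝ) b) P P :=
  (hTi k).comp (u := fun m : ℕ => min (m : ℝ) b) measurable_from_top

omit [IsProbabilityMeasure P] in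
lemma indep_trunc (hT : iIndepFun T P) (b : ℝ) :
    iIndepFun (fun k ω => min (T k ω : ℝ) b) P :=
  hT.comp (fun _ (m : ℕ) => min (m : ℝ) b) fun _ => measurable_from_top

lemma measurable_truncDev (hTm : ∀ k, Measurable (T k)) (μ b : ℝ) (m : ℕ) :
    Measurable (truncDev T μ b m) :=
  (Finset.measurable_sum _ fun i _ => measurable_trunc (hTm i) b).sub_const _

lemma memLp_truncDev (hTm : ∀ k, Measurable (T k)) {μ b : ℝ} (hb : 0 ≤ b) (m : ℕ) :
    MemLp (truncDev T μ b m) 2 P :=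
  (memLp_finsetSum _ fun i _ => memLp_trunc (hTm i) hb).sub (memLp_const _)

/-- Variance plus squared bias; the bias comes from centring at the untruncated mean. -/
lemma integral_truncDev_sq_le (hTm : ∀ k, Measurable (T k)) (hT : iIndepFun T P)
    (hTi : ∀ k, IdentDistrib (T k) (T 0) P P) (μ : ℝ) {b : ℝ} (hb : 0 ≤ b) (m : ℕ) :
    ∫ ω, truncDev T μ b m ω ^ 2 ∂P ≤
      m * ∫ ω, min (T 0 ω : ℝ) b ^ 2 ∂P + (m * (∫ ω, min (T 0 ω : ℝ) b ∂P - μ)) ^ 2 := by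
  have hL := memLp_truncDev (P := P) hTm (μ := μ) hb m
  have h1 := variance_eq_sub hL
  have hmean : ∫ ω, truncDev T μ b m ω ∂P = m * (∫ ω, min (T 0 ω : ℝ) b ∂P - μ) := by
    unfold truncDev
    have hi : ∀ i, Integrable (fun ω => min (T i ω : ℝ) b) P := fun i =>
      (memLp_trunc (hTm i) hb).integrable (by norm_num)
    rw [integral_sub (integrable_finsetSum _ fun i _ => hi i) (integrable_const _),
      integral_finsetSum _ fun i _ => hi i]
    simp_rw [fun i => (identDistrib_trunc hTi b i).integral_eq]
    simp
    ring
  have hvar : variance (truncDev T μ b m) P ≤ m * ∫ ω, min (T 0 ω : ℝ) b ^ 2 ∂P := by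
    have h2 := variance_sub_const (μ := P) (X := fun ω => ∑ i ∈ Finset.range m, min (T i ω : ℝ) b)
      (Finset.measurable_sum _ fun i _ => measurable_trunc (hTm i) b).aestronglyMeasurable (μ * m)
    have h3 := IndepFun.variance_sum (μ := P) (X := fun i ω => min (T i ω : ℝ) b)
      (s := Finset.range m) (fun i _ => memLp_trunc (hTm i) hb)
      (fun i _ k _ hik => (indep_trunc hT b).indepFun hik)
    have hs : (∑ i ∈ Finset.range m, fun ω => min (T i ω : ℝ) b) =
        fun ω => ∑ i ∈ Finset.range m, min (T i ω : ℝ) b := by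
      ext ω; simp
    rw [hs] at h3
    change variance (fun ω => ∑ i ∈ Finset.range m, min (T i ω : ℝ) b - μ * m) P ≤ _
    rw [h2, h3]
    simp_rw [fun i => (identDistrib_trunc hTi b i).variance_eq]
    rw [Finset.sum_const, Finset.card_range, nsmul_eq_mul]
    gcongr
    exact variance_le_expectation_sq (measurable_trunc (hTm 0) b).aestronglyMeasurable
  rw [hmean] at h1
  have h4 : ∫ ω, truncDev T μ b m ω ^ 2 ∂P = P[truncDev T μ b m ^ 2] := rfl
  rw [h4]
  linarith

/-- The fluctuations of the truncated renewal sums are of order `a_n`. -/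
lemma exists_integral_truncDev_sq_le (hTm : ∀ k, Measurable (T k)) (hT : iIndepFun T P)
    (hTi : ∀ k, IdentDistrib (T k) (T 0) P P) (hU : RegVarTail P (T 0) α) (hα1 : 1 < α)
    (hα2 : α < 2) {K : ℝ} (hK : 0 < K) :
    ∃ C > 0, ∀ᶠ n : ℕ in atTop, ∀ m ≤ 2 * n,
      ∫ ω, truncDev T (∫ ω, (T 0 ω : ℝ) ∂P) (K * tailQuantile P (T 0) n) m ω ^ 2 ∂P ≤
        C * tailQuantile P (T 0) n ^ 2 := by
  obtain ⟨C₁, hC₁, h1⟩ := hU.truncated_sq (hTm 0) hα1 hα2 hK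
  obtain ⟨C₂, hC₂, h2⟩ := hU.integral_sub_truncated (hTm 0) hα1 hK
  refine ⟨2 * C₁ + (2 * C₂) ^ 2, by positivity, ?_⟩
  filter_upwards [h1, h2, eventually_ge_atTop 1,
    (hU.tendsto_quantile (by linarith)).eventually_gt_atTop 0] with n h1 h2 hn ha m hm
  set a := tailQuantile P (T 0) n
  have hn' : (0 : ℝ) < n := by exact_mod_cast hn
  have hm' : (m : ℝ) ≤ 2 * n := by exact_mod_cast hm
  refine (integral_truncDev_sq_le hTm hT hTi _ (by positivity) m).trans ?_
  have hb : 0 ≤ K * a := by positivity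
  have hint := hU.integrable (hTm 0) hα1
  have htr := (memLp_trunc (P := P) (hTm 0) hb).integrable (by norm_num)
  rw [integral_sub hint htr] at h2
  have hle : 0 ≤ ∫ ω, (T 0 ω : ℝ) ∂P - ∫ ω, min (T 0 ω : ℝ) (K * a) ∂P :=
    sub_nonneg.2 (integral_mono htr hint fun ω => min_le_left _ _)
  have e1 : (m : ℝ) * ∫ ω, min (T 0 ω : ℝ) (K * a) ^ 2 ∂P ≤ 2 * n * (C₁ * (a ^ 2 / n)) := by
    gcongr
  have e2 : (m * (∫ ω, min (T 0 ω : ℝ) (K * a) ∂P - ∫ ω, (T 0 ω : ℝ) ∂P)) ^ 2 ≤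
      (2 * n * (C₂ * (a / n))) ^ 2 := by
    rw [mul_pow, ← neg_sub (∫ ω, (T 0 ω : ℝ) ∂P), neg_sq, ← mul_pow]
    gcongr
  refine (add_le_add e1 e2).trans (le_of_eq ?_)
  field_simp

omit [IsProbabilityMeasure P] in
/-- The deviation of the sum of the first `m` variables is independent of the next variable. -/
lemma integral_trunc_sq_mul_truncDev_sq (hTm : ∀ k, Measurable (T k)) (hT : iIndepFun T P)
    (hTi : ∀ k, IdentDistrib (T k) (T 0) P P) (μ b : ℝ) (m : ℕ) :
    ∫ ω, min (T m ω : ℝ) b ^ 2 * truncDev T μ b m ω ^ 2 ∂P =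
      (∫ ω, min (T 0 ω : ℝ) b ^ 2 ∂P) * ∫ ω, truncDev T μ b m ω ^ 2 ∂P := by
  have h1 := (indep_trunc hT b).indepFun_sum_range_succ (fun i => measurable_trunc (hTm i) b) m
  have h2 : IndepFun (fun ω => min (T m ω : ℝ) b ^ 2) (fun ω => truncDev T μ b m ω ^ 2) P := by
    have h3 := (h1.comp (φ := fun y : ℝ => (y - μ * m) ^ 2) (ψ := fun y : ℝ => y ^ 2)
      (by fun_prop) (by fun_prop)).symm
    have e : (fun ω => truncDev T μ b m ω ^ 2) = (fun y : ℝ => (y - μ * m) ^ 2) ∘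
        ∑ j ∈ Finset.range m, fun ω => min (T j ω : ℝ) b := by
      ext ω
      simp [truncDev]
    rw [e]
    exact h3
  rw [h2.integral_fun_mul_eq_mul_integral
    ((measurable_trunc (hTm m) b).pow_const 2).aestronglyMeasurable
    ((measurable_truncDev hTm μ b m).pow_const 2).aestronglyMeasurable]
  congr 1
  exact ((identDistrib_trunc hTi b m).comp (measurable_id.pow_const 2)).integral_eq

/-- Chebyshev's inequality. -/
lemma measureReal_lt_abs_le {X : Ω → ℝ} (hX : MemLp X 2 P) {w : ℝ} (hw : 0 < w) :
    P.real {ω | w < |X ω|} ≤ (∫ ω, X ω ^ 2 ∂P) / w ^ 2 := by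
  have h1 := mul_meas_ge_le_integral_of_nonneg (μ := P) (f := fun ω => X ω ^ 2)
    (Eventually.of_forall fun ω => sq_nonneg _) hX.integrable_sq (w ^ 2)
  rw [le_div_iff₀ (by positivity), mul_comm]
  refine le_trans (mul_le_mul_of_nonneg_left (measureReal_mono fun ω hω => ?_) (sq_nonneg w)) h1
  simp only [Set.mem_ofPred_eq] at hω ⊢
  rw [← sq_abs (X ω)]
  gcongr

end TruncDev

/-! ### The Taqqu-Levy model -/

section TaqquLevy

lemma regimeEnd_succ {Ω : Type*} (T : ℕ → Ω → ℕ) (S₀ : Ω → ℕ) (k : ℕ) (ω : Ω) :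
    regimeEnd T S₀ (k + 1) ω = regimeEnd T S₀ k ω + T k ω := by
  simp [regimeEnd, Finset.sum_range_succ, add_assoc]

lemma regimeEnd_mono {Ω : Type*} (T : ℕ → Ω → ℕ) (S₀ : Ω → ℕ) (ω : Ω) :
    Monotone fun k => regimeEnd T S₀ k ω :=
  monotone_nat_of_le_succ fun k => by rw [regimeEnd_succ]; lia

lemma regimeEnd_nonneg {Ω : Type*} (T : ℕ → Ω → ℕ) (S₀ : Ω → ℕ) (k : ℕ) (ω : Ω) :
    0 ≤ regimeEnd T S₀ k ω := by
  unfold regimeEnd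
  positivity

lemma le_regimeEnd {Ω : Type*} {T : ℕ → Ω → ℕ} (S₀ : Ω → ℕ) {ω : Ω} (hT : ∀ k, 0 < T k ω) (k : ℕ) :
    (k : ℤ) ≤ regimeEnd T S₀ k ω := by
  induction k with
  | zero => exact regimeEnd_nonneg _ _ _ _
  | succ k ih =>
    rw [regimeEnd_succ]
    have := hT k
    push_cast
    lia

lemma taqquLevy_eq_sum {Ω : Type*} {T : ℕ → Ω → ℕ} {S₀ : Ω → ℕ} {W : ℕ → Ω → ℝ} {ω : Ω}
    (hT : ∀ k, 0 < T k ω) {n : ℕ} {t : ℤ} (ht : t ≤ n) :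
    taqquLevy T S₀ W t ω = ∑ k ∈ Finset.range (n + 2),
      if regimeStart T S₀ k ω ≤ t ∧ t < regimeEnd T S₀ k ω then W k ω else 0 := by
  classical
  unfold taqquLevy
  rw [tsum_eq_sum (s := Finset.range (n + 2))]
  · intro k hk
    rw [if_neg]
    rintro ⟨h1, -⟩
    obtain ⟨m, rfl⟩ : ∃ m, k = m + 1 := ⟨k - 1, by simp at hk; lia⟩
    have h2 := le_regimeEnd S₀ hT m
    simp only [Finset.mem_range, not_lt] at hk
    simp only [regimeStart] at h1
    lia

/-- The error made by replacing the contribution of the `k`-th regime to the Fourier transform by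
its contribution to the approximating sum, as a function of the renewal times. -/
noncomputable def taqquLevyCoeff (μ : ℝ) (j : ℕ → ℕ) (n k : ℕ) (y : ℕ × (ℕ → ℕ)) : ℂ :=
  expBlock (fourierFreq n (j n)) n (regimeStart (fun i y => y.2 i) Prod.fst k y)
      (regimeEnd (fun i y => y.2 i) Prod.fst k y) -
    if 1 ≤ k ∧ k ≤ ⌊(n : ℝ) / μ⌋₊ then
      (y.2 (k - 1) : ℂ) * Complex.exp (Complex.I * μ * k * fourierFreq n (j n)) else 0

lemma measurable_taqquLevyCoeff (μ : ℝ) (j : ℕ → ℕ) (n k : ℕ) :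
    Measurable (taqquLevyCoeff μ j n k) := by
  have hy : ∀ i, Measurable fun y : ℕ × (ℕ → ℕ) => y.2 i := fun i =>
    (measurable_pi_apply i).comp measurable_snd
  have hend : ∀ k, Measurable (regimeEnd (fun i (y : ℕ × (ℕ → ℕ)) => y.2 i) Prod.fst k) := by
    intro k
    unfold regimeEnd
    refine Measurable.add (measurable_from_top.comp measurable_fst) ?_
    exact Finset.measurable_sum _ fun i _ => measurable_from_top.comp (hy i)
  have hstart : Measurable (regimeStart (fun i (y : ℕ × (ℕ → ℕ)) => y.2 i) Prod.fst k) := by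
    cases k with
    | zero => exact measurable_const
    | succ k => exact hend k
  have hb : Measurable fun z : ℤ × ℤ => expBlock (fourierFreq n (j n)) n z.1 z.2 :=
    Measurable.of_discrete
  refine (hb.comp (hstart.prodMk (hend k))).sub ?_
  split_ifs
  · exact (measurable_from_top.comp (hy (k - 1)) : Measurable fun y : ℕ × (ℕ → ℕ) =>
      (y.2 (k - 1) : ℂ)).mul_const _
  · exact measurable_const

lemma dft_taqquLevy_sub {Ω : Type*} {T : ℕ → Ω → ℕ} {S₀ : Ω → ℕ} {W : ℕ → Ω → ℝ} {ω : Ω}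
    (hT : ∀ k, 0 < T k ω) {μ : ℝ} (hμ : 1 ≤ μ) (j : ℕ → ℕ) (n : ℕ) :
    dft (taqquLevy T S₀ W) n (j n) ω - dftApprox (taqquLevyEta T W) μ n (j n) ω =
      ∑ k ∈ Finset.range (n + 2), (W k ω : ℂ) *
        taqquLevyCoeff μ j n k (S₀ ω, fun k => T k ω) := by
  have h1 := dft_eq_sum_expBlock (X := taqquLevy T S₀ W) (n := n) (j := j n) (ω := ω)
    (F := Finset.range (n + 2)) (V := fun k => W k ω) (s := fun k => regimeStart T S₀ k ω)
    (e := fun k => regimeEnd T S₀ k ω) (fun t ht => taqquLevy_eq_sum hT (Finset.mem_Icc.1 ht).2)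
  have hfl : ⌊(n : ℝ) / μ⌋₊ ≤ n := by
    refine Nat.floor_le_of_le (div_le_self (Nat.cast_nonneg _) hμ)
  have h2 : dftApprox (taqquLevyEta T W) μ n (j n) ω = ∑ k ∈ Finset.range (n + 2), (W k ω : ℂ) *
      (if 1 ≤ k ∧ k ≤ ⌊(n : ℝ) / μ⌋₊ then
      (T (k - 1) ω : ℂ) * Complex.exp (Complex.I * μ * k * fourierFreq n (j n)) else 0) := by
    unfold dftApprox taqquLevyEta
    simp_rw [mul_ite, mul_zero]
    rw [← Finset.sum_filter]
    refine Finset.sum_congr ?_ fun k _ => by push_cast; ring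
    ext k
    simp only [Finset.mem_Icc, Finset.mem_filter, Finset.mem_range]
    lia
  rw [h1, h2, ← Finset.sum_sub_distrib]
  refine Finset.sum_congr rfl fun k _ => ?_
  rw [← mul_sub, taqquLevyCoeff]
  congr 2
  cases k <;> rfl

variable {μ : ℝ} {j : ℕ → ℕ} {n : ℕ} {y : ℕ × (ℕ → ℕ)}

lemma norm_taqquLevyCoeff_zero_le : ‖taqquLevyCoeff μ j n 0 y‖ ≤ y.1 + 1 := by
  have h := norm_expBlock_le (fourierFreq n (j n)) n (-1) (y.1 + 1)
  have h2 : taqquLevyCoeff μ j n 0 y =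
      expBlock (fourierFreq n (j n)) n (-1) (-1 + ((y.1 + 1 : ℕ) : ℤ)) := by
    simp [taqquLevyCoeff, regimeStart, regimeEnd]
  rw [h2]
  exact_mod_cast h

lemma norm_taqquLevyCoeff_succ_le (m : ℕ) : ‖taqquLevyCoeff μ j n (m + 1) y‖ ≤ 2 * y.2 m := by
  unfold taqquLevyCoeff
  refine (norm_sub_le _ _).trans ?_
  have h1 := norm_expBlock_le (fourierFreq n (j n)) n
    (regimeStart (fun i (y : ℕ × (ℕ → ℕ)) => y.2 i) Prod.fst (m + 1) y) (y.2 m)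
  have h2 : ‖(if 1 ≤ m + 1 ∧ m + 1 ≤ ⌊(n : ℝ) / μ⌋₊ then (y.2 (m + 1 - 1) : ℂ) *
      Complex.exp (Complex.I * μ * (m + 1 : ℕ) * fourierFreq n (j n)) else 0)‖ ≤ y.2 m := by
    split_ifs
    · have := norm_exp_I_mul_mul (μ * (m + 1 : ℕ)) (fourierFreq n (j n))
      rw [norm_mul]
      rw [show Complex.I * μ * (m + 1 : ℕ) * fourierFreq n (j n) =
        Complex.I * ((μ * (m + 1 : ℕ) : ℝ) : ℂ) * fourierFreq n (j n) by push_cast; ring, this]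
      simp
    · simp
  rw [regimeEnd_succ]
  simp only [regimeStart] at h1 ⊢
  linarith

lemma taqquLevyCoeff_succ_eq_zero {m : ℕ} (hm : ⌊(n : ℝ) / μ⌋₊ ≤ m)
    (hS : n < regimeEnd (fun i (y : ℕ × (ℕ → ℕ)) => y.2 i) Prod.fst m y) :
    taqquLevyCoeff μ j n (m + 1) y = 0 := by
  unfold taqquLevyCoeff
  rw [if_neg (by lia), sub_zero]
  refine Finset.sum_eq_zero fun t ht => if_neg ?_
  rw [Finset.mem_Icc] at ht
  simp only [regimeStart]
  lia

lemma norm_taqquLevyCoeff_succ_le_of_le {m : ℕ} (hm : m + 1 ≤ ⌊(n : ℝ) / μ⌋₊)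
    (hS : regimeEnd (fun i (y : ℕ × (ℕ → ℕ)) => y.2 i) Prod.fst (m + 1) y ≤ n) :
    ‖taqquLevyCoeff μ j n (m + 1) y‖ ≤ (y.2 m : ℝ) ^ 2 * fourierFreq n (j n) + 1 +
      y.2 m * (|(regimeEnd (fun i (y : ℕ × (ℕ → ℕ)) => y.2 i) Prod.fst m y : ℝ) - μ * (m + 1)| *
        fourierFreq n (j n)) := by
  unfold taqquLevyCoeff
  rw [if_pos ⟨by lia, hm⟩]
  set x := fourierFreq n (j n) with hx
  have hx0 : 0 ≤ x := fourierFreq_nonneg _ _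
  rw [regimeEnd_succ] at hS ⊢
  simp only [regimeStart, Nat.add_sub_cancel]
  set S := regimeEnd (fun i (y : ℕ × (ℕ → ℕ)) => y.2 i) Prod.fst m y with hSdef
  have h1 := norm_expBlock_sub_le hx0 (n := n) (s := S) (m := y.2 m) (regimeEnd_nonneg _ _ _ _)
    (by lia)
  have h2 := norm_exp_sub_exp_le (S : ℝ) (μ * (m + 1)) hx0
  have e : expBlock x n S (S + (y.2 m : ℤ)) -
      (y.2 m : ℂ) * Complex.exp (Complex.I * μ * (m + 1 : ℕ) * x) =
      (expBlock x n S (S + (y.2 m : ℤ)) - (y.2 m : ℂ) * Complex.exp (Complex.I * S * x)) +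
      (y.2 m : ℂ) * (Complex.exp (Complex.I * ((S : ℝ) : ℂ) * x) -
        Complex.exp (Complex.I * ((μ * (m + 1) : ℝ) : ℂ) * x)) := by
    push_cast
    ring_nf
  rw [e]
  refine (norm_add_le _ _).trans (add_le_add h1 ?_)
  rw [norm_mul, Complex.norm_natCast]
  gcongr

end TaqquLevy

/-! ### Approximation in the Taqqu-Levy model -/

section TaqquLevyApprox

/-- On the event that all renewal times are at most `b` and that the renewal sums stay within `w / 2`
of their means at the two ends of the window of width `2 w` around `n / μ`, the squared coefficients
are controlled by truncated variables. -/
lemma sum_norm_taqquLevyCoeff_sq_le {μ a b w : ℝ} {j : ℕ → ℕ} {n : ℕ} {y : ℕ × (ℕ → ℕ)}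
    (hμ : 1 ≤ μ) (ha : 0 ≤ a) (hw : 0 < w) (hn : 1 ≤ n)
    (hwn : w ≤ n / μ) (haw : √a ≤ w / 2) (hkp : ⌈n / μ + w⌉₊ ≤ 2 * n)
    (hT : ∀ i ∈ Finset.range (2 * n), (y.2 i : ℝ) ≤ b) (hS : (y.1 : ℝ) ≤ √a)
    (hm : |truncDev (fun i (y : ℕ × (ℕ → ℕ)) => y.2 i) μ b ⌊n / μ - w⌋₊ y| ≤ w / 2)
    (hp : |truncDev (fun i (y : ℕ × (ℕ → ℕ)) => y.2 i) μ b ⌈n / μ + w⌉₊ y| ≤ w / 2) :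
    ∑ k ∈ Finset.range (n + 2), ‖taqquLevyCoeff μ j n k y‖ ^ 2 ≤
      (2 * a + 2) + ∑ m ∈ Finset.range (n + 1),
        (3 * (b * fourierFreq n (j n)) ^ 2 * min (y.2 m : ℝ) b ^ 2 + 3 +
          9 * fourierFreq n (j n) ^ 2 * (a + μ ^ 2) * min (y.2 m : ℝ) b ^ 2 +
          9 * fourierFreq n (j n) ^ 2 * (min (y.2 m : ℝ) b ^ 2 *
            truncDev (fun i (y : ℕ × (ℕ → ℕ)) => y.2 i) μ b m y ^ 2)) +
        ∑ m ∈ Finset.Ico ⌊n / μ - w⌋₊ ⌈n / μ + w⌉₊, 4 * min (y.2 m : ℝ) b ^ 2 := by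
  set x := fourierFreq n (j n) with hx
  set D := fun m => truncDev (fun i (y : ℕ × (ℕ → ℕ)) => y.2 i) μ b m y with hD
  set km := ⌊n / μ - w⌋₊ with hkm
  set kp := ⌈n / μ + w⌉₊ with hkpdef
  have hμ0 : 0 < μ := by linarith
  have hx0 : 0 ≤ x := fourierFreq_nonneg _ _
  have hS2 : (y.1 : ℝ) ^ 2 ≤ a := by
    calc (y.1 : ℝ) ^ 2 ≤ √a ^ 2 := by gcongr
      _ = a := Real.sq_sqrt ha
  have hend : ∀ m ≤ 2 * n,
      (regimeEnd (fun i (y : ℕ × (ℕ → ℕ)) => y.2 i) Prod.fst m y : ℝ) = y.1 + D m + μ * m := by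
    intro m hmn
    simp only [hD, truncDev, regimeEnd]
    push_cast
    have : ∑ i ∈ Finset.range m, min (y.2 i : ℝ) b = ∑ i ∈ Finset.range m, (y.2 i : ℝ) :=
      Finset.sum_congr rfl fun i hi => min_eq_left (hT i (Finset.mem_range.2
        ((Finset.mem_range.1 hi).trans_le hmn)))
    rw [this]
    ring
  have hndiv : (n : ℝ) / μ ≤ n := div_le_self (Nat.cast_nonneg _) hμ
  have hkm1 : (km : ℝ) ≤ n / μ - w := Nat.floor_le (by linarith)
  have hkmn : km ≤ n := by
    have : (km : ℝ) ≤ n := by linarith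
    exact_mod_cast this
  have hkmf : km ≤ ⌊(n : ℝ) / μ⌋₊ := Nat.floor_mono (by linarith)
  have hkp1 : n / μ + w ≤ (kp : ℝ) := Nat.le_ceil _
  have hfkp : ⌊(n : ℝ) / μ⌋₊ ≤ kp := by
    have h1 : (⌊(n : ℝ) / μ⌋₊ : ℝ) ≤ kp :=
      (Nat.floor_le (by positivity)).trans (by linarith)
    exact_mod_cast h1
  have hSm : regimeEnd (fun i (y : ℕ × (ℕ → ℕ)) => y.2 i) Prod.fst km y ≤ n := by
    have h1 := hend km (by lia)
    have h2 := (abs_le.1 hm).2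
    have h3 : μ * km ≤ n - μ * w := by
      calc μ * km ≤ μ * (n / μ - w) := by gcongr
        _ = n - μ * w := by field_simp
    have h4 : w ≤ μ * w := le_mul_of_one_le_left hw.le hμ
    have h5 : (regimeEnd (fun i (y : ℕ × (ℕ → ℕ)) => y.2 i) Prod.fst km y : ℝ) ≤ n := by
      rw [h1]; simp only [hD]; linarith
    exact_mod_cast h5
  have hSp : n < regimeEnd (fun i (y : ℕ × (ℕ → ℕ)) => y.2 i) Prod.fst kp y := by
    have h1 := hend kp hkp
    have h2 := (abs_le.1 hp).1
    have h3 : n + μ * w ≤ μ * kp := by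
      calc n + μ * w = μ * (n / μ + w) := by field_simp
        _ ≤ μ * kp := by gcongr
    have h4 : w ≤ μ * w := le_mul_of_one_le_left hw.le hμ
    have h6 : (0 : ℝ) ≤ y.1 := Nat.cast_nonneg _
    have h5 : (n : ℝ) < (regimeEnd (fun i (y : ℕ × (ℕ → ℕ)) => y.2 i) Prod.fst kp y : ℝ) := by
      rw [h1]; simp only [hD]; linarith
    exact_mod_cast h5
  set B := fun m => 3 * (b * x) ^ 2 * min (y.2 m : ℝ) b ^ 2 + 3 +
          9 * x ^ 2 * (a + μ ^ 2) * min (y.2 m : ℝ) b ^ 2 +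
          9 * x ^ 2 * (min (y.2 m : ℝ) b ^ 2 * D m ^ 2) with hB
  have hB0 : ∀ m, 0 ≤ B m := fun m => by simp only [hB]; positivity
  have hterm : ∀ m ∈ Finset.range (n + 1), ‖taqquLevyCoeff μ j n (m + 1) y‖ ^ 2 ≤
      B m + if m ∈ Finset.Ico km kp then 4 * min (y.2 m : ℝ) b ^ 2 else 0 := by
    intro m hmr
    have hmn : m ≤ n := Nat.lt_succ_iff.1 (Finset.mem_range.1 hmr)
    have hTm : (y.2 m : ℝ) ≤ b := hT m (Finset.mem_range.2 (by lia))
    have ht : min (y.2 m : ℝ) b = y.2 m := min_eq_left hTm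
    by_cases hwin : m ∈ Finset.Ico km kp
    · rw [if_pos hwin, ht]
      have h1 := norm_taqquLevyCoeff_succ_le (μ := μ) (j := j) (n := n) (y := y) m
      have h2 : ‖taqquLevyCoeff μ j n (m + 1) y‖ ^ 2 ≤ (2 * (y.2 m : ℝ)) ^ 2 := by gcongr
      nlinarith [hB0 m]
    · rw [if_neg hwin, add_zero]
      rw [Finset.mem_Ico, not_and_or, not_le, not_lt] at hwin
      rcases hwin with hlow | hhigh
      · have h1 := norm_taqquLevyCoeff_succ_le_of_le (μ := μ) (j := j) (n := n) (y := y) (m := m)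
          (by lia) ((regimeEnd_mono _ _ y (by lia : m + 1 ≤ km)).trans hSm)
        rw [hend m (by lia), show (y.1 : ℝ) + D m + μ * m - μ * (m + 1) = y.1 + D m - μ by ring] at h1
        set u := |(y.1 : ℝ) + D m - μ| with hu
        have hu2 : u ^ 2 ≤ 3 * (a + D m ^ 2 + μ ^ 2) := by
          rw [hu, sq_abs]
          nlinarith [sq_nonneg ((y.1 : ℝ) - D m), sq_nonneg ((y.1 : ℝ) + μ), sq_nonneg (D m + μ)]
        have hu0 : 0 ≤ u := abs_nonneg _
        have hT0 : (0 : ℝ) ≤ y.2 m := Nat.cast_nonneg _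
        simp only [hB, ht]
        set t := (y.2 m : ℝ)
        calc ‖taqquLevyCoeff μ j n (m + 1) y‖ ^ 2 ≤ (t ^ 2 * x + 1 + t * (u * x)) ^ 2 := by gcongr
          _ ≤ 3 * (t * x) ^ 2 * t ^ 2 + 3 + 3 * x ^ 2 * t ^ 2 * u ^ 2 := by
            nlinarith [sq_nonneg (t ^ 2 * x - 1), sq_nonneg (t ^ 2 * x - t * (u * x)),
              sq_nonneg (1 - t * (u * x))]
          _ ≤ 3 * (b * x) ^ 2 * t ^ 2 + 3 + 3 * x ^ 2 * t ^ 2 * (3 * (a + D m ^ 2 + μ ^ 2)) := by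
            gcongr
          _ = _ := by ring
      · rw [taqquLevyCoeff_succ_eq_zero (hfkp.trans hhigh)
          (hSp.trans_le (regimeEnd_mono _ _ y hhigh))]
        simpa using hB0 m
  have h0 : ‖taqquLevyCoeff μ j n 0 y‖ ^ 2 ≤ 2 * a + 2 := by
    have h1 := norm_taqquLevyCoeff_zero_le (μ := μ) (j := j) (n := n) (y := y)
    calc ‖taqquLevyCoeff μ j n 0 y‖ ^ 2 ≤ ((y.1 : ℝ) + 1) ^ 2 := by gcongr
      _ ≤ _ := by nlinarith [sq_nonneg ((y.1 : ℝ) - 1)]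
  rw [Finset.sum_range_succ']
  have h3 := Finset.sum_le_sum hterm
  rw [Finset.sum_add_distrib] at h3
  have h4 : ∑ m ∈ Finset.range (n + 1), (if m ∈ Finset.Ico km kp then 4 * min (y.2 m : ℝ) b ^ 2 else 0) ≤
      ∑ m ∈ Finset.Ico km kp, 4 * min (y.2 m : ℝ) b ^ 2 := by
    rw [← Finset.sum_filter]
    refine Finset.sum_le_sum_of_subset_of_nonneg (fun m hm => (Finset.mem_filter.1 hm).2)
      fun m _ _ => by positivity
  linarith

variable {Ω : Type*} [MeasurableSpace Ω] {P : Measure Ω} [IsProbabilityMeasure P]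
  {α : ℝ} {T : ℕ → Ω → ℕ} {S₀ : Ω → ℕ} {W : ℕ → Ω → ℝ}

lemma IsTaqquLevyModel.one_le_mean (h : IsTaqquLevyModel P α T S₀ W) (hα1 : 1 < α) :
    1 ≤ ∫ ω, (T 0 ω : ℝ) ∂P := by
  have h1 : ∫ _ω, (1 : ℝ) ∂P ≤ ∫ ω, (T 0 ω : ℝ) ∂P := by
    refine integral_mono_ae (integrable_const 1) (h.tail_T.integrable (h.measurable_T 0) hα1) ?_
    filter_upwards [h.T_pos 0] with ω hω
    exact_mod_cast hω
  simpa using h1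

/-- The Fourier transform of the Taqqu-Levy process is approximated by the weighted sum of the
independent variables `T_k W_k`. -/
lemma IsTaqquLevyModel.tendstoInMeasure_dft_sub (h : IsTaqquLevyModel P α T S₀ W) (hα1 : 1 < α)
    (hα2 : α < 2) {ρ : ℝ} (hρ : ρ < 1 - 1 / α) {j : ℕ → ℕ}
    (hj : ∀ᶠ n : ℕ in atTop, (j n : ℝ) ≤ (n : ℝ) ^ ρ) :
    TendstoInMeasure P (fun (n : ℕ) ω => (((tailQuantile P (T 0) n)⁻¹ : ℝ) : ℂ) *
      (dft (taqquLevy T S₀ W) n (j n) ω -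
        dftApprox (taqquLevyEta T W) (∫ ω', (T 0 ω' : ℝ) ∂P) n (j n) ω)) atTop (fun _ => 0) := by
  have hα0 : 0 < α := by linarith
  have hU := h.tail_T
  set a := tailQuantile P (T 0) with ha
  set μ := ∫ ω', (T 0 ω' : ℝ) ∂P with hμdef
  have hμ : 1 ≤ μ := h.one_le_mean hα1
  have hatop : Tendsto a atTop atTop := hU.tendsto_quantile hα0
  have hY : Measurable fun ω => (S₀ ω, fun k => T k ω) :=
    h.measurable_S₀.prodMk (measurable_pi_lambda _ h.measurable_T)
  suffices hmain : TendstoInMeasure P (fun (n : ℕ) ω => (((a n)⁻¹ : ℝ) : ℂ) *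
      ∑ k ∈ Finset.range (n + 2), (W k ω : ℂ) *
        taqquLevyCoeff μ j n k (S₀ ω, fun k => T k ω)) atTop (fun _ => 0) by
    refine TendstoInMeasure.congr_left (fun n => ?_) hmain
    filter_upwards [ae_all_iff.2 h.T_pos] with ω hω
    rw [dft_taqquLevy_sub hω hμ]
  refine tendstoInMeasure_sum_mul_random h.measurable_W h.indep_W h.identDistrib_W
    h.sq_integrable_W h.mean_W hY h.indep_W_S₀_T (fun n => Finset.range (n + 2))
    (c := taqquLevyCoeff μ j) (measurable_taqquLevyCoeff μ j) (hatop.eventually_gt_atTop 0)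
    fun δ hδ => ?_
  obtain ⟨K, hK, hKn⟩ := hU.exists_forall_le hα0 h.identDistrib_T rfl
    (F := fun n : ℕ => Finset.range (2 * n)) (Eventually.of_forall fun n => by simp)
    (half_pos hδ)
  obtain ⟨C, hC, hCn⟩ := hU.truncated_sq (h.measurable_T 0) hα1 hα2 hK
  obtain ⟨C', hC', hC'n⟩ := exists_integral_truncDev_sq_le h.measurable_T h.indep_T
    h.identDistrib_T hU hα1 hα2 hK
  rw [← hμdef] at hC'n
  -- the truncation level and the half-width of the window around `n / μ`
  set b : ℕ → ℝ := fun n => K * a n with hb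
  -- the geometric mean of `n` and `a_n`: large compared with `a_n`, small compared with `n`
  set w : ℕ → ℝ := fun n => √(n * a n) with hw
  set x : ℕ → ℝ := fun n => fourierFreq n (j n) with hx
  set t : ℕ → ℕ → Ω → ℝ := fun n m ω => min (T m ω : ℝ) (b n) with ht
  set D : ℕ → ℕ → Ω → ℝ := fun n m ω => truncDev T μ (b n) m ω with hD
  set km : ℕ → ℕ := fun n => ⌊n / μ - w n⌋₊ with hkm
  set kp : ℕ → ℕ := fun n => ⌈n / μ + w n⌉₊ with hkp
  -- the majorant: the initial regime, all regimes, and those that may be near time `n`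
  set Z : ℕ → Ω → ℝ := fun n ω =>
    (2 * a n + 2) + ∑ m ∈ Finset.range (n + 1),
        (3 * (b n * x n) ^ 2 * t n m ω ^ 2 + 3 + 9 * x n ^ 2 * (a n + μ ^ 2) * t n m ω ^ 2 +
          9 * x n ^ 2 * (t n m ω ^ 2 * D n m ω ^ 2)) +
        ∑ m ∈ Finset.Ico (km n) (kp n), 4 * t n m ω ^ 2 with hZ
  have hwdiv : Tendsto (fun n : ℕ => w n / n) atTop (nhds 0) := by
    have h1 := (hU.tendsto_quantile_div hα1).sqrt
    rw [Real.sqrt_zero] at h1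
    refine h1.congr' ?_
    filter_upwards [eventually_ge_atTop 1] with n hn
    have hn' : (0 : ℝ) < n := by exact_mod_cast hn
    rw [hw]
    simp only
    rw [← Real.sqrt_sq hn'.le, ← Real.sqrt_div' _ (sq_nonneg _), Real.sqrt_sq hn'.le]
    congr 1
    field_simp
    rfl
  have hwa : ∀ n, 0 ≤ a n → w n ^ 2 = n * a n := fun n han => Real.sq_sqrt (by positivity)
  -- conditions valid for all large `n`
  have hev : ∀ᶠ n : ℕ in atTop, 0 < a n ∧ 1 ≤ n ∧ 0 < w n ∧ w n ≤ n / μ ∧ √(a n) ≤ w n / 2 ∧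
      kp n ≤ 2 * n := by
    filter_upwards [hatop.eventually_gt_atTop 0, eventually_ge_atTop 4,
      hwdiv.eventually (gt_mem_nhds (show 0 < min μ⁻¹ (1 / 2) by positivity))] with n han hn hwn
    have hn' : (4 : ℝ) ≤ n := by exact_mod_cast hn
    have hn0 : (0 : ℝ) < n := by linarith
    rw [div_lt_iff₀ hn0] at hwn
    have h1 : w n ≤ μ⁻¹ * n := hwn.le.trans (by gcongr; exact min_le_left _ _)
    have h2 : w n ≤ 1 / 2 * n := hwn.le.trans (by gcongr; exact min_le_right _ _)
    have hw0 : 0 < w n := Real.sqrt_pos.2 (by positivity)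
    refine ⟨han, by lia, hw0, by rwa [div_eq_inv_mul], ?_, ?_⟩
    · rw [Real.sqrt_le_left (by positivity), div_pow, hwa n han.le]
      nlinarith
    · refine Nat.ceil_le.2 ?_
      have : (n : ℝ) / μ ≤ n := div_le_self hn0.le hμ
      push_cast
      linarith
  have hti : ∀ n m, 0 ≤ a n → Integrable (fun ω => t n m ω ^ 2) P := fun n m han =>
    (memLp_trunc (h.measurable_T m) (by positivity : 0 ≤ b n)).integrable_sq
  have hDi : ∀ n m, 0 ≤ a n → Integrable (fun ω => D n m ω ^ 2) P := fun n m han =>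
    (memLp_truncDev h.measurable_T (by positivity : 0 ≤ b n) m).integrable_sq
  have htDi : ∀ n m, 0 ≤ a n → Integrable (fun ω => t n m ω ^ 2 * D n m ω ^ 2) P := by
    intro n m han
    have hbn : 0 ≤ b n := by positivity
    refine ((hDi n m han).const_mul (b n ^ 2)).mono' (Measurable.aestronglyMeasurable ?_)
      (Eventually.of_forall fun ω => ?_)
    · exact ((measurable_trunc (h.measurable_T m) (b n)).pow_const 2).mul
        ((measurable_truncDev h.measurable_T μ (b n) m).pow_const 2)
    · rw [Real.norm_eq_abs, abs_of_nonneg (by positivity)]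
      have h0 : 0 ≤ t n m ω := le_min (Nat.cast_nonneg _) hbn
      gcongr
      exact min_le_right _ _
  have hte : ∀ n m, ∫ ω, t n m ω ^ 2 ∂P = ∫ ω, t n 0 ω ^ 2 ∂P := fun n m =>
    ((identDistrib_trunc h.identDistrib_T (b n) m).comp (measurable_id.pow_const 2)).integral_eq
  have i1 : ∀ n m, 0 ≤ a n → Integrable (fun ω =>
      3 * (b n * x n) ^ 2 * t n m ω ^ 2 + 3 + 9 * x n ^ 2 * (a n + μ ^ 2) * t n m ω ^ 2 +
          9 * x n ^ 2 * (t n m ω ^ 2 * D n m ω ^ 2)) P := fun n m han =>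
    ((((hti n m han).const_mul _).add (integrable_const _)).add ((hti n m han).const_mul _)).add
      ((htDi n m han).const_mul _)
  have i2 : ∀ n m, 0 ≤ a n → Integrable (fun ω => 4 * t n m ω ^ 2) P := fun n m han =>
    (hti n m han).const_mul _
  have hZi : ∀ n, 0 ≤ a n → Integrable (Z n) P := fun n han =>
    ((integrable_const _).add (integrable_finsetSum _ fun m _ => i1 n m han)).add
      (integrable_finsetSum _ fun m _ => i2 n m han)
  have hZint : ∀ᶠ n : ℕ in atTop, ∫ ω, Z n ω ∂P ≤ (2 * a n + 2) + ((n + 1 : ℕ) : ℝ) *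
      (3 * (b n * x n) ^ 2 * (C * (a n ^ 2 / n)) + 3 +
        9 * x n ^ 2 * (a n + μ ^ 2) * (C * (a n ^ 2 / n)) +
        9 * x n ^ 2 * ((C * (a n ^ 2 / n)) * (C' * a n ^ 2))) +
      (2 * w n + 2) * (4 * (C * (a n ^ 2 / n))) := by
    filter_upwards [hev, hCn, hC'n] with n ⟨han, hn, hw0, hwn, haw, hkpn⟩ hCn hC'n
    have hcard : ((Finset.Ico (km n) (kp n)).card : ℝ) ≤ 2 * w n + 2 := by
      have hle : km n ≤ kp n := by
        have h1 : (km n : ℝ) ≤ kp n :=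
          (Nat.floor_le (by linarith)).trans (le_trans (by linarith) (Nat.le_ceil _))
        exact_mod_cast h1
      rw [Nat.card_Ico, Nat.cast_sub hle]
      have h1 := Nat.ceil_lt_add_one (show 0 ≤ n / μ + w n by positivity)
      have h2 := Nat.lt_floor_add_one (n / μ - w n)
      linarith
    have q0 : 0 ≤ ∫ ω, t n 0 ω ^ 2 ∂P := integral_nonneg fun ω => sq_nonneg _
    have e1 : ∀ m ∈ Finset.range (n + 1), ∫ ω, (3 * (b n * x n) ^ 2 * t n m ω ^ 2 + 3 +
        9 * x n ^ 2 * (a n + μ ^ 2) * t n m ω ^ 2 +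
          9 * x n ^ 2 * (t n m ω ^ 2 * D n m ω ^ 2)) ∂P ≤
        3 * (b n * x n) ^ 2 * (C * (a n ^ 2 / n)) + 3 +
        9 * x n ^ 2 * (a n + μ ^ 2) * (C * (a n ^ 2 / n)) +
        9 * x n ^ 2 * ((C * (a n ^ 2 / n)) * (C' * a n ^ 2)) := by
      intro m hm
      have j1 := (hti n m han.le).const_mul (3 * (b n * x n) ^ 2)
      have j2 := (hti n m han.le).const_mul (9 * x n ^ 2 * (a n + μ ^ 2))
      have j3 := (htDi n m han.le).const_mul (9 * x n ^ 2)
      have j4 := j1.add (integrable_const (3 : ℝ))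
      have j5 := j4.add j2
      simp only [Pi.add_def] at j4 j5
      rw [integral_add j5 j3, integral_add j4 j2, integral_add j1 (integrable_const 3),
        integral_const_mul, integral_const_mul, integral_const_mul,
        integral_trunc_sq_mul_truncDev_sq h.measurable_T h.indep_T h.identDistrib_T, hte]
      have hd := hC'n m (by have := Finset.mem_range.1 hm; lia)
      have hd0 : 0 ≤ ∫ ω, truncDev T μ (b n) m ω ^ 2 ∂P := integral_nonneg fun ω => sq_nonneg _
      simp only [integral_const, probReal_univ, one_smul]
      have hc0 : 0 ≤ C * (a n ^ 2 / n) := by positivity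
      gcongr
    have e2 : ∀ m ∈ Finset.Ico (km n) (kp n), ∫ ω, 4 * t n m ω ^ 2 ∂P ≤
        4 * (C * (a n ^ 2 / n)) := by
      intro m _
      rw [integral_const_mul, hte]
      gcongr
    have s1 := Finset.sum_le_sum e1
    have s2 := Finset.sum_le_sum e2
    rw [Finset.sum_const, nsmul_eq_mul] at s1 s2
    simp only [hZ]
    have j6 := (integrable_const (μ := P) (2 * a n + 2)).add
      (integrable_finsetSum (Finset.range (n + 1)) fun m _ => i1 n m han.le)
    simp only [Pi.add_def] at j6
    rw [integral_add j6 (integrable_finsetSum _ fun m _ => i2 n m han.le),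
      integral_add (integrable_const _) (integrable_finsetSum _ fun m _ => i1 n m han.le),
      integral_finsetSum _ fun m _ => i1 n m han.le, integral_finsetSum _ fun m _ => i2 n m han.le]
    simp only [integral_const, probReal_univ, one_smul]
    rw [Finset.card_range] at s1
    have s3 : ((Finset.Ico (km n) (kp n)).card : ℝ) * (4 * (C * (a n ^ 2 / n))) ≤
        (2 * w n + 2) * (4 * (C * (a n ^ 2 / n))) := by gcongr
    linarith
  refine ⟨fun n => {y | (∀ i ∈ Finset.range (2 * n), (y.2 i : ℝ) ≤ b n) ∧ (y.1 : ℝ) ≤ √(a n) ∧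
    |truncDev (fun i (y : ℕ × (ℕ → ℕ)) => y.2 i) μ (b n) (km n) y| ≤ w n / 2 ∧
    |truncDev (fun i (y : ℕ × (ℕ → ℕ)) => y.2 i) μ (b n) (kp n) y| ≤ w n / 2}, Z,
    fun n => ?_, ?_, ?_, ?_⟩
  · have hy : ∀ i, Measurable fun y : ℕ × (ℕ → ℕ) => y.2 i := fun i =>
      (measurable_pi_apply i).comp measurable_snd
    have m1 : MeasurableSet {y : ℕ × (ℕ → ℕ) | ∀ i ∈ Finset.range (2 * n), (y.2 i : ℝ) ≤ b n} := by
      have : {y : ℕ × (ℕ → ℕ) | ∀ i ∈ Finset.range (2 * n), (y.2 i : ℝ) ≤ b n} =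
          ⋂ i ∈ Finset.range (2 * n), (fun y : ℕ × (ℕ → ℕ) => y.2 i) ⁻¹'
            {k : ℕ | (k : ℝ) ≤ b n} := by
        ext y
        simp
      rw [this]
      exact Finset.measurableSet_biInter _ fun i _ => hy i MeasurableSet.of_discrete
    have m2 : MeasurableSet {y : ℕ × (ℕ → ℕ) | (y.1 : ℝ) ≤ √(a n)} :=
      measurable_fst (MeasurableSet.of_discrete (s := {k : ℕ | (k : ℝ) ≤ √(a n)}))
    have m3 : ∀ k, MeasurableSet {y : ℕ × (ℕ → ℕ) |
        |truncDev (fun i (y : ℕ × (ℕ → ℕ)) => y.2 i) μ (b n) k y| ≤ w n / 2} := fun k =>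
      measurableSet_le (measurable_truncDev hy μ (b n) k).abs measurable_const
    exact m1.inter (m2.inter ((m3 _).inter (m3 _)))
  · have hS : Tendsto (fun n => P.real {ω | √(a n) < (S₀ ω : ℝ)}) atTop (nhds 0) := by
      have h1 : Tendsto (fun m : ℕ => P {ω | m ≤ S₀ ω}) atTop (nhds 0) := by
        have := tendsto_measure_iInter_atTop (μ := P) (s := fun m : ℕ => {ω | m ≤ S₀ ω})
          (fun m => (h.measurable_S₀ (MeasurableSet.of_discrete
            (s := {k : ℕ | m ≤ k}))).nullMeasurableSet)
          (fun i k hik ω hω => hik.trans hω) ⟨0, measure_ne_top _ _⟩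
        have he : ⋂ m : ℕ, {ω | m ≤ S₀ ω} = ∅ := by
          ext ω
          simp only [Set.mem_iInter, Set.mem_ofPred_eq, Set.mem_empty_iff_false, iff_false, not_forall,
            not_le]
          exact ⟨S₀ ω + 1, Nat.lt_succ_self _⟩
        rw [he, measure_empty] at this
        exact this
      have h2 : Tendsto (fun n => ⌊√(a n)⌋₊) atTop atTop :=
        tendsto_nat_floor_atTop.comp (Real.tendsto_sqrt_atTop.comp hatop)
      have h3 := (ENNReal.tendsto_toReal ENNReal.zero_ne_top).comp (h1.comp h2)
      refine squeeze_zero (fun _ => measureReal_nonneg) (fun n => ?_) h3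
      refine measureReal_mono fun ω hω => ?_
      have hω' : √(a n) < (S₀ ω : ℝ) := hω
      have : ((⌊√(a n)⌋₊ : ℕ) : ℝ) ≤ S₀ ω := (Nat.floor_le (Real.sqrt_nonneg _)).trans hω'.le
      exact_mod_cast this
    have hdev : Tendsto (fun n : ℕ => 4 * C' * (a n / n)) atTop (nhds 0) := by
      simpa using (hU.tendsto_quantile_div hα1).const_mul (4 * C')
    have hcheb : ∀ᶠ n : ℕ in atTop, ∀ k ≤ 2 * n,
        P.real {ω | w n / 2 < |D n k ω|} ≤ 4 * C' * (a n / n) := by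
      filter_upwards [hev, hC'n] with n ⟨han, hn, hw0, _⟩ hC'n k hk
      have hn0 : (0 : ℝ) < n := by exact_mod_cast hn
      refine (measureReal_lt_abs_le (memLp_truncDev h.measurable_T (by positivity : 0 ≤ b n) k)
        (half_pos hw0)).trans ?_
      rw [div_le_iff₀ (by positivity), div_pow, hwa n han.le]
      refine (hC'n k hk).trans (le_of_eq ?_)
      field_simp
      rw [ha]
      ring
    filter_upwards [hKn, hcheb, hev, hS.eventually (gt_mem_nhds (show 0 < δ / 6 by linarith)),
      hdev.eventually (gt_mem_nhds (show 0 < δ / 6 by linarith))] with n h1 h2 hev h3 h4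
    obtain ⟨han, hn, hw0, hwn, haw, hkpn⟩ := hev
    have hkmn : km n ≤ 2 * n := by
      have h5 : (km n : ℝ) ≤ kp n :=
          (Nat.floor_le (by linarith)).trans (le_trans (by linarith) (Nat.le_ceil _))
      have h6 : km n ≤ kp n := by exact_mod_cast h5
      lia
    have hsub : {ω | (S₀ ω, fun k => T k ω) ∉ {y : ℕ × (ℕ → ℕ) |
        (∀ i ∈ Finset.range (2 * n), (y.2 i : ℝ) ≤ b n) ∧ (y.1 : ℝ) ≤ √(a n) ∧
        |truncDev (fun i (y : ℕ × (ℕ → ℕ)) => y.2 i) μ (b n) (km n) y| ≤ w n / 2 ∧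
        |truncDev (fun i (y : ℕ × (ℕ → ℕ)) => y.2 i) μ (b n) (kp n) y| ≤ w n / 2}} ⊆
        ({ω | ¬ ∀ i ∈ Finset.range (2 * n), (T i ω : ℝ) ≤ K * a n} ∪ {ω | √(a n) < (S₀ ω : ℝ)}) ∪
        ({ω | w n / 2 < |D n (km n) ω|} ∪ {ω | w n / 2 < |D n (kp n) ω|}) := by
      intro ω hω
      by_contra hcon
      simp only [Set.mem_union, Set.mem_ofPred_eq, not_or, not_not, not_lt] at hcon
      exact hω ⟨hcon.1.1, hcon.1.2, hcon.2.1, hcon.2.2⟩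
    refine (measureReal_mono hsub).trans ((measureReal_union_le _ _).trans ?_)
    have h5 := h2 (km n) hkmn
    have h6 := h2 (kp n) hkpn
    have h7 := measureReal_union_le (μ := P)
      {ω | ¬ ∀ i ∈ Finset.range (2 * n), (T i ω : ℝ) ≤ K * a n} {ω | √(a n) < (S₀ ω : ℝ)}
    have h8 := measureReal_union_le (μ := P)
      {ω | w n / 2 < |D n (km n) ω|} {ω | w n / 2 < |D n (kp n) ω|}
    linarith
  · filter_upwards [hev] with n ⟨han, hn, hw0, hwn, haw, hkpn⟩
    refine ⟨hZi n han.le, fun ω => ?_, Eventually.of_forall fun ω hω => ?_⟩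
    · refine add_nonneg (add_nonneg (by positivity) (Finset.sum_nonneg fun m _ => ?_))
        (Finset.sum_nonneg fun m _ => ?_) <;> positivity
    · exact sum_norm_taqquLevyCoeff_sq_le hμ han.le hw0 hn hwn haw hkpn hω.1 hω.2.1 hω.2.2.1 hω.2.2.2
  · have l1 := hU.tendsto_div_quantile_sq hα0 hα2
    have l2 := hU.tendsto_quantile_mul_freq hα0 hρ hj
    have l4 : Tendsto (fun n => (a n)⁻¹) atTop (nhds 0) := tendsto_inv_atTop_zero.comp hatop
    have l5 : Tendsto (fun n : ℕ => (n : ℝ)⁻¹) atTop (nhds 0) := tendsto_inv_atTop_nhds_zero_nat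
    have hlim : Tendsto (fun n : ℕ => (2 * (a n)⁻¹ + 2 * (a n)⁻¹ ^ 2) +
        (3 * K ^ 2 * C * (1 + (n : ℝ)⁻¹) * (a n * x n) ^ 2 + 3 * (n / a n ^ 2 + (a n)⁻¹ ^ 2) +
          9 * C * (1 + (n : ℝ)⁻¹) * (a n * x n) ^ 2 * ((a n)⁻¹ + μ ^ 2 * (a n)⁻¹ ^ 2) +
          9 * C * C' * (1 + (n : ℝ)⁻¹) * (a n * x n) ^ 2) +
        4 * C * (2 * (w n / n) + 2 * (n : ℝ)⁻¹)) atTop (nhds 0) := by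
      have p1 := (l4.const_mul 2).add ((l4.pow 2).const_mul 2)
      have p2 := ((l5.const_add 1).const_mul (3 * K ^ 2 * C)).mul (l2.pow 2)
      have p3 := (l1.add (l4.pow 2)).const_mul 3
      have p4 := (((l5.const_add 1).const_mul (9 * C)).mul (l2.pow 2)).mul
        (l4.add ((l4.pow 2).const_mul (μ ^ 2)))
      have p5 := ((l5.const_add 1).const_mul (9 * C * C')).mul (l2.pow 2)
      have p6 := ((hwdiv.const_mul 2).add (l5.const_mul 2)).const_mul (4 * C)
      have := (p1.add (((p2.add p3).add p4).add p5)).add p6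
      simpa using this
    refine tendsto_of_tendsto_of_tendsto_of_le_of_le' tendsto_const_nhds hlim ?_ ?_
    · filter_upwards [hev] with n ⟨han, hn, hw0, _⟩
      refine div_nonneg (integral_nonneg fun ω => ?_) (sq_nonneg _)
      refine add_nonneg (add_nonneg (by positivity) (Finset.sum_nonneg fun m _ => ?_))
        (Finset.sum_nonneg fun m _ => ?_) <;> positivity
    · filter_upwards [hev, hZint] with n ⟨han, hn, hw0, _⟩ hZn
      have hn' : (0 : ℝ) < n := by exact_mod_cast hn
      rw [div_le_iff₀ (by positivity)]
      refine hZn.trans (le_of_eq ?_)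
      simp only [hb]
      push_cast
      field_simp

end TaqquLevyApprox

/-! ### A layer-cake formula for characteristic functions -/

section LayerCake

/-- The derivative in `x` of the compensated exponential `exp (i y x) - 1 - i y x`. -/
noncomputable def compKernel (y x : ℝ) : ℂ :=
  Complex.I * y * (Complex.exp (Complex.I * y * x) - 1)

@[fun_prop]
lemma continuous_compKernel : Continuous fun p : ℝ × ℝ => compKernel p.1 p.2 := by
  unfold compKernel
  fun_prop

lemma norm_compKernel_le (y : ℝ) {x : ℝ} (hx : 0 ≤ x) :
    ‖compKernel y x‖ ≤ |y| * (2 + |y|) * min 1 x := by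
  have h1 : ‖Complex.exp (Complex.I * y * x) - 1‖ ≤ 2 :=
    (norm_sub_le _ _).trans (by rw [norm_exp_I_mul_mul, norm_one]; norm_num)
  have h2 : ‖Complex.exp (Complex.I * y * x) - 1‖ ≤ |y| * x := by
    simpa using norm_exp_sub_exp_le y 0 hx
  rw [compKernel, norm_mul, norm_mul, Complex.norm_I, one_mul, Complex.norm_real, Real.norm_eq_abs,
    mul_assoc |y| (2 + |y|)]
  refine mul_le_mul_of_nonneg_left ?_ (abs_nonneg y)
  have hy := abs_nonneg y
  rcases le_total 1 x with h | h
  · rw [min_eq_left h]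
    linarith
  · rw [min_eq_right h]
    nlinarith

lemma compKernel_mul (c y x : ℝ) : compKernel (c * y) x = c * compKernel y (c * x) := by
  simp only [compKernel]
  push_cast
  rw [show Complex.I * (c * y) * x = Complex.I * y * (c * x) by ring]
  ring

lemma intervalIntegral_compKernel (y b : ℝ) :
    ∫ x in (0 : ℝ)..b, compKernel y x =
      Complex.exp (Complex.I * y * b) - 1 - Complex.I * y * b := by
  have hd : ∀ x ∈ Set.uIcc 0 b, HasDerivAt
      (fun x : ℝ => Complex.exp (Complex.I * y * x) - Complex.I * y * x) (compKernel y x) x := by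
    intro x _
    have h1 : HasDerivAt (fun x : ℝ => Complex.I * y * (x : ℂ)) (Complex.I * y) x := by
      simpa using (Complex.ofRealCLM.hasDerivAt (x := x)).const_mul (Complex.I * (y : ℂ))
    refine (h1.cexp.sub h1).congr_deriv ?_
    rw [compKernel]
    ring
  rw [intervalIntegral.integral_eq_sub_of_hasDerivAt hd
    ((by fun_prop : Continuous fun x => compKernel y x).intervalIntegrable _ _)]
  simp
  ring

variable {Ω : Type*} [MeasurableSpace Ω] {P : Measure Ω} [IsProbabilityMeasure P] {U : Ω → ℕ}

/-- Integrating the derivative of the compensated exponential against the tail of `U / a`. -/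
lemma integral_compKernel_mul_tail (hUm : Measurable U) (hUi : Integrable (fun ω => (U ω : ℝ)) P)
    {a : ℝ} (ha : 0 < a) (y : ℝ) :
    ∫ x in Set.Ioi (0 : ℝ), compKernel y x * (tail P U (a * x) : ℂ) =
      charFun (P.map fun ω => (U ω : ℝ)) (y / a) - 1 -
        Complex.I * y * (((∫ ω, (U ω : ℝ) ∂P) / a : ℝ) : ℂ) := by
  have hm : Measurable fun ω => (U ω : ℝ) := measurable_from_top.comp hUm
  let F : ℝ → Ω → ℂ := fun x ω => (Set.Iio ((U ω : ℝ) / a)).indicator (fun x => compKernel y x) x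
  have hset : MeasurableSet {p : ℝ × Ω | p.1 < (U p.2 : ℝ) / a} :=
    measurableSet_lt measurable_fst ((hm.comp measurable_snd).div_const a)
  have hFm : Measurable (Function.uncurry F) := by
    have : Function.uncurry F = {p : ℝ × Ω | p.1 < (U p.2 : ℝ) / a}.indicator
        (fun p => compKernel y p.1) := by
      ext p
      simp only [Function.uncurry, F, Set.indicator, Set.mem_Iio, Set.mem_ofPred_eq]
    rw [this]
    exact ((by fun_prop : Continuous fun x => compKernel y x).measurable.comp
      measurable_fst).indicator hset
  have hFle : ∀ x ∈ Set.Ioi (0 : ℝ), ∀ ω, ‖F x ω‖ ≤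
      (Set.Iio ((U ω : ℝ) / a)).indicator (fun _ => |y| * (2 + |y|)) x := by
    intro x hx ω
    simp only [F]
    rw [norm_indicator_eq_indicator_norm]
    refine Set.indicator_le_indicator ((norm_compKernel_le y (le_of_lt hx)).trans ?_)
    exact mul_le_of_le_one_right (by positivity) (min_le_left _ _)
  have hq : ∀ ω, 0 ≤ (U ω : ℝ) / a := fun ω => by positivity
  have hind : ∀ ω, ∀ G : ℝ → ℂ, ∫ x in Set.Ioi (0 : ℝ), (Set.Iio ((U ω : ℝ) / a)).indicator G x =
      ∫ x in (0 : ℝ)..((U ω : ℝ) / a), G x := by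
    intro ω G
    rw [setIntegral_indicator measurableSet_Iio, Set.Ioi_inter_Iio, ← integral_Ioc_eq_integral_Ioo,
      intervalIntegral.integral_of_le (hq ω)]
  have hindr : ∀ ω, IntegrableOn ((Set.Iio ((U ω : ℝ) / a)).indicator
      (fun _ => |y| * (2 + |y|))) (Set.Ioi (0 : ℝ)) := by
    intro ω
    rw [IntegrableOn, integrable_indicator_iff measurableSet_Iio, IntegrableOn,
      Measure.restrict_restrict measurableSet_Iio, Set.inter_comm, Set.Ioi_inter_Iio]
    exact integrableOn_const (by simp)
  have hFi : Integrable (Function.uncurry F)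
      ((volume.restrict (Set.Ioi (0 : ℝ))).prod P) := by
    rw [integrable_prod_iff' hFm.aestronglyMeasurable]
    have hx : ∀ ω, Integrable (fun x => F x ω) (volume.restrict (Set.Ioi (0 : ℝ))) := by
      intro ω
      refine (hindr ω).mono' (hFm.comp measurable_prodMk_right).aestronglyMeasurable ?_
      filter_upwards [ae_restrict_mem measurableSet_Ioi] with x hx using hFle x hx ω
    refine ⟨Eventually.of_forall hx, ?_⟩
    refine ((hUi.div_const a).const_mul (|y| * (2 + |y|))).mono' ?_ (Eventually.of_forall fun ω => ?_)
    · exact hFm.norm.stronglyMeasurable.integral_prod_left.aestronglyMeasurable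
    · rw [Real.norm_eq_abs, abs_of_nonneg (integral_nonneg fun x => norm_nonneg _)]
      have h1 : ∫ x in Set.Ioi (0 : ℝ), ‖F x ω‖ ≤ ∫ x in Set.Ioi (0 : ℝ),
          (Set.Iio ((U ω : ℝ) / a)).indicator (fun _ => |y| * (2 + |y|)) x := by
        refine integral_mono_ae (hx ω).norm (hindr ω) ?_
        filter_upwards [ae_restrict_mem measurableSet_Ioi] with x hx using hFle x hx ω
      refine h1.trans (le_of_eq ?_)
      rw [setIntegral_indicator measurableSet_Iio, Set.Ioi_inter_Iio, setIntegral_const,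
        Measure.real, Real.volume_Ioo, sub_zero, ENNReal.toReal_ofReal (hq ω), smul_eq_mul, mul_comm]
  have hL : ∀ x, compKernel y x * (tail P U (a * x) : ℂ) = ∫ ω, F x ω ∂P := by
    intro x
    have h1 : ∀ ω, F x ω = compKernel y x * ({ω | a * x < (U ω : ℝ)}.indicator (fun _ => (1 : ℂ)) ω) := by
      intro ω
      have : x < (U ω : ℝ) / a ↔ a * x < (U ω : ℝ) := by rw [lt_div_iff₀ ha, mul_comm]
      simp only [F, Set.indicator, Set.mem_Iio, Set.mem_ofPred_eq, this]
      split_ifs <;> simp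
    simp_rw [h1]
    rw [integral_const_mul, integral_indicator (measurableSet_lt measurable_const hm),
      setIntegral_const, tail]
    simp
  simp_rw [hL]
  rw [integral_integral_swap hFi]
  have hR : ∀ ω, ∫ x in Set.Ioi (0 : ℝ), F x ω =
      Complex.exp (((y / a : ℝ) : ℂ) * (U ω : ℝ) * Complex.I) - 1 -
        Complex.I * y * (((U ω : ℝ) / a : ℝ) : ℂ) := by
    intro ω
    simp only [F]
    rw [hind, intervalIntegral_compKernel]
    congr 3
    push_cast
    ring
  simp_rw [hR]
  have hei : Integrable (fun ω => Complex.exp (((y / a : ℝ) : ℂ) * (U ω : ℝ) * Complex.I)) P := by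
    refine (integrable_const (1 : ℝ)).mono' ?_ (Eventually.of_forall fun ω => ?_)
    · exact (by fun_prop : Continuous fun u : ℝ => Complex.exp (((y / a : ℝ) : ℂ) * u * Complex.I)
        ).measurable.comp hm |>.aestronglyMeasurable
    · rw [← Complex.ofReal_mul, Complex.norm_exp_ofReal_mul_I]
  have hui : Integrable (fun ω => Complex.I * y * (((U ω : ℝ) / a : ℝ) : ℂ)) P :=
    ((hUi.div_const a).ofReal).const_mul _
  have h1i := hei.sub (integrable_const (1 : ℂ))
  simp only [Pi.sub_def] at h1i
  rw [integral_sub h1i hui, integral_sub hei (integrable_const _), integral_const_mul,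
    integral_complex_ofReal, integral_div, charFun_apply_real, integral_map hm.aemeasurable
      (by fun_prop)]
  simp

end LayerCake

/-! ### The stable exponent as a limit -/

section StableExponent

/-- The exponent `∫₀^∞ (d/dx) (exp (i y x) - 1 - i y x) x ^ (-α) dx` of a totally skewed
`α`-stable law, `1 < α < 2`. -/
noncomputable def stableExponent (α y : ℝ) : ℂ :=
  ∫ x in Set.Ioi (0 : ℝ), compKernel y x * ((x ^ (-α) : ℝ) : ℂ)

lemma stableExponent_mul (α : ℝ) {c : ℝ} (hc : 0 < c) (y : ℝ) :
    stableExponent α (c * y) = ((c ^ α : ℝ) : ℂ) * stableExponent α y := by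
  have h1 : ∀ x ∈ Set.Ioi (0 : ℝ), compKernel (c * y) x * ((x ^ (-α) : ℝ) : ℂ) =
      ((c ^ (1 + α) : ℝ) : ℂ) *
        (fun x => compKernel y x * ((x ^ (-α) : ℝ) : ℂ)) (c * x) := by
    intro x hx
    have hx' : 0 < x := hx
    beta_reduce
    rw [compKernel_mul, Real.mul_rpow hc.le hx'.le, Real.rpow_add hc, Real.rpow_one,
      Real.rpow_neg hc.le]
    have : ((c ^ α : ℝ) : ℂ) ≠ 0 := by exact_mod_cast (Real.rpow_pos_of_pos hc α).ne'
    push_cast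
    field_simp
  rw [stableExponent, setIntegral_congr_fun measurableSet_Ioi h1, integral_const_mul,
    integral_comp_mul_left_Ioi (fun x => compKernel y x * ((x ^ (-α) : ℝ) : ℂ)) 0 hc, mul_zero,
    Complex.real_smul, ← mul_assoc, ← Complex.ofReal_mul, Real.rpow_add hc, Real.rpow_one,
    mul_right_comm, mul_inv_cancel₀ hc.ne', one_mul, stableExponent]

/-- Integrable majorant on `(0, ∞)` for compensated exponentials against regularly varying tails. -/
lemma integrableOn_min_mul_rpow_add {β γ : ℝ} (hγ1 : 1 < γ) (hγ2 : γ < 2) (hβ1 : 1 < β)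
    (hβ2 : β < 2) :
    IntegrableOn (fun x : ℝ => min 1 x * (x ^ (-β) + x ^ (-γ))) (Set.Ioi 0) := by
  have key : ∀ s : ℝ, 1 < s → s < 2 →
      IntegrableOn (fun x : ℝ => min 1 x * x ^ (-s)) (Set.Ioi 0) := by
    intro s hs1 hs2
    rw [← Set.Ioc_union_Ioi_eq_Ioi zero_le_one]
    refine IntegrableOn.union ?_ ?_
    · have h1 : IntegrableOn (fun x : ℝ => x ^ (1 - s)) (Set.Ioc 0 1) := by
        have := intervalIntegral.intervalIntegrable_rpow' (a := 0) (b := 1) (r := 1 - s)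
          (by linarith)
        rwa [intervalIntegrable_iff_integrableOn_Ioc_of_le zero_le_one] at this
      refine h1.congr_fun (fun x hx => ?_) measurableSet_Ioc
      beta_reduce
      rw [min_eq_right hx.2, sub_eq_add_neg, Real.rpow_add hx.1, Real.rpow_one]
    · refine (integrableOn_Ioi_rpow_of_lt (a := -s) (by linarith) one_pos).congr_fun
        (fun x hx => ?_) measurableSet_Ioi
      rw [min_eq_left (le_of_lt hx), one_mul]
  simp_rw [mul_add]
  exact (key β hβ1 hβ2).add (key γ hγ1 hγ2)

variable {Ω : Type*} [MeasurableSpace Ω] {P : Measure Ω} [IsProbabilityMeasure P] {U : Ω → ℕ}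
  {α : ℝ}

/-- The compensated log-characteristic scale `n (E exp (i y U / a_n) - 1 - i y E U / a_n)`, where
`a_n` is the tail quantile of `U`. -/
noncomputable def compChar (P : Measure Ω) (U : Ω → ℕ) (n : ℕ) (y : ℝ) : ℂ :=
  n * (charFun (P.map fun ω => (U ω : ℝ)) (y / tailQuantile P U n) - 1 -
    Complex.I * y * (((∫ ω, (U ω : ℝ) ∂P) / tailQuantile P U n : ℝ) : ℂ))

lemma continuous_compChar (n : ℕ) : Continuous (compChar P U n) := by
  unfold compChar
  refine continuous_const.mul ((Continuous.sub ?_ continuous_const).sub (by fun_prop))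
  exact continuous_charFun.comp (by fun_prop)

/-- The compensated characteristic scale is an integral of the rescaled tails. -/
lemma compChar_eq (hUm : Measurable U) (hUi : Integrable (fun ω => (U ω : ℝ)) P) {n : ℕ}
    (hn : 0 < tailQuantile P U n) (y : ℝ) :
    compChar P U n y = ∫ x in Set.Ioi (0 : ℝ), compKernel y x *
      ((n * tail P U (tailQuantile P U n * x) : ℝ) : ℂ) := by
  rw [compChar, ← integral_compKernel_mul_tail hUm hUi hn, ← integral_const_mul]
  refine integral_congr_ae (Eventually.of_forall fun x => ?_)
  push_cast
  ring

lemma measurable_tail : Measurable (tail P U) := tail_antitone.measurable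

/-- A majorant for dominated convergence, integrable as the Potter exponents are taken in
`(1, 2)`. -/
lemma RegVarTail.exists_compKernel_bound (hU : RegVarTail P U α) (hα1 : 1 < α) (hα2 : α < 2) :
    ∃ g : ℝ → ℝ, IntegrableOn g (Set.Ioi 0) ∧ ∀ᶠ n : ℕ in atTop, ∀ x ∈ Set.Ioi (0 : ℝ), ∀ y : ℝ,
      ‖compKernel y x * ((n * tail P U (tailQuantile P U n * x) : ℝ) : ℂ)‖ ≤
        |y| * (2 + |y|) * g x := by
  obtain ⟨γ, hγ1, hγ⟩ := exists_between hα1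
  obtain ⟨β, hβ, hβ2⟩ := exists_between hα2
  obtain ⟨C, hC, hCn⟩ := hU.mul_tail_le (one_pos.trans hα1) hβ (one_pos.trans hγ1).le hγ
  refine ⟨fun x => C * (min 1 x * (x ^ (-β) + x ^ (-γ))),
    (integrableOn_min_mul_rpow_add hγ1 (hγ.trans hα2) (hα1.trans hβ) hβ2).const_mul C, ?_⟩
  filter_upwards [hCn] with n hn x hx y
  have hx' : 0 < x := hx
  have ht : 0 ≤ n * tail P U (tailQuantile P U n * x) :=
    mul_nonneg (Nat.cast_nonneg _) measureReal_nonneg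
  rw [norm_mul, Complex.norm_real, Real.norm_eq_abs, abs_of_nonneg ht]
  calc ‖compKernel y x‖ * (n * tail P U (tailQuantile P U n * x))
      ≤ (|y| * (2 + |y|) * min 1 x) * (C * (x ^ (-β) + x ^ (-γ))) := by
        refine mul_le_mul (norm_compKernel_le y hx'.le) (hn x hx') ht (by positivity)
    _ = _ := by ring

lemma RegVarTail.norm_compChar_le (hU : RegVarTail P U α) (hUm : Measurable U) (hα1 : 1 < α)
    (hα2 : α < 2) :
    ∃ M : ℝ, 0 ≤ M ∧ ∀ᶠ n : ℕ in atTop, ∀ y, ‖compChar P U n y‖ ≤ M * (|y| * (2 + |y|)) := by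
  obtain ⟨g, hg, hgn⟩ := hU.exists_compKernel_bound hα1 hα2
  refine ⟨|∫ x in Set.Ioi (0 : ℝ), g x|, abs_nonneg _, ?_⟩
  filter_upwards [hgn, (hU.tendsto_quantile (one_pos.trans hα1)).eventually_gt_atTop 0]
    with n hn ha y
  rw [compChar_eq hUm (hU.integrable hUm hα1) ha]
  refine (norm_integral_le_of_norm_le (hg.const_mul (|y| * (2 + |y|))) ?_).trans ?_
  · filter_upwards [ae_restrict_mem measurableSet_Ioi] with x hx using hn x hx y
  · rw [integral_const_mul, mul_comm]
    exact mul_le_mul_of_nonneg_right (le_abs_self _) (by positivity)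

/-- Convergence of the compensated characteristic scale to the stable exponent, jointly in `n` and
the argument; this is continuous convergence, hence locally uniform. -/
lemma RegVarTail.tendsto_compChar (hU : RegVarTail P U α) (hUm : Measurable U) (hα1 : 1 < α)
    (hα2 : α < 2) (y : ℝ) :
    Tendsto (fun p : ℕ × ℝ => compChar P U p.1 p.2) (atTop ×ˢ nhds y)
      (nhds (stableExponent α y)) := by
  obtain ⟨g, hg, hgn⟩ := hU.exists_compKernel_bound hα1 hα2
  have hα := one_pos.trans hα1
  have hy : ∀ᶠ z in nhds y, |z| ≤ |y| + 1 :=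
    (continuous_abs.tendsto y).eventually (ge_mem_nhds (by linarith))
  have h1 : Tendsto (fun p : ℕ × ℝ => ∫ x in Set.Ioi (0 : ℝ), compKernel p.2 x *
      ((p.1 * tail P U (tailQuantile P U p.1 * x) : ℝ) : ℂ)) (atTop ×ˢ nhds y)
      (nhds (stableExponent α y)) := by
    refine tendsto_integral_filter_of_dominated_convergence
      (fun x => (|y| + 1) * (2 + (|y| + 1)) * |g x|) (Eventually.of_forall fun p => ?_) ?_
      (hg.abs.const_mul _) ?_
    · refine AEStronglyMeasurable.mul (by fun_prop) ?_
      refine Measurable.aestronglyMeasurable (Complex.measurable_ofReal.comp ?_)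
      exact (measurable_tail.comp (measurable_id.const_mul _)).const_mul _
    · filter_upwards [hgn.prod_mk hy] with p hp
      filter_upwards [ae_restrict_mem measurableSet_Ioi] with x hx
      refine (hp.1 x hx p.2).trans ?_
      have h0 := abs_nonneg p.2
      have h1 := hp.2
      calc |p.2| * (2 + |p.2|) * g x ≤ |p.2| * (2 + |p.2|) * |g x| := by
            gcongr
            exact le_abs_self _
        _ ≤ _ := by gcongr
    · filter_upwards [ae_restrict_mem measurableSet_Ioi] with x hx
      refine Tendsto.mul ?_ ?_
      · exact ((by fun_prop : Continuous fun z => compKernel z x).tendsto y).comp tendsto_snd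
      · exact (Complex.continuous_ofReal.tendsto _).comp
          ((hU.tendsto_mul_tail hα hx).comp tendsto_fst)
  refine h1.congr' ?_
  have ha := ((hU.tendsto_quantile hα).eventually_gt_atTop 0).prod_inl (nhds y)
  filter_upwards [ha] with p hp
  rw [compChar_eq hUm (hU.integrable hUm hα1) hp]

lemma RegVarTail.tendsto_compChar_const (hU : RegVarTail P U α) (hUm : Measurable U) (hα1 : 1 < α)
    (hα2 : α < 2) (y : ℝ) :
    Tendsto (fun n => compChar P U n y) atTop (nhds (stableExponent α y)) := by
  have h : Tendsto (fun n : ℕ => (n, y)) atTop (atTop ×ˢ nhds y) :=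
    tendsto_id.prodMk tendsto_const_nhds
  have h2 := (hU.tendsto_compChar hUm hα1 hα2 y).comp h
  simpa only [Function.comp_def] using h2

lemma re_compChar (hUm : Measurable U) (n : ℕ) (y : ℝ) :
    (compChar P U n y).re =
      -(n * ∫ ω, (1 - Real.cos (y / tailQuantile P U n * U ω)) ∂P) := by
  have hm : Measurable fun ω => (U ω : ℝ) := measurable_from_top.comp hUm
  have hei : Integrable (fun ω => Complex.exp
      (((y / tailQuantile P U n : ℝ) : ℂ) * (U ω : ℝ) * Complex.I)) P := by
    refine (integrable_const (1 : ℝ)).mono' ?_ (Eventually.of_forall fun ω => ?_)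
    · exact (by fun_prop : Continuous fun u : ℝ => Complex.exp
        (((y / tailQuantile P U n : ℝ) : ℂ) * u * Complex.I)).measurable.comp hm
          |>.aestronglyMeasurable
    · rw [← Complex.ofReal_mul, Complex.norm_exp_ofReal_mul_I]
  have hre : (charFun (P.map fun ω => (U ω : ℝ)) (y / tailQuantile P U n)).re =
      ∫ ω, Real.cos (y / tailQuantile P U n * U ω) ∂P := by
    rw [charFun_apply_real, integral_map hm.aemeasurable (by fun_prop)]
    have := integral_re hei
    simp only [RCLike.re_to_complex] at this
    rw [← this]
    refine integral_congr_ae (Eventually.of_forall fun ω => ?_)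
    beta_reduce
    rw [← Complex.ofReal_mul, Complex.exp_ofReal_mul_I_re]
  have hci : Integrable (fun ω => Real.cos (y / tailQuantile P U n * U ω)) P := by
    refine (integrable_const (1 : ℝ)).mono' ?_ (Eventually.of_forall fun ω => ?_)
    · exact (Real.measurable_cos.comp (hm.const_mul _)).aestronglyMeasurable
    · exact Real.abs_cos_le_one _
  rw [integral_sub (integrable_const _) hci, ← hre]
  simp [compChar]
  ring

/-- A limit of real parts `n E[cos (y U / a_n) - 1]`. -/
lemma RegVarTail.re_stableExponent_nonpos (hU : RegVarTail P U α) (hUm : Measurable U)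
    (hα1 : 1 < α) (hα2 : α < 2) (y : ℝ) : (stableExponent α y).re ≤ 0 := by
  refine le_of_tendsto ((Complex.continuous_re.tendsto _).comp
    (hU.tendsto_compChar_const hUm hα1 hα2 y)) (Eventually.of_forall fun n => ?_)
  simp only [Function.comp, re_compChar hUm]
  refine neg_nonpos.2 (mul_nonneg (Nat.cast_nonneg _) (integral_nonneg fun ω => ?_))
  exact sub_nonneg.2 (Real.cos_le_one _)

lemma RegVarTail.re_stableExponent_neg (hU : RegVarTail P U α) (hUm : Measurable U)
    (hα1 : 1 < α) (hα2 : α < 2) {y : ℝ} (hy : y ≠ 0) : (stableExponent α y).re < 0 := by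
  have hα := one_pos.trans hα1
  have hm : Measurable fun ω => (U ω : ℝ) := measurable_from_top.comp hUm
  -- by scaling only `|y| = 1` matters, where a jump of size between `a_n` and `2 a_n` contributes
  have unit : ∀ s : ℝ, |s| = 1 → (stableExponent α s).re < 0 := by
    intro s hs
    have hc : 0 < 1 - Real.cos 1 := sub_pos.2 (by
      have := Real.cos_lt_cos_of_nonneg_of_le_pi le_rfl
        (by linarith [Real.pi_gt_three] : (1 : ℝ) ≤ Real.pi) one_pos
      rwa [Real.cos_zero] at this)
    have h2 : (2 : ℝ) ^ (-α) < 1 := Real.rpow_lt_one_of_one_lt_of_neg one_lt_two (by linarith)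
    have hlim : Tendsto (fun n : ℕ => -((1 - Real.cos 1) *
        (n * tail P U (tailQuantile P U n * 1) - n * tail P U (tailQuantile P U n * 2)))) atTop
        (nhds (-((1 - Real.cos 1) * (1 ^ (-α) - 2 ^ (-α))))) :=
      (((hU.tendsto_mul_tail hα one_pos).sub (hU.tendsto_mul_tail hα two_pos)).const_mul _).neg
    rw [Real.one_rpow] at hlim
    refine lt_of_le_of_lt (le_of_tendsto_of_tendsto ((Complex.continuous_re.tendsto _).comp
      (hU.tendsto_compChar_const hUm hα1 hα2 s)) hlim ?_)
      (neg_lt_zero.2 (mul_pos hc (sub_pos.2 h2)))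
    filter_upwards [(hU.tendsto_quantile hα).eventually_gt_atTop 0] with n ha
    simp only [Function.comp, re_compChar hUm]
    set a := tailQuantile P U n
    rw [neg_le_neg_iff, ← mul_sub, mul_left_comm]
    refine mul_le_mul_of_nonneg_left ?_ (Nat.cast_nonneg _)
    have hA : MeasurableSet {ω | a * 1 < (U ω : ℝ)} := measurableSet_lt measurable_const hm
    have hB : MeasurableSet {ω | a * 2 < (U ω : ℝ)} := measurableSet_lt measurable_const hm
    have hsub : {ω | a * 2 < (U ω : ℝ)} ⊆ {ω | a * 1 < (U ω : ℝ)} := by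
      intro ω (hω : a * 2 < (U ω : ℝ))
      show a * 1 < (U ω : ℝ)
      linarith
    rw [tail, tail, ← measureReal_sdiff hsub hB, mul_comm, ← smul_eq_mul, ← setIntegral_const,
      ← integral_indicator (hA.diff hB)]
    have hci : Integrable (fun ω => 1 - Real.cos (s / a * U ω)) P := by
      refine (integrable_const (2 : ℝ)).mono' ?_ (Eventually.of_forall fun ω => ?_)
      · exact ((Real.measurable_cos.comp (hm.const_mul _)).const_sub 1).aestronglyMeasurable
      · have h1 := Real.neg_one_le_cos (s / a * U ω)
        have h2 := Real.cos_le_one (s / a * U ω)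
        rw [Real.norm_eq_abs, abs_le]
        constructor <;> linarith
    refine integral_mono ((integrable_const _).indicator (hA.diff hB)) hci fun ω => ?_
    by_cases hω : ω ∈ {ω | a * 1 < (U ω : ℝ)} \ {ω | a * 2 < (U ω : ℝ)}
    · rw [Set.indicator_of_mem hω]
      have h3 : a * 1 < (U ω : ℝ) := hω.1
      have h4 : (U ω : ℝ) ≤ a * 2 := not_lt.1 hω.2
      beta_reduce
      rw [← Real.cos_abs (s / a * U ω), abs_mul, abs_div, hs, abs_of_pos ha,
        abs_of_nonneg (Nat.cast_nonneg _)]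
      have h5 : 1 ≤ 1 / a * (U ω : ℝ) := by
        rw [one_div, ← div_eq_inv_mul, le_div_iff₀ ha]
        linarith
      have h6 : 1 / a * (U ω : ℝ) ≤ Real.pi := by
        rw [one_div, ← div_eq_inv_mul, div_le_iff₀ ha]
        nlinarith [Real.pi_gt_three]
      linarith [Real.cos_le_cos_of_nonneg_of_le_pi zero_le_one h6 h5]
    · rw [Set.indicator_of_notMem hω]
      exact sub_nonneg.2 (Real.cos_le_one _)
  have hy' : 0 < |y| := abs_pos.2 hy
  have h1 := stableExponent_mul α hy' (y / |y|)
  rw [mul_div_cancel₀ _ hy'.ne'] at h1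
  rw [h1, Complex.re_ofReal_mul]
  refine mul_neg_of_pos_of_neg (Real.rpow_pos_of_pos hy' _) (unit _ ?_)
  rw [abs_div, abs_abs, div_self hy'.ne']

end StableExponent

/-! ### Riemann sums at Fourier frequencies -/

section Equidistribution

lemma Function.Periodic.uniformContinuous {E : Type*} [PseudoMetricSpace E] {f : ℝ → E} {c : ℝ}
    (hf : Function.Periodic f c) (hc : 0 < c) (hcont : Continuous f) : UniformContinuous f := by
  have h1 : UniformContinuousOn f (Set.Icc (-c) (2 * c)) :=
    isCompact_Icc.uniformContinuousOn_of_continuous hcont.continuousOn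
  rw [Metric.uniformContinuousOn_iff] at h1
  rw [Metric.uniformContinuous_iff]
  intro ε hε
  obtain ⟨δ, hδ, h⟩ := h1 ε hε
  refine ⟨min δ c, lt_min hδ hc, fun {x y} hxy => ?_⟩
  obtain ⟨k, hk, -⟩ := existsUnique_sub_zsmul_mem_Ico hc x 0
  have hk1 : 0 ≤ x - k • c := hk.1
  have hk2 : x - k • c < 0 + c := hk.2
  have hxy1 : dist x y < δ := hxy.trans_le (min_le_left _ _)
  have hxy2 := hxy.trans_le (min_le_right _ _)
  rw [Real.dist_eq, abs_lt] at hxy2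
  rw [← hf.sub_zsmul_eq k (x := x), ← hf.sub_zsmul_eq k (x := y)]
  refine h _ ⟨by linarith, by linarith⟩ _ ⟨by linarith, by linarith⟩ ?_
  rwa [dist_sub_right]

/-- The error of a Riemann sum with step `θ`, for a function oscillating by at most `ε` on
intervals of length `θ`. -/
lemma norm_sum_mul_sub_integral_le {f : ℝ → ℂ} (hf : Continuous f) {θ ε : ℝ} (hθ : 0 ≤ θ)
    (hε : ∀ x y, |x - y| ≤ θ → ‖f x - f y‖ ≤ ε) (m : ℕ) :
    ‖θ * ∑ k ∈ Finset.Icc 1 m, f (k * θ) - ∫ t in (0 : ℝ)..(m * θ), f t‖ ≤ m * θ * ε := by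
  have hi : ∀ a b : ℝ, IntervalIntegrable f volume a b := fun a b => hf.intervalIntegrable a b
  have h1 := intervalIntegral.sum_integral_adjacent_intervals (f := f) (μ := volume)
    (a := fun k : ℕ => (k : ℝ) * θ) (n := m) fun k _ => hi _ _
  simp only [Nat.cast_zero, zero_mul] at h1
  have h2 : ∑ k ∈ Finset.Icc 1 m, f (k * θ) = ∑ k ∈ Finset.range m, f ((k + 1 : ℕ) * θ) := by
    rw [Finset.range_eq_Ico, Finset.sum_Ico_add' (fun k : ℕ => f (k * θ)) 0 m 1]
    rfl
  rw [← h1, h2, Finset.mul_sum, ← Finset.sum_sub_distrib]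
  refine (norm_sum_le_of_le (n := fun _ => θ * ε) _ fun k _ => ?_).trans ?_
  · have h3 : (θ : ℂ) * f ((k + 1 : ℕ) * θ) =
        ∫ _ in (k * θ : ℝ)..((k + 1 : ℕ) * θ), f ((k + 1 : ℕ) * θ) := by
      rw [intervalIntegral.integral_const, Complex.real_smul]
      push_cast
      ring
    rw [h3, ← intervalIntegral.integral_sub (by simp) (hi _ _)]
    have hle : (k * θ : ℝ) ≤ (k + 1 : ℕ) * θ := by
      push_cast
      linarith
    refine (intervalIntegral.norm_integral_le_of_norm_le_const (C := ε) fun t ht => ?_).trans ?_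
    · rw [Set.uIoc_of_le hle] at ht
      refine hε _ _ ?_
      have h4 := ht.1
      have h5 := ht.2
      push_cast at h5 ⊢
      rw [abs_le]
      constructor <;> linarith
    · rw [abs_of_nonneg (by linarith)]
      push_cast
      exact le_of_eq (by ring)
  · rw [Finset.sum_const, Finset.card_range, nsmul_eq_mul, mul_assoc]

/-- Riemann sums along `⌊n / μ⌋` points spaced by `μ x_j`: these points make `j` turns of the
circle, up to one step, and the step tends to zero. -/
lemma tendsto_average_fourierFreq {f : ℝ → ℂ} (hf : Continuous f)
    (hper : Function.Periodic f (2 * Real.pi)) {μ : ℝ} (hμ : 0 < μ) {j : ℕ → ℕ}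
    (hj : ∀ᶠ n in atTop, 1 ≤ j n)
    (hx : Tendsto (fun n => fourierFreq n (j n)) atTop (nhds 0)) :
    Tendsto (fun n : ℕ => (n : ℂ)⁻¹ *
        ∑ k ∈ Finset.Icc 1 ⌊(n : ℝ) / μ⌋₊, f (k * (μ * fourierFreq n (j n)))) atTop
      (nhds ((2 * Real.pi * μ : ℂ)⁻¹ * ∫ t in (0 : ℝ)..(2 * Real.pi), f t)) := by
  have hpi := Real.two_pi_pos
  obtain ⟨C, hC⟩ : ∃ C, ∀ t, ‖f t‖ ≤ C := by
    obtain ⟨C, hC⟩ := isCompact_Icc.exists_bound_of_continuousOn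
      (s := Set.Icc 0 (2 * Real.pi)) hf.continuousOn
    refine ⟨C, fun t => ?_⟩
    obtain ⟨y, hy, h⟩ := hper.exists_mem_Ico₀ hpi t
    rw [h]
    exact hC y ⟨hy.1, hy.2.le⟩
  have hunif := Metric.uniformContinuous_iff.1 (hper.uniformContinuous hpi hf)
  rw [Metric.tendsto_nhds]
  intro ε hε
  obtain ⟨δ, hδ, hfδ⟩ := hunif (ε * μ / 2) (by positivity)
  have hθ0 : Tendsto (fun n => μ * fourierFreq n (j n)) atTop (nhds 0) := by
    simpa using hx.const_mul μ
  have hCn : Tendsto (fun n : ℕ => C * (n : ℝ)⁻¹) atTop (nhds 0) := by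
    simpa using tendsto_inv_atTop_nhds_zero_nat.const_mul C
  filter_upwards [hj, eventually_ge_atTop 1, hθ0.eventually (gt_mem_nhds hδ),
    hCn.eventually (gt_mem_nhds (half_pos hε))] with n hjn hn hθδ hCn
  have hn0 : (0 : ℝ) < n := by exact_mod_cast hn
  have hj0 : (0 : ℝ) < j n := by exact_mod_cast hjn
  set θ := μ * fourierFreq n (j n) with hθ
  set m := ⌊(n : ℝ) / μ⌋₊
  have hnθ : n * θ = μ * (j n * (2 * Real.pi)) := by
    rw [hθ, fourierFreq]
    field_simp
  have hθpos : 0 < θ := by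
    have : 0 < n * θ := by rw [hnθ]; positivity
    exact (pos_iff_pos_of_mul_pos this).1 hn0
  have hm1 : m * θ ≤ j n * (2 * Real.pi) := by
    have h1 : (m : ℝ) ≤ n / μ := Nat.floor_le (by positivity)
    calc m * θ ≤ n / μ * θ := by gcongr
      _ = j n * (2 * Real.pi) := by rw [div_mul_eq_mul_div, hnθ]; field_simp
  have hm2 : j n * (2 * Real.pi) - m * θ ≤ θ := by
    have h1 : n / μ < (m : ℝ) + 1 := Nat.lt_floor_add_one _
    have h2 : n / μ * θ ≤ (m + 1) * θ := by gcongr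
    have h3 : n / μ * θ = j n * (2 * Real.pi) := by
      rw [div_mul_eq_mul_div, hnθ]; field_simp
    linarith
  have hi : ∀ a b : ℝ, IntervalIntegrable f volume a b := fun a b => hf.intervalIntegrable a b
  have e1 := norm_sum_mul_sub_integral_le hf hθpos.le (ε := ε * μ / 2) (fun x y hxy => by
    have := (hfδ (a := x) (b := y) (by rw [Real.dist_eq]; linarith)).le
    rwa [dist_eq_norm] at this) m
  have e2 : ‖∫ t in (m * θ)..(j n * (2 * Real.pi)), f t‖ ≤ C * θ := by
    refine (intervalIntegral.norm_integral_le_of_norm_le_const (C := C) fun t _ => hC t).trans ?_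
    rw [abs_of_nonneg (by linarith)]
    exact mul_le_mul_of_nonneg_left hm2 ((norm_nonneg _).trans (hC 0))
  have e3 : ∫ t in (0 : ℝ)..(j n * (2 * Real.pi)), f t = j n * ∫ t in (0 : ℝ)..(2 * Real.pi), f t := by
    have := hper.intervalIntegral_add_zsmul_eq (j n) 0 hi
    simpa using this
  have e4 : ‖θ * ∑ k ∈ Finset.Icc 1 m, f (k * θ) - j n * ∫ t in (0 : ℝ)..(2 * Real.pi), f t‖ ≤
      m * θ * (ε * μ / 2) + C * θ := by
    rw [← e3, ← intervalIntegral.integral_add_adjacent_intervals (hi 0 (m * θ)) (hi _ _),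
      ← sub_sub]
    exact (norm_sub_le _ _).trans (add_le_add e1 e2)
  have hθc : (θ : ℂ) ≠ 0 := by exact_mod_cast hθpos.ne'
  have hnc : (n : ℂ) ≠ 0 := by exact_mod_cast hn0.ne'
  have hjc : (j n : ℂ) ≠ 0 := by exact_mod_cast hj0.ne'
  have hμc : (μ : ℂ) ≠ 0 := by exact_mod_cast hμ.ne'
  have hpc : (Real.pi : ℂ) ≠ 0 := by exact_mod_cast Real.pi_ne_zero
  have hnθc : (n : ℂ) * θ = μ * (j n * (2 * Real.pi)) := by exact_mod_cast hnθ
  have e5 : (n : ℂ)⁻¹ * ∑ k ∈ Finset.Icc 1 m, f (k * θ) -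
      (2 * Real.pi * μ : ℂ)⁻¹ * ∫ t in (0 : ℝ)..(2 * Real.pi), f t =
      ((n : ℂ) * θ)⁻¹ * (θ * ∑ k ∈ Finset.Icc 1 m, f (k * θ) -
        j n * ∫ t in (0 : ℝ)..(2 * Real.pi), f t) := by
    rw [mul_sub]
    congr 1
    · generalize ∑ k ∈ Finset.Icc 1 m, f (k * θ) = S
      field_simp
    · rw [hnθc]
      field_simp
  rw [dist_eq_norm, e5, norm_mul, norm_inv, norm_mul, Complex.norm_natCast, Complex.norm_real,
    Real.norm_eq_abs, abs_of_pos hθpos, inv_mul_lt_iff₀ (by positivity)]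
  have h6 : (m : ℝ) * μ ≤ n := by
    rw [← le_div_iff₀ hμ]
    exact Nat.floor_le (by positivity)
  have h7 : C < ε / 2 * n := by
    rwa [← div_eq_mul_inv, div_lt_iff₀ hn0] at hCn
  calc _ ≤ _ := e4
    _ = (m * μ) * θ * (ε / 2) + C * θ := by ring
    _ < n * θ * (ε / 2) + ε / 2 * n * θ :=
        add_lt_add_of_le_of_lt (by gcongr) (mul_lt_mul_of_pos_right h7 hθpos)
    _ = n * θ * ε := by ring

end Equidistribution

/-! ### Products of characteristic functions along the circle -/

section Products

lemma norm_prod_sub_prod_le {ι : Type*} (s : Finset ι) {z w : ι → ℂ} (hz : ∀ i ∈ s, ‖z i‖ ≤ 1)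
    (hw : ∀ i ∈ s, ‖w i‖ ≤ 1) : ‖∏ i ∈ s, z i - ∏ i ∈ s, w i‖ ≤ ∑ i ∈ s, ‖z i - w i‖ := by
  classical
  induction s using Finset.induction_on with
  | empty => simp
  | insert a s ha ih =>
    have hz' : ∀ i ∈ s, ‖z i‖ ≤ 1 := fun i hi => hz i (Finset.mem_insert_of_mem hi)
    have hw' : ∀ i ∈ s, ‖w i‖ ≤ 1 := fun i hi => hw i (Finset.mem_insert_of_mem hi)
    rw [Finset.prod_insert ha, Finset.prod_insert ha, Finset.sum_insert ha]
    have h1 : z a * ∏ i ∈ s, z i - w a * ∏ i ∈ s, w i =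
        (z a - w a) * ∏ i ∈ s, z i + w a * (∏ i ∈ s, z i - ∏ i ∈ s, w i) := by ring
    have h2 : ‖∏ i ∈ s, z i‖ ≤ 1 := by
      rw [norm_prod]
      exact Finset.prod_le_one (fun i _ => norm_nonneg _) hz'
    rw [h1]
    refine (norm_add_le _ _).trans (add_le_add ?_ ?_)
    · rw [norm_mul]
      exact mul_le_of_le_one_right (norm_nonneg _) h2
    · rw [norm_mul]
      exact (mul_le_of_le_one_left (norm_nonneg _) (hw a (Finset.mem_insert_self _ _))).trans
        (ih hz' hw')

/-- A triangular array of characteristic function values `1 + ψ_n(r) / n`, evaluated along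
equidistributed points of the circle, has products converging to the exponential of the circle
average of the limit of `ψ_n`. -/
lemma tendsto_prod_circle {φ : ℝ → ℂ} (hφ : ∀ s, ‖φ s‖ ≤ 1) {a : ℕ → ℝ} {ψ : ℝ → ℂ}
    (hψ : Continuous ψ)
    (hlim : ∀ R, TendstoUniformlyOn (fun (n : ℕ) s => (n : ℂ) * (φ (s / a n) - 1)) ψ atTop
      (Set.Icc (-R) R))
    {r : ℝ → ℝ} (hr : Continuous r) (hper : Function.Periodic r (2 * Real.pi)) {μ : ℝ}
    (hμ : 0 < μ) {j : ℕ → ℕ} (hj : ∀ᶠ n in atTop, 1 ≤ j n)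
    (hx : Tendsto (fun n => fourierFreq n (j n)) atTop (nhds 0)) :
    Tendsto (fun n : ℕ => ∏ k ∈ Finset.Icc 1 ⌊(n : ℝ) / μ⌋₊,
        φ (r (k * (μ * fourierFreq n (j n))) / a n)) atTop
      (nhds (Complex.exp ((2 * Real.pi * μ : ℂ)⁻¹ * ∫ t in (0 : ℝ)..(2 * Real.pi), ψ (r t)))) := by
  obtain ⟨R, hR⟩ : ∃ R, ∀ t, |r t| ≤ R := by
    obtain ⟨C, hC⟩ := isCompact_Icc.exists_bound_of_continuousOn
      (s := Set.Icc 0 (2 * Real.pi)) hr.continuousOn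
    refine ⟨C, fun t => ?_⟩
    obtain ⟨y, hy, h⟩ := hper.exists_mem_Ico₀ Real.two_pi_pos t
    rw [h]
    exact hC y ⟨hy.1, hy.2.le⟩
  have hrR : ∀ t, r t ∈ Set.Icc (-R) R := fun t => abs_le.1 (hR t)
  obtain ⟨M, hM⟩ := isCompact_Icc.exists_bound_of_continuousOn (s := Set.Icc (-R) R) hψ.continuousOn
  have hM0 : 0 ≤ M := (norm_nonneg _).trans (hM _ (hrR 0))
  set q : ℕ → ℕ → ℝ := fun n k => r (k * (μ * fourierFreq n (j n))) with hq
  set z : ℕ → ℕ → ℂ := fun n k => φ (q n k / a n) - 1 with hz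
  have hunif := Metric.tendstoUniformlyOn_iff.1 (hlim R)
  have hcard : ∀ n : ℕ, ((Finset.Icc 1 ⌊(n : ℝ) / μ⌋₊).card : ℝ) ≤ n / μ := fun n => by
    rw [Nat.card_Icc, Nat.add_sub_cancel]
    exact Nat.floor_le (by positivity)
  have hsum : Tendsto (fun n : ℕ => ∑ k ∈ Finset.Icc 1 ⌊(n : ℝ) / μ⌋₊, z n k) atTop
      (nhds ((2 * Real.pi * μ : ℂ)⁻¹ * ∫ t in (0 : ℝ)..(2 * Real.pi), ψ (r t))) := by
    have h1 := tendsto_average_fourierFreq (f := fun t => ψ (r t)) (hψ.comp hr)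
      (fun t => by simp only [hper t]) hμ hj hx
    refine tendsto_of_tendsto_of_dist h1 ?_
    rw [Metric.tendsto_nhds]
    intro ε hε
    filter_upwards [hunif (ε * μ / 2) (by positivity), eventually_ge_atTop 1] with n hn hn1
    have hn0 : (0 : ℝ) < n := by exact_mod_cast hn1
    have hnc : (n : ℂ) ≠ 0 := by exact_mod_cast hn0.ne'
    rw [Real.dist_eq, sub_zero, abs_of_nonneg dist_nonneg, dist_eq_norm, Finset.mul_sum,
      ← Finset.sum_sub_distrib]
    refine lt_of_le_of_lt (norm_sum_le_of_le (n := fun _ => (n : ℝ)⁻¹ * (ε * μ / 2)) _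
      fun k _ => ?_) ?_
    · have h2 := (hn (q n k) (hrR _)).le
      rw [dist_eq_norm] at h2
      have h3 : (n : ℂ)⁻¹ * ψ (q n k) - z n k = (n : ℂ)⁻¹ * (ψ (q n k) - n * z n k) := by
        field_simp
      rw [h3, norm_mul, norm_inv, Complex.norm_natCast]
      gcongr
    · rw [Finset.sum_const, nsmul_eq_mul]
      calc _ ≤ n / μ * ((n : ℝ)⁻¹ * (ε * μ / 2)) := by
            gcongr
            exact hcard n
        _ = ε / 2 := by field_simp
        _ < ε := half_lt_self hε
  have hexp := (Complex.continuous_exp.tendsto _).comp hsum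
  refine tendsto_of_tendsto_of_dist hexp ?_
  have hbound : Tendsto (fun n : ℕ => (M + 1) ^ 2 / μ * (n : ℝ)⁻¹) atTop (nhds 0) := by
    have := (tendsto_inv_atTop_nhds_zero_nat (𝕜 := ℝ)).const_mul ((M + 1) ^ 2 / μ)
    rwa [mul_zero] at this
  refine tendsto_of_tendsto_of_tendsto_of_le_of_le' tendsto_const_nhds hbound
    (Eventually.of_forall fun _ => dist_nonneg) ?_
  filter_upwards [hunif 1 one_pos, eventually_ge_atTop ⌈M + 1⌉₊, eventually_ge_atTop 1]
    with n hn hnM hn1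
  have hn0 : (0 : ℝ) < n := by exact_mod_cast hn1
  have hnM' : M + 1 ≤ n := (Nat.le_ceil _).trans (by exact_mod_cast hnM)
  have hzn : ∀ k, ‖z n k‖ ≤ (M + 1) / n := by
    intro k
    have h2 := (hn (q n k) (hrR _)).le
    rw [dist_eq_norm, norm_sub_rev] at h2
    have h3 : ‖(n : ℂ) * z n k‖ ≤ M + 1 := by
      have := norm_add_le ((n : ℂ) * z n k - ψ (q n k)) (ψ (q n k))
      rw [sub_add_cancel] at this
      linarith [hM (q n k) (hrR _)]
    rw [norm_mul, Complex.norm_natCast] at h3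
    rw [le_div_iff₀ hn0]
    linarith
  simp only [Function.comp]
  rw [dist_eq_norm, Complex.exp_sum]
  refine (norm_prod_sub_prod_le _ (fun k _ => ?_) (fun k _ => hφ _)).trans ?_
  · rw [Complex.norm_exp, Real.exp_le_one_iff]
    have h1 : (φ (q n k / a n)).re ≤ 1 := (Complex.re_le_norm _).trans (hφ _)
    simp only [hz, Complex.sub_re, Complex.one_re]
    linarith
  · have h1 : ∀ k ∈ Finset.Icc 1 ⌊(n : ℝ) / μ⌋₊, ‖Complex.exp (z n k) - φ (q n k / a n)‖ ≤
        ((M + 1) / n) ^ 2 := by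
      intro k _
      have h2 := hzn k
      have h3 : ‖z n k‖ ≤ 1 := h2.trans ((div_le_one hn0).2 hnM')
      have h4 : Complex.exp (z n k) - φ (q n k / a n) = Complex.exp (z n k) - 1 - z n k := by
        simp only [hz]
        ring
      rw [h4]
      exact (Complex.norm_exp_sub_one_sub_id_le h3).trans (by gcongr)
    refine (Finset.sum_le_sum h1).trans ?_
    rw [Finset.sum_const, nsmul_eq_mul]
    calc _ ≤ n / μ * ((M + 1) / n) ^ 2 := by
          gcongr
          exact hcard n
      _ = (M + 1) ^ 2 / μ * (n : ℝ)⁻¹ := by field_simp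

end Products

/-! ### Products of independent sequences -/

section IndependentProducts

variable {Ω ι : Type*} [MeasurableSpace Ω] {P : Measure Ω} [IsProbabilityMeasure P]

omit [IsProbabilityMeasure P] in
/-- If two independent sequences consist of independent variables, then the sequence of pairs is
independent. -/
lemma iIndepFun.prodMk_of_indepFun {β γ : Type*} [MeasurableSpace β] [MeasurableSpace γ]
    {A : ι → Ω → β} {C : ι → Ω → γ} (hAm : ∀ i, Measurable (A i)) (hCm : ∀ i, Measurable (C i))
    (hA : iIndepFun A P) (hC : iIndepFun C P)
    (hAC : IndepFun (fun ω i => A i ω) (fun ω i => C i ω) P) :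
    iIndepFun (fun i ω => (A i ω, C i ω)) P := by
  let R : Set (Set (β × γ)) := Set.image2 (· ×ˢ ·) {s | MeasurableSet s} {t | MeasurableSet t}
  refine iIndepSets.iIndep (fun i => ((hAm i).prodMk (hCm i)).comap_le)
    (fun i => {s | ∃ t ∈ R, (fun ω => (A i ω, C i ω)) ⁻¹' t = s})
    (fun i => isPiSystem_prod.comap _) (fun i => ?_) ?_
  · rw [← generateFrom_prod, MeasurableSpace.comap_generateFrom]
    rfl
  · rw [iIndepSets_iff]
    intro s f hf
    choose! t ht using hf
    have hST : ∀ i ∈ s, ∃ S T, MeasurableSet S ∧ MeasurableSet T ∧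
        f i = A i ⁻¹' S ∩ C i ⁻¹' T := by
      intro i hi
      obtain ⟨⟨S, hS, T, hT, hST⟩, h2⟩ := ht i hi
      rw [← hST] at h2
      exact ⟨S, T, hS, hT, h2.symm⟩
    choose! S T hS hT hf using hST
    have hi2 : ∀ i ∈ s, P (f i) = P (A i ⁻¹' S i) * P (C i ⁻¹' T i) := by
      intro i hi
      rw [hf i hi]
      exact (hAC.comp (measurable_pi_apply i) (measurable_pi_apply i)).measure_inter_preimage_eq_mul
        _ _ (hS i hi) (hT i hi)
    have hinter : ⋂ i ∈ s, f i = (⋂ i ∈ s, A i ⁻¹' S i) ∩ ⋂ i ∈ s, C i ⁻¹' T i := by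
      rw [Set.iInter₂_congr hf]
      ext ω
      simp only [Set.mem_iInter, Set.mem_inter_iff]
      exact ⟨fun h => ⟨fun i hi => (h i hi).1, fun i hi => (h i hi).2⟩,
        fun h i hi => ⟨h.1 i hi, h.2 i hi⟩⟩
    have hall : P ((⋂ i ∈ s, A i ⁻¹' S i) ∩ ⋂ i ∈ s, C i ⁻¹' T i) =
        P (⋂ i ∈ s, A i ⁻¹' S i) * P (⋂ i ∈ s, C i ⁻¹' T i) := by
      have h1 := hAC.measure_inter_preimage_eq_mul (⋂ i ∈ s, (fun a => a i) ⁻¹' S i)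
        (⋂ i ∈ s, (fun a => a i) ⁻¹' T i)
        (Finset.measurableSet_biInter _ fun i hi => measurable_pi_apply i (hS i hi))
        (Finset.measurableSet_biInter _ fun i hi => measurable_pi_apply i (hT i hi))
      simp only [Set.preimage_iInter] at h1
      exact h1
    rw [hinter, hall, hA.measure_inter_preimage_eq_mul s hS, hC.measure_inter_preimage_eq_mul s hT,
      ← Finset.prod_mul_distrib]
    exact (Finset.prod_congr rfl hi2).symm

/-- The characteristic function of a product of independent variables is a mixture. -/
lemma IndepFun.charFun_map_mul {X Y X' Y' : Ω → ℝ} (hX : Measurable X) (hY : Measurable Y)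
    (hXY : IndepFun X Y P) (hXX' : IdentDistrib X X' P P) (hYY' : IdentDistrib Y Y' P P) (s : ℝ) :
    charFun (P.map fun ω => X ω * Y ω) s = ∫ ω, charFun (P.map X') (s * Y' ω) ∂P := by
  have : IsProbabilityMeasure (P.map X) := Measure.isProbabilityMeasure_map hX.aemeasurable
  have : IsProbabilityMeasure (P.map Y) := Measure.isProbabilityMeasure_map hY.aemeasurable
  have h1 : P.map (fun ω => X ω * Y ω) = ((P.map X).prod (P.map Y)).map fun p => p.1 * p.2 := by
    rw [← (indepFun_iff_map_prod_eq_prod_map_map hX.aemeasurable hY.aemeasurable).1 hXY,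
      Measure.map_map (by fun_prop) (hX.prodMk hY)]
    rfl
  have hc : Continuous fun p : ℝ × ℝ => Complex.exp (s * ((p.1 * p.2 : ℝ) : ℂ) * Complex.I) := by
    fun_prop
  rw [h1, charFun_apply_real, integral_map (by fun_prop) (by fun_prop), integral_prod_symm,
    ← hXX'.map_eq]
  · have h2 : ∫ ω, charFun (P.map X) (s * Y' ω) ∂P = ∫ y, charFun (P.map X) (s * y) ∂(P.map Y') :=
      (integral_map hYY'.aemeasurable_snd
        (continuous_charFun.comp (by fun_prop)).aestronglyMeasurable).symm
    rw [h2, ← hYY'.map_eq]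
    refine integral_congr_ae (Eventually.of_forall fun y => ?_)
    beta_reduce
    rw [charFun_apply_real]
    refine integral_congr_ae (Eventually.of_forall fun x => ?_)
    beta_reduce
    congr 1
    push_cast
    ring
  · refine (integrable_const (1 : ℝ)).mono' hc.aestronglyMeasurable
      (Eventually.of_forall fun p => ?_)
    rw [← Complex.ofReal_mul, Complex.norm_exp_ofReal_mul_I]

end IndependentProducts

/-! ### Exponents of products with an independent factor -/

section StableMixture

variable {Ω : Type*} [MeasurableSpace Ω] {P : Measure Ω} [IsProbabilityMeasure P] {U : Ω → ℕ}
  {B : Ω → ℝ} {α : ℝ}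

/-- The stable exponent of a sum of independent copies of `U B`, given `B` and averaged over it. -/
noncomputable def stableMixture (α : ℝ) (P : Measure Ω) (B : Ω → ℝ) (s : ℝ) : ℂ :=
  ∫ ω, stableExponent α (s * B ω) ∂P

omit [IsProbabilityMeasure P] in
lemma stableMixture_mul (α : ℝ) {c : ℝ} (hc : 0 < c) (s : ℝ) :
    stableMixture α P B (c * s) = ((c ^ α : ℝ) : ℂ) * stableMixture α P B s := by
  simp only [stableMixture, mul_assoc, stableExponent_mul α hc]
  rw [integral_const_mul]

/-- Continuous convergence of functions is locally uniform convergence. -/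
lemma tendstoLocallyUniformly_of_forall_tendsto_prod {E : Type*} [PseudoMetricSpace E]
    {F : ℕ → ℝ → E} {f : ℝ → E}
    (h : ∀ x, Tendsto (fun p : ℕ × ℝ => F p.1 p.2) (atTop ×ˢ nhds x) (nhds (f x))) :
    TendstoLocallyUniformly F f atTop := by
  have hpt : ∀ x, Tendsto (fun n => F n x) atTop (nhds (f x)) := fun x => by
    have h1 : Tendsto (fun n : ℕ => (n, x)) atTop (atTop ×ˢ nhds x) :=
      tendsto_id.prodMk tendsto_const_nhds
    have h2 := (h x).comp h1
    simpa only [Function.comp_def] using h2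
  rw [Metric.tendstoLocallyUniformly_iff]
  intro ε hε x
  obtain ⟨p, hp, q, hq, hpq⟩ := eventually_prod_iff.1
    ((Metric.tendsto_nhds.1 (h x)) (ε / 3) (by linarith))
  refine ⟨{y | q y}, hq, ?_⟩
  filter_upwards [hp] with n hn y hy
  have h1 : dist (f y) (f x) ≤ ε / 3 :=
    le_of_tendsto ((hpt y).dist tendsto_const_nhds) (hp.mono fun m hm => (hpq hm hy).le)
  have h2 := hpq hn hy
  have h3 := dist_triangle_right (f y) (F n y) (f x)
  simp only at h2
  linarith

lemma RegVarTail.continuous_stableExponent (hU : RegVarTail P U α) (hUm : Measurable U)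
    (hα1 : 1 < α) (hα2 : α < 2) : Continuous (stableExponent α) :=
  (tendstoLocallyUniformly_of_forall_tendsto_prod
    (hU.tendsto_compChar hUm hα1 hα2)).continuous
      (Eventually.of_forall fun n => continuous_compChar n).frequently

lemma RegVarTail.norm_stableExponent_le (hU : RegVarTail P U α) (hUm : Measurable U)
    (hα1 : 1 < α) (hα2 : α < 2) :
    ∃ M : ℝ, 0 ≤ M ∧ ∀ y, ‖stableExponent α y‖ ≤ M * (|y| * (2 + |y|)) := by
  obtain ⟨M, hM, h⟩ := hU.norm_compChar_le hUm hα1 hα2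
  exact ⟨M, hM, fun y => le_of_tendsto (hU.tendsto_compChar_const hUm hα1 hα2 y).norm
    (h.mono fun n hn => hn y)⟩

lemma integrable_abs_mul_two_add (hB : MemLp B 2 P) (R : ℝ) :
    Integrable (fun ω => R * |B ω| * (2 + R * |B ω|)) P := by
  have h1 : Integrable (fun ω => |B ω|) P := (hB.integrable one_le_two).abs
  have h2 : Integrable (fun ω => (B ω) ^ 2) P := hB.integrable_sq
  refine ((h1.const_mul (2 * R)).add (h2.const_mul (R ^ 2))).congr (Eventually.of_forall fun ω => ?_)
  simp only [Pi.add_apply]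
  rw [← sq_abs (B ω)]
  ring

/-- Two moments of `B` suffice for domination, as the compensated characteristic scale grows at
most quadratically. -/
lemma RegVarTail.tendsto_integral_compChar (hU : RegVarTail P U α) (hUm : Measurable U)
    (hα1 : 1 < α) (hα2 : α < 2) (hBm : Measurable B) (hB : MemLp B 2 P) (s : ℝ) :
    Tendsto (fun p : ℕ × ℝ => ∫ ω, compChar P U p.1 (p.2 * B ω) ∂P) (atTop ×ˢ nhds s)
      (nhds (stableMixture α P B s)) := by
  obtain ⟨M, hM, hMn⟩ := hU.norm_compChar_le hUm hα1 hα2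
  have hs : ∀ᶠ z in nhds s, |z| ≤ |s| + 1 :=
    (continuous_abs.tendsto s).eventually (ge_mem_nhds (by linarith))
  refine tendsto_integral_filter_of_dominated_convergence
    (fun ω => M * ((|s| + 1) * |B ω| * (2 + (|s| + 1) * |B ω|)))
    (Eventually.of_forall fun p => ?_) ?_
    ((integrable_abs_mul_two_add hB (|s| + 1)).const_mul M) (Eventually.of_forall fun ω => ?_)
  · exact ((continuous_compChar p.1).measurable.comp (hBm.const_mul p.2)).aestronglyMeasurable
  · filter_upwards [hMn.prod_mk hs] with p hp
    refine Eventually.of_forall fun ω => (hp.1 _).trans ?_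
    have h1 := hp.2
    rw [abs_mul]
    gcongr
  · have h1 : Tendsto (fun p : ℕ × ℝ => (p.1, p.2 * B ω)) (atTop ×ˢ nhds s)
        (atTop ×ˢ nhds (s * B ω)) :=
      tendsto_fst.prodMk (((continuous_mul_const (B ω)).tendsto s).comp tendsto_snd)
    have h2 := (hU.tendsto_compChar hUm hα1 hα2 (s * B ω)).comp h1
    simpa only [Function.comp_def] using h2

/-- Since `B` is centred, the compensator averages out. -/
lemma integral_compChar (hUm : Measurable U) (hBm : Measurable B) (hBi : Integrable B P) (hB0 : ∫ ω, B ω ∂P = 0)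
    (n : ℕ) (s : ℝ) :
    ∫ ω, compChar P U n (s * B ω) ∂P =
      n * ((∫ ω, charFun (P.map fun ω => (U ω : ℝ)) (s / tailQuantile P U n * B ω) ∂P) - 1) := by
  have hm : Measurable fun ω => (U ω : ℝ) := measurable_from_top.comp hUm
  have : IsProbabilityMeasure (P.map fun ω => (U ω : ℝ)) :=
    Measure.isProbabilityMeasure_map hm.aemeasurable
  have hi : Integrable
      (fun ω => charFun (P.map fun ω => (U ω : ℝ)) (s / tailQuantile P U n * B ω)) P := by
    refine (integrable_const (1 : ℝ)).mono' ?_ (Eventually.of_forall fun ω => norm_charFun_le_one _)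
    exact (measurable_charFun.comp (hBm.const_mul _)).aestronglyMeasurable
  have h1 := hi.sub (integrable_const (1 : ℂ))
  simp only [Pi.sub_def] at h1
  have h2 : Integrable (fun ω => (Complex.I * s * (((∫ ω, (U ω : ℝ) ∂P) / tailQuantile P U n : ℝ) :
      ℂ)) * ((B ω : ℝ) : ℂ)) P := hBi.ofReal.const_mul _
  have h3 : ∀ ω, compChar P U n (s * B ω) = n *
      (charFun (P.map fun ω => (U ω : ℝ)) (s / tailQuantile P U n * B ω) - 1 -
        (Complex.I * s * (((∫ ω, (U ω : ℝ) ∂P) / tailQuantile P U n : ℝ) : ℂ)) *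
          ((B ω : ℝ) : ℂ)) := by
    intro ω
    rw [compChar, mul_div_right_comm]
    push_cast
    ring
  simp_rw [h3]
  rw [integral_const_mul, integral_sub h1 h2, integral_sub hi (integrable_const _),
    integral_const_mul, integral_complex_ofReal, hB0]
  simp

lemma RegVarTail.tendstoLocallyUniformly_integral_compChar (hU : RegVarTail P U α)
    (hUm : Measurable U) (hα1 : 1 < α) (hα2 : α < 2) (hBm : Measurable B) (hB : MemLp B 2 P) :
    TendstoLocallyUniformly (fun n s => ∫ ω, compChar P U n (s * B ω) ∂P)
      (stableMixture α P B) atTop :=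
  tendstoLocallyUniformly_of_forall_tendsto_prod
    (hU.tendsto_integral_compChar hUm hα1 hα2 hBm hB)

lemma RegVarTail.continuous_stableMixture (hU : RegVarTail P U α) (hUm : Measurable U)
    (hα1 : 1 < α) (hα2 : α < 2) (hBm : Measurable B) (hB : MemLp B 2 P) :
    Continuous (stableMixture α P B) := by
  obtain ⟨M, hM, hMy⟩ := hU.norm_stableExponent_le hUm hα1 hα2
  have hc := hU.continuous_stableExponent hUm hα1 hα2
  rw [continuous_iff_continuousAt]
  intro s
  have hs : ∀ᶠ z in nhds s, |z| ≤ |s| + 1 :=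
    (continuous_abs.tendsto s).eventually (ge_mem_nhds (by linarith))
  refine tendsto_integral_filter_of_dominated_convergence
    (fun ω => M * ((|s| + 1) * |B ω| * (2 + (|s| + 1) * |B ω|)))
    (Eventually.of_forall fun z => ?_) ?_
    ((integrable_abs_mul_two_add hB (|s| + 1)).const_mul M) (Eventually.of_forall fun ω => ?_)
  · exact (hc.measurable.comp (hBm.const_mul z)).aestronglyMeasurable
  · filter_upwards [hs] with z hz
    refine Eventually.of_forall fun ω => (hMy _).trans ?_
    rw [abs_mul]
    gcongr
  · exact (hc.comp (continuous_mul_const (B ω))).tendsto s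

lemma RegVarTail.integrable_stableExponent (hU : RegVarTail P U α) (hUm : Measurable U)
    (hα1 : 1 < α) (hα2 : α < 2) (hBm : Measurable B) (hB : MemLp B 2 P) (s : ℝ) :
    Integrable (fun ω => stableExponent α (s * B ω)) P := by
  obtain ⟨M, hM, hMy⟩ := hU.norm_stableExponent_le hUm hα1 hα2
  refine ((integrable_abs_mul_two_add hB |s|).const_mul M).mono' ?_
    (Eventually.of_forall fun ω => ?_)
  · exact ((hU.continuous_stableExponent hUm hα1 hα2).measurable.comp
      (hBm.const_mul s)).aestronglyMeasurable
  · simpa only [abs_mul] using hMy (s * B ω)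

lemma RegVarTail.re_stableMixture (hU : RegVarTail P U α) (hUm : Measurable U)
    (hα1 : 1 < α) (hα2 : α < 2) (hBm : Measurable B) (hB : MemLp B 2 P) (s : ℝ) :
    (stableMixture α P B s).re = ∫ ω, (stableExponent α (s * B ω)).re ∂P := by
  have := integral_re (hU.integrable_stableExponent hUm hα1 hα2 hBm hB s)
  simpa [stableMixture] using this.symm

lemma RegVarTail.re_stableMixture_nonpos (hU : RegVarTail P U α) (hUm : Measurable U)
    (hα1 : 1 < α) (hα2 : α < 2) (hBm : Measurable B) (hB : MemLp B 2 P) (s : ℝ) :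
    (stableMixture α P B s).re ≤ 0 := by
  rw [hU.re_stableMixture hUm hα1 hα2 hBm hB]
  exact integral_nonpos fun ω => hU.re_stableExponent_nonpos hUm hα1 hα2 _

lemma RegVarTail.re_stableMixture_neg (hU : RegVarTail P U α) (hUm : Measurable U)
    (hα1 : 1 < α) (hα2 : α < 2) (hBm : Measurable B) (hB : MemLp B 2 P)
    (hB0 : ¬ B =ᵐ[P] 0) {s : ℝ} (hs : s ≠ 0) :
    (stableMixture α P B s).re < 0 := by
  refine lt_of_le_of_ne (hU.re_stableMixture_nonpos hUm hα1 hα2 hBm hB s) fun h => hB0 ?_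
  rw [hU.re_stableMixture hUm hα1 hα2 hBm hB, ← neg_eq_zero, ← integral_neg,
    integral_eq_zero_iff_of_nonneg
      (fun ω => neg_nonneg.2 (hU.re_stableExponent_nonpos hUm hα1 hα2 _))
      (hU.integrable_stableExponent hUm hα1 hα2 hBm hB s).re.neg] at h
  filter_upwards [h] with ω hω
  by_contra hne
  have h1 := hU.re_stableExponent_neg hUm hα1 hα2 (mul_ne_zero hs hne)
  simp only [Pi.zero_apply, neg_eq_zero] at hω
  exact h1.ne hω

end StableMixture

/-! ### Averages over the circle -/

section CircleAverage

/-- The projection of the direction `u` on the unit vector at angle `t`. -/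
noncomputable def circleProj (u : ℂ) (t : ℝ) : ℝ := inner ℝ (Complex.exp (Complex.I * t)) u

lemma continuous_circleProj : Continuous fun p : ℂ × ℝ => circleProj p.1 p.2 := by
  unfold circleProj
  fun_prop

lemma periodic_circleProj (u : ℂ) : Function.Periodic (circleProj u) (2 * Real.pi) := by
  intro t
  have : Complex.exp (Complex.I * ((t + 2 * Real.pi : ℝ) : ℂ)) = Complex.exp (Complex.I * t) := by
    rw [Complex.exp_eq_exp_iff_exists_int]
    exact ⟨1, by push_cast; ring⟩
  rw [circleProj, this, circleProj]

lemma circleProj_mul (c : ℝ) (u : ℂ) (t : ℝ) : circleProj (c * u) t = c * circleProj u t := by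
  rw [circleProj, ← Complex.real_smul, inner_smul_right, circleProj]

/-- The average over the unit circle of `ψ` along the projections of `u`, divided by `μ`. -/
noncomputable def circleExponent (μ : ℝ) (ψ : ℝ → ℂ) (u : ℂ) : ℂ :=
  (2 * Real.pi * μ : ℂ)⁻¹ * ∫ t in (0 : ℝ)..(2 * Real.pi), ψ (circleProj u t)

variable {μ α : ℝ} {ψ : ℝ → ℂ}

lemma continuous_circleExponent (hψ : Continuous ψ) : Continuous (circleExponent μ ψ) := by
  refine continuous_const.mul ?_
  exact intervalIntegral.continuous_parametric_intervalIntegral_of_continuous'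
    (f := fun u t => ψ (circleProj u t)) (hψ.comp continuous_circleProj) _ _

lemma circleExponent_mul (hψ : ∀ c : ℝ, 0 < c → ∀ s, ψ (c * s) = ((c ^ α : ℝ) : ℂ) * ψ s) {c : ℝ}
    (hc : 0 < c) (u : ℂ) :
    circleExponent μ ψ (c * u) = ((c ^ α : ℝ) : ℂ) * circleExponent μ ψ u := by
  simp only [circleExponent, circleProj_mul, hψ c hc]
  rw [intervalIntegral.integral_const_mul]
  ring

/-- The integrand has nonpositive real part, is continuous, and is negative at angle `0`, where the
projection of `1` is `1`. -/
lemma re_circleExponent_one_neg (hμ : 0 < μ) (hψ : Continuous ψ) (hψ0 : ∀ s, (ψ s).re ≤ 0)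
    (hψ1 : (ψ 1).re < 0) : (circleExponent μ ψ 1).re < 0 := by
  have hc : Continuous fun t => ψ (circleProj 1 t) :=
    hψ.comp (continuous_circleProj.comp (by fun_prop : Continuous fun t : ℝ => ((1 : ℂ), t)))
  have h1 : (∫ t in (0 : ℝ)..(2 * Real.pi), ψ (circleProj 1 t)).re =
      ∫ t in (0 : ℝ)..(2 * Real.pi), (ψ (circleProj 1 t)).re := by
    have := intervalIntegral.intervalIntegral_re
      (hc.intervalIntegrable (μ := volume) 0 (2 * Real.pi))
    simpa using this.symm
  have h2 : 0 < ∫ t in (0 : ℝ)..(2 * Real.pi), -(ψ (circleProj 1 t)).re := by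
    refine intervalIntegral.integral_pos Real.two_pi_pos
      (Complex.continuous_re.comp hc).neg.continuousOn (fun t _ => neg_nonneg.2 (hψ0 _))
      ⟨0, ⟨le_rfl, Real.two_pi_pos.le⟩, ?_⟩
    simpa [circleProj] using hψ1
  rw [intervalIntegral.integral_neg, ← h1] at h2
  have h3 : ((2 * Real.pi * μ : ℂ)⁻¹) = (((2 * Real.pi * μ)⁻¹ : ℝ) : ℂ) := by push_cast; ring
  rw [circleExponent, h3, Complex.re_ofReal_mul]
  exact mul_neg_of_pos_of_neg (by positivity) (by linarith)

end CircleAverage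

/-! ### Limit laws from characteristic functions -/

section StableLimit

variable {Ω : Type*} [MeasurableSpace Ω] {P : Measure Ω} [IsProbabilityMeasure P] {α : ℝ}

/-- A pointwise limit of characteristic functions which is continuous at `0` is the characteristic
function of the limit law. -/
lemma exists_tendstoInDistribution_of_charFun {E : Type*} [NormedAddCommGroup E]
    [InnerProductSpace ℝ E] [FiniteDimensional ℝ E] [MeasurableSpace E] [BorelSpace E]
    {Z : ℕ → Ω → E} (hZ : ∀ n, AEMeasurable (Z n) P) {g : E → ℂ} (hg : ContinuousAt g 0)
    (h : ∀ u, Tendsto (fun n => charFun (P.map (Z n)) u) atTop (nhds (g u))) :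
    ∃ ν : ProbabilityMeasure E, charFun (ν : Measure E) = g ∧
      TendstoInDistribution Z atTop (fun z : E => z) (fun _ => P) (ν : Measure E) := by
  have hp : ∀ n, IsProbabilityMeasure (P.map (Z n)) := fun n =>
    Measure.isProbabilityMeasure_map (hZ n)
  let ν' : ℕ → ProbabilityMeasure E := fun n => ⟨P.map (Z n), hp n⟩
  have ht := isTightMeasureSet_of_tendsto_charFun (μ := fun n => P.map (Z n)) hg h
  have hcpt : IsCompact (closure (Set.range ν')) := by
    refine isCompact_closure_of_isTightMeasureSet ?_
    convert ht using 1
    ext κ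
    simp only [Set.mem_ofPred_eq, Set.mem_range, exists_exists_eq_and]
    rfl
  obtain ⟨ν, -, φ, hφ, hν⟩ := hcpt.tendsto_subseq (x := ν') fun n =>
    subset_closure (Set.mem_range_self n)
  have hνg : charFun (ν : Measure E) = g := by
    ext u
    exact tendsto_nhds_unique ((ProbabilityMeasure.tendsto_iff_tendsto_charFun.1 hν) u)
      ((h u).comp hφ.tendsto_atTop)
  refine ⟨ν, hνg, hZ, aemeasurable_id', ?_⟩
  refine ProbabilityMeasure.tendsto_of_tendsto_charFun fun u => ?_
  simp only [ProbabilityMeasure.coe_mk, Measure.map_id', hνg]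
  exact h u

lemma charFun_map_linear_prod (ν : Measure ℂ) [IsProbabilityMeasure ν] (a b : ℝ) (u : ℂ) :
    charFun ((ν.prod ν).map fun z => (a : ℂ) * z.1 + (b : ℂ) * z.2) u =
      charFun ν (a * u) * charFun ν (b * u) := by
  rw [charFun_apply, integral_map (by fun_prop) (by fun_prop), charFun_apply, charFun_apply,
    ← integral_prod_mul]
  refine integral_congr_ae (Eventually.of_forall fun z => ?_)
  beta_reduce
  have e : ∀ (c : ℝ) (w : ℂ), (c : ℂ) * w = c • w := fun c w => Complex.real_smul.symm
  rw [← Complex.exp_add, e a z.1, e b z.2, e a u, e b u, inner_add_left, inner_smul_left, inner_smul_left, inner_smul_right,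
    inner_smul_right]
  congr 1
  push_cast
  simp
  ring

/-- A law whose characteristic exponent is homogeneous of degree `α` is strictly stable: the
defining identity holds with centring `c = 0`. -/
lemma isStableLaw_of_charFun (hα : 0 < α) {ν : ProbabilityMeasure ℂ} {Ψ : ℂ → ℂ}
    (hν : ∀ u, charFun (ν : Measure ℂ) u = Complex.exp (Ψ u))
    (hΨ : ∀ c : ℝ, 0 < c → ∀ u, Ψ (c * u) = ((c ^ α : ℝ) : ℂ) * Ψ u) : IsStableLaw α ν := by
  intro a b ha hb
  refine ⟨0, ?_⟩
  have hs : 0 < a ^ α + b ^ α := add_pos (Real.rpow_pos_of_pos ha _) (Real.rpow_pos_of_pos hb _)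
  have : IsProbabilityMeasure (((ν : Measure ℂ).prod (ν : Measure ℂ)).map
      fun z => (a : ℂ) * z.1 + (b : ℂ) * z.2) :=
    Measure.isProbabilityMeasure_map (by fun_prop)
  have : IsProbabilityMeasure ((ν : Measure ℂ).map
      fun z => (((a ^ α + b ^ α) ^ (1 / α) : ℝ) : ℂ) * z + 0) :=
    Measure.isProbabilityMeasure_map (by fun_prop)
  refine Measure.ext_of_charFun (funext fun u => ?_)
  have h2 : charFun ((ν : Measure ℂ).map
      fun z => (((a ^ α + b ^ α) ^ (1 / α) : ℝ) : ℂ) * z + 0) u =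
      charFun (ν : Measure ℂ) ((((a ^ α + b ^ α) ^ (1 / α) : ℝ) : ℂ) * u) := by
    have := charFun_map_smul (μ := (ν : Measure ℂ)) ((a ^ α + b ^ α) ^ (1 / α)) u
    simpa only [Complex.real_smul, add_zero] using this
  rw [charFun_map_linear_prod, h2, hν, hν, hν, ← Complex.exp_add, hΨ a ha, hΨ b hb,
    hΨ _ (Real.rpow_pos_of_pos hs _), ← Real.rpow_mul hs.le, one_div_mul_cancel hα.ne',
    Real.rpow_one]
  push_cast
  ring_nf

lemma ne_dirac_of_norm_charFun_lt {ν : Measure ℂ} {u : ℂ} (h : ‖charFun ν u‖ < 1) (z : ℂ) :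
    ν ≠ Measure.dirac z := by
  rintro rfl
  rw [charFun_dirac, Complex.norm_exp_ofReal_mul_I] at h
  exact lt_irrefl _ h

end StableLimit

/-! ### The limit law of the weighted sums -/

section Limit

variable {Ω : Type*} [MeasurableSpace Ω] {P : Measure Ω} [IsProbabilityMeasure P] {α : ℝ}
  {U : Ω → ℕ} {B : Ω → ℝ}

omit [IsProbabilityMeasure P] in
lemma charFun_map_real_mul {X : Ω → ℝ} (hX : AEMeasurable X P) (c u : ℂ) :
    charFun (P.map fun ω => (X ω : ℂ) * c) u = charFun (P.map X) (inner ℝ c u) := by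
  have hm : AEMeasurable (fun ω => (X ω : ℂ) * c) P :=
    (Complex.measurable_ofReal.comp_aemeasurable hX).mul_const c
  rw [charFun_apply, integral_map hm (by fun_prop), charFun_apply_real,
    integral_map hX (by fun_prop)]
  refine integral_congr_ae (Eventually.of_forall fun ω => ?_)
  beta_reduce
  rw [show (X ω : ℂ) * c = X ω • c from Complex.real_smul.symm, inner_smul_left]
  congr 2
  push_cast
  simp [mul_comm]

lemma RegVarTail.tendsto_freq (hU : RegVarTail P U α) (hα : 0 < α) {ρ : ℝ}
    (hρ : ρ < 1 - 1 / α) {j : ℕ → ℕ} (hj : ∀ᶠ n : ℕ in atTop, (j n : ℝ) ≤ (n : ℝ) ^ ρ) :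
    Tendsto (fun n : ℕ => fourierFreq n (j n)) atTop (nhds 0) := by
  refine tendsto_of_tendsto_of_tendsto_of_le_of_le' tendsto_const_nhds
    (hU.tendsto_quantile_mul_freq hα hρ hj) (Eventually.of_forall fun n => fourierFreq_nonneg _ _) ?_
  filter_upwards [(hU.tendsto_quantile hα).eventually_ge_atTop 1] with n hn
  exact le_mul_of_one_le_left (fourierFreq_nonneg _ _) hn

/-- The weighted sums `d_{n, j(n)} / a_n` of independent copies of a product `U B` of independent
factors have characteristic functions converging to that of a stable law. The sum starts at `k = 1`,
so the copies `A`, `C`, indexed from `0`, are shifted by one. -/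
lemma RegVarTail.tendsto_charFun_dftApprox (hU : RegVarTail P U α) (hUm : Measurable U)
    (hα1 : 1 < α) (hα2 : α < 2) (hBm : Measurable B) (hB : MemLp B 2 P) (hB0 : ∫ ω, B ω ∂P = 0)
    {A : ℕ → Ω → ℕ} {C : ℕ → Ω → ℝ} (hAm : ∀ k, Measurable (A k)) (hCm : ∀ k, Measurable (C k))
    (hA : iIndepFun A P) (hC : iIndepFun C P)
    (hAC : IndepFun (fun ω k => A k ω) (fun ω k => C k ω) P)
    (hAU : ∀ k, IdentDistrib (A k) U P P) (hCB : ∀ k, IdentDistrib (C k) B P P)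
    {η : ℕ → Ω → ℝ} (hη : ∀ k ω, η (k + 1) ω = A k ω * C k ω)
    {μ ρ : ℝ} (hμ : 0 < μ) (hρ : ρ < 1 - 1 / α) {j : ℕ → ℕ}
    (hj : ∀ᶠ n : ℕ in atTop, (j n : ℝ) ≤ (n : ℝ) ^ ρ) (hj1 : ∀ᶠ n in atTop, 1 ≤ j n) (u : ℂ) :
    Tendsto (fun n => charFun (P.map fun ω =>
        (((tailQuantile P U n)⁻¹ : ℝ) : ℂ) * dftApprox η μ n (j n) ω) u) atTop
      (nhds (Complex.exp (circleExponent μ (stableMixture α P B) u))) := by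
  have hcast : Measurable fun k : ℕ => (k : ℝ) := measurable_from_top
  have hXm : ∀ k, Measurable fun ω => (A k ω : ℝ) := fun k => hcast.comp (hAm k)
  have hηm : ∀ k, Measurable (η (k + 1)) := fun k => by
    have : η (k + 1) = fun ω => (A k ω : ℝ) * C k ω := funext (hη k)
    rw [this]
    exact (hXm k).mul (hCm k)
  have hind : iIndepFun (fun k => η (k + 1)) P := by
    have h1 := (iIndepFun.prodMk_of_indepFun hAm hCm hA hC hAC).comp
      (fun _ (p : ℕ × ℝ) => (p.1 : ℝ) * p.2)
      (fun _ => (hcast.comp measurable_fst).mul measurable_snd)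
    have h2 : (fun k => η (k + 1)) = fun k => (fun p : ℕ × ℝ => (p.1 : ℝ) * p.2) ∘
        fun ω => (A k ω, C k ω) := by
      ext k ω
      exact hη k ω
    rw [h2]
    exact h1
  set φ : ℝ → ℂ := fun s => ∫ ω, charFun (P.map fun ω => (U ω : ℝ)) (s * B ω) ∂P with hφ
  have hlaw : ∀ k s, charFun (P.map (η (k + 1))) s = φ s := by
    intro k s
    have : η (k + 1) = fun ω => (A k ω : ℝ) * C k ω := funext (hη k)
    rw [this]
    refine IndepFun.charFun_map_mul (hXm k) (hCm k) ?_ ((hAU k).comp hcast) (hCB k) s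
    exact (hAC.comp (measurable_pi_apply k) (measurable_pi_apply k)).comp hcast measurable_id
  have hφ1 : ∀ s, ‖φ s‖ ≤ 1 := fun s => by
    have : IsProbabilityMeasure (P.map (η 1)) :=
      Measure.isProbabilityMeasure_map (hηm 0).aemeasurable
    rw [← hlaw 0]
    exact norm_charFun_le_one _
  have hlim : ∀ R, TendstoUniformlyOn
      (fun (n : ℕ) s => (n : ℂ) * (φ (s / tailQuantile P U n) - 1)) (stableMixture α P B) atTop
      (Set.Icc (-R) R) := by
    intro R
    have h0 := (hU.tendstoLocallyUniformly_integral_compChar hUm hα1 hα2 hBm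
      hB).tendstoLocallyUniformlyOn (s := Set.Icc (-R) R)
    have h1 := (tendstoLocallyUniformlyOn_iff_tendstoUniformlyOn_of_compact isCompact_Icc).1 h0
    refine h1.congr (Eventually.of_forall fun n s _ => ?_)
    exact integral_compChar hUm hBm (hB.integrable one_le_two) hB0 n s
  have hcirc := tendsto_prod_circle hφ1 (hU.continuous_stableMixture hUm hα1 hα2 hBm hB) hlim
    (r := circleProj u)
    (continuous_circleProj.comp (by fun_prop : Continuous fun t : ℝ => (u, t)))
    (periodic_circleProj u) hμ hj1 (hU.tendsto_freq (one_pos.trans hα1) hρ hj)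
  refine hcirc.congr fun n => ?_
  set a := tailQuantile P U n
  set e : ℕ → ℂ := fun k => ((a⁻¹ : ℝ) : ℂ) *
    Complex.exp (Complex.I * μ * k * fourierFreq n (j n)) with he
  have h1 : (fun ω => ((a⁻¹ : ℝ) : ℂ) * dftApprox η μ n (j n) ω) =
      fun ω => ∑ k ∈ Finset.Icc 1 ⌊(n : ℝ) / μ⌋₊, (η k ω : ℂ) * e k := by
    ext ω
    rw [dftApprox, Finset.mul_sum]
    refine Finset.sum_congr rfl fun k _ => ?_
    simp only [he]
    ring
  have hk : ∀ k ∈ Finset.Icc 1 ⌊(n : ℝ) / μ⌋₊, k - 1 + 1 = k := fun k hk =>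
    Nat.sub_add_cancel (Finset.mem_Icc.1 hk).1
  have hYm : ∀ k ∈ Finset.Icc 1 ⌊(n : ℝ) / μ⌋₊, AEMeasurable (fun ω => (η k ω : ℂ) * e k) P := by
    intro k hk'
    have := hηm (k - 1)
    rw [hk k hk'] at this
    exact ((Complex.measurable_ofReal.comp this).mul_const _).aemeasurable
  have hYi : iIndepFun ((Finset.Icc 1 ⌊(n : ℝ) / μ⌋₊).restrict fun k ω => (η k ω : ℂ) * e k) P := by
    have hinj : Function.Injective fun k : Finset.Icc 1 ⌊(n : ℝ) / μ⌋₊ => (k : ℕ) - 1 := by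
      intro k l hkl
      have h2 := hk k k.2
      have h3 := hk l l.2
      simp only at hkl
      exact Subtype.ext (by lia)
    have h2 := (hind.precomp hinj).comp
      (fun (k : Finset.Icc 1 ⌊(n : ℝ) / μ⌋₊) (x : ℝ) => (x : ℂ) * e k)
      (fun k => Complex.measurable_ofReal.mul_const _)
    convert h2 using 1
    ext k ω
    simp only [Finset.restrict, Function.comp, hk k k.2]
  rw [h1, hYi.charFun_map_fun_finsetSum_eq_prod hYm, Finset.prod_apply]
  refine Finset.prod_congr rfl fun k hk' => ?_
  have hm := hηm (k - 1)
  rw [hk k hk'] at hm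
  have h3 := hlaw (k - 1)
  rw [hk k hk'] at h3
  rw [charFun_map_real_mul hm.aemeasurable, h3, he]
  beta_reduce
  rw [show ((a⁻¹ : ℝ) : ℂ) * Complex.exp (Complex.I * μ * k * fourierFreq n (j n)) =
    a⁻¹ • Complex.exp (Complex.I * μ * k * fourierFreq n (j n)) from Complex.real_smul.symm,
    inner_smul_left, circleProj, div_eq_inv_mul]
  congr 3
  push_cast
  ring_nf

/-- The common conclusion for both models: if the scaled transform `D` is asymptotically the scaled
weighted sum `d`, it converges in distribution to a stable law. -/
lemma RegVarTail.exists_stable_limit (hU : RegVarTail P U α) (hUm : Measurable U)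
    (hα1 : 1 < α) (hα2 : α < 2) (hBm : Measurable B) (hB : MemLp B 2 P) (hB0 : ∫ ω, B ω ∂P = 0)
    {A : ℕ → Ω → ℕ} {C : ℕ → Ω → ℝ} (hAm : ∀ k, Measurable (A k)) (hCm : ∀ k, Measurable (C k))
    (hA : iIndepFun A P) (hC : iIndepFun C P)
    (hAC : IndepFun (fun ω k => A k ω) (fun ω k => C k ω) P)
    (hAU : ∀ k, IdentDistrib (A k) U P P) (hCB : ∀ k, IdentDistrib (C k) B P P)
    {η : ℕ → Ω → ℝ} (hη : ∀ k ω, η (k + 1) ω = A k ω * C k ω)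
    {μ ρ : ℝ} (hμ : 0 < μ) (hρ : ρ < 1 - 1 / α) {j : ℕ → ℕ}
    (hj : ∀ᶠ n : ℕ in atTop, (j n : ℝ) ≤ (n : ℝ) ^ ρ) (hj1 : ∀ᶠ n in atTop, 1 ≤ j n)
    {b : ℕ → ℝ} (hb : ∀ᶠ n in atTop, b n = (tailQuantile P U n)⁻¹)
    {D : ℕ → Ω → ℂ} (hD : ∀ n, AEMeasurable (D n) P)
    (hlim : TendstoInMeasure P
      (fun n ω => (b n : ℂ) * (D n ω - dftApprox η μ n (j n) ω)) atTop (fun _ => 0)) :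
    ∃ ν : ProbabilityMeasure ℂ, IsStableLaw α ν ∧
      (¬ (B =ᵐ[P] 0) → ∀ z : ℂ, (ν : Measure ℂ) ≠ Measure.dirac z) ∧
      TendstoInDistribution (fun n ω => (b n : ℂ) * D n ω) atTop (fun z : ℂ => z) (fun _ => P)
        (ν : Measure ℂ) := by
  have hψ := hU.continuous_stableMixture hUm hα1 hα2 hBm hB
  have hcast : Measurable fun k : ℕ => (k : ℝ) := measurable_from_top
  have hηm : ∀ k, Measurable (η (k + 1)) := fun k => by
    have : η (k + 1) = fun ω => (A k ω : ℝ) * C k ω := funext (hη k)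
    rw [this]
    exact (hcast.comp (hAm k)).mul (hCm k)
  have hdm : ∀ n, AEMeasurable (fun ω => (b n : ℂ) * dftApprox η μ n (j n) ω) P := by
    intro n
    refine (Measurable.const_mul ?_ _).aemeasurable
    refine Finset.measurable_fun_sum _ fun k hk => Measurable.mul_const ?_ _
    have := hηm (k - 1)
    rw [Nat.sub_add_cancel (Finset.mem_Icc.1 hk).1] at this
    exact Complex.measurable_ofReal.comp this
  obtain ⟨ν, hν, hνlim⟩ := exists_tendstoInDistribution_of_charFun hdm
    (g := fun u => Complex.exp (circleExponent μ (stableMixture α P B) u))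
    (Complex.continuous_exp.comp (continuous_circleExponent hψ)).continuousAt fun u => by
      refine (hU.tendsto_charFun_dftApprox hUm hα1 hα2 hBm hB hB0 hAm hCm hA hC hAC hAU hCB hη hμ hρ
        hj hj1 u).congr' ?_
      filter_upwards [hb] with n hn
      rw [hn]
  refine ⟨ν, isStableLaw_of_charFun (one_pos.trans hα1) (congrFun hν)
    (fun c hc u => circleExponent_mul (fun c hc s => stableMixture_mul α hc s) hc u), fun hB1 z => ?_,
    ?_⟩
  · refine ne_dirac_of_norm_charFun_lt (u := 1) ?_ z
    rw [hν, Complex.norm_exp, Real.exp_lt_one_iff]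
    exact re_circleExponent_one_neg hμ hψ (hU.re_stableMixture_nonpos hUm hα1 hα2 hBm hB)
      (hU.re_stableMixture_neg hUm hα1 hα2 hBm hB hB1 one_ne_zero)
  · refine tendstoInDistribution_of_tendstoInMeasure_sub _ _ hνlim ?_ fun n => (hD n).const_mul _
    have h1 : ((fun n ω => (b n : ℂ) * D n ω) - fun n ω => (b n : ℂ) * dftApprox η μ n (j n) ω) =
        fun n ω => (b n : ℂ) * (D n ω - dftApprox η μ n (j n) ω) := by
      ext n ω
      simp only [Pi.sub_apply]
      ring
    rw [h1]
    exact hlim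

end Limit

/-! ### The two models -/

section Models

variable {Ω : Type*} [MeasurableSpace Ω] {P : Measure Ω} [IsProbabilityMeasure P] {α : ℝ}

omit [IsProbabilityMeasure P] in
/-- Almost surely all interarrival times are positive, so that only finitely many regimes meet the
observation window. -/
lemma IsTaqquLevyModel.aemeasurable_dft {T : ℕ → Ω → ℕ} {S₀ : Ω → ℕ} {W : ℕ → Ω → ℝ}
    (h : IsTaqquLevyModel P α T S₀ W) (j : ℕ → ℕ) (n : ℕ) :
    AEMeasurable (dft (taqquLevy T S₀ W) n (j n)) P := by
  have hT : ∀ᵐ ω ∂P, ∀ k, 0 < T k ω := ae_all_iff.2 h.T_pos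
  have hcast : Measurable fun k : ℕ => (k : ℝ) := measurable_from_top
  have hY : Measurable fun ω => (S₀ ω, fun k => T k ω) :=
    h.measurable_S₀.prodMk (measurable_pi_lambda _ h.measurable_T)
  have hη : Measurable (dftApprox (taqquLevyEta T W) 1 n (j n)) := by
    refine Finset.measurable_fun_sum _ fun k _ => Measurable.mul_const ?_ _
    exact Complex.measurable_ofReal.comp
      ((hcast.comp (h.measurable_T (k - 1))).mul (h.measurable_W k))
  have hs : Measurable fun ω => ∑ k ∈ Finset.range (n + 2), (W k ω : ℂ) *
      taqquLevyCoeff 1 j n k (S₀ ω, fun k => T k ω) :=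
    Finset.measurable_fun_sum _ fun k _ =>
      (Complex.measurable_ofReal.comp (h.measurable_W k)).mul
        ((measurable_taqquLevyCoeff 1 j n k).comp hY)
  refine (hs.add hη).aemeasurable.congr ?_
  filter_upwards [hT] with ω hω
  rw [Pi.add_apply, ← dft_taqquLevy_sub hω le_rfl j n, sub_add_cancel]

lemma eventually_ell_inv_mul (P : Measure Ω) (U : Ω → ℕ) (α : ℝ) :
    ∀ᶠ n : ℕ in atTop,
      (ell P U α n)⁻¹ * (n : ℝ) ^ (-(1 / α)) = (tailQuantile P U n)⁻¹ := by
  filter_upwards [eventually_ge_atTop 1] with n hn using ell_inv_mul hn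

end Models

theorem proposition4p1 {Ω : Type*} [MeasurableSpace Ω] (P : Measure Ω) [IsProbabilityMeasure P]
    (α ρ : ℝ) (hα₁ : 1 < α) (hα₂ : α < 2) (hρ₀ : 0 < ρ) (hρ₁ : ρ < 1 - 1 / α)
    (j : ℕ → ℕ) (hj : ∀ᶠ n : ℕ in atTop, (j n : ℝ) ≤ (n : ℝ) ^ ρ) :
    (∀ (T : ℕ → Ω → ℕ) (S₀ : Ω → ℕ) (W : ℕ → Ω → ℝ), IsTaqquLevyModel P α T S₀ W →
      TendstoInMeasure P
        (fun (n : ℕ) ω => (((ell P (T 0) α n)⁻¹ * (n : ℝ) ^ (-(1 / α)) : ℝ) : ℂ) *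
          (dft (taqquLevy T S₀ W) n (j n) ω -
            dftApprox (taqquLevyEta T W) (∫ ω', (T 0 ω' : ℝ) ∂P) n (j n) ω))
        atTop (fun _ => 0) ∧
      ((∀ᶠ n : ℕ in atTop, 1 ≤ j n) →
        ∃ ν : ProbabilityMeasure ℂ, IsStableLaw α ν ∧
          (¬ (W 0 =ᵐ[P] 0) → ∀ z : ℂ, (ν : Measure ℂ) ≠ Measure.dirac z) ∧
          TendstoInDistribution
            (fun (n : ℕ) ω => (((ell P (T 0) α n)⁻¹ * (n : ℝ) ^ (-(1 / α)) : ℝ) : ℂ) *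
              dft (taqquLevy T S₀ W) n (j n) ω)
            atTop (fun z : ℂ => z) (fun _ => P) (ν : Measure ℂ))) ∧
    (∀ (N : ℤ → Ω → ℕ) (ε : ℤ → Ω → ℝ), IsParkeModel P α N ε →
      TendstoInMeasure P
        (fun (n : ℕ) ω => (((ell P (N 0) α n)⁻¹ * (n : ℝ) ^ (-(1 / α)) : ℝ) : ℂ) *
          (dft (parke N ε) n (j n) ω - dftApprox (parkeEta N ε) 1 n (j n) ω))
        atTop (fun _ => 0) ∧
      ((∀ᶠ n : ℕ in atTop, 1 ≤ j n) →
        ∃ ν : ProbabilityMeasure ℂ, IsStableLaw α ν ∧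
          (¬ (ε 0 =ᵐ[P] 0) → ∀ z : ℂ, (ν : Measure ℂ) ≠ Measure.dirac z) ∧
          TendstoInDistribution
            (fun (n : ℕ) ω => (((ell P (N 0) α n)⁻¹ * (n : ℝ) ^ (-(1 / α)) : ℝ) : ℂ) *
              dft (parke N ε) n (j n) ω)
            atTop (fun z : ℂ => z) (fun _ => P) (ν : Measure ℂ))) := by
  have hα : 0 < α := one_pos.trans hα₁
  constructor
  · intro T S₀ W h
    have hb := eventually_ell_inv_mul P (T 0) α
    have hlim : TendstoInMeasure P
        (fun (n : ℕ) ω => (((ell P (T 0) α n)⁻¹ * (n : ℝ) ^ (-(1 / α)) : ℝ) : ℂ) *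
          (dft (taqquLevy T S₀ W) n (j n) ω -
            dftApprox (taqquLevyEta T W) (∫ ω', (T 0 ω' : ℝ) ∂P) n (j n) ω))
        atTop (fun _ => 0) := by
      refine (h.tendstoInMeasure_dft_sub hα₁ hα₂ hρ₁ hj).congr' ?_ EventuallyEq.rfl
      filter_upwards [hb] with n hn
      rw [hn]
    refine ⟨hlim, fun hj1 => ?_⟩
    have hWsub : Measurable fun (w : ℕ → ℝ) (k : ℕ) => w (k + 1) :=
      measurable_pi_lambda _ fun k => measurable_pi_apply (k + 1)
    have hTW : IndepFun (fun ω k => T k ω) (fun ω k => W (k + 1) ω) P :=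
      (h.indep_W_S₀_T.symm).comp measurable_snd hWsub
    exact h.tail_T.exists_stable_limit (h.measurable_T 0) hα₁ hα₂ (h.measurable_W 0)
      h.sq_integrable_W h.mean_W h.measurable_T (fun k => h.measurable_W (k + 1)) h.indep_T
      (h.indep_W.precomp (add_left_injective 1)) hTW h.identDistrib_T
      (fun k => h.identDistrib_W (k + 1)) (fun k ω => by simp [taqquLevyEta])
      (one_pos.trans_le (h.one_le_mean hα₁)) hρ₁ hj hj1 hb (fun n => h.aemeasurable_dft j n) hlim
  · intro N ε h
    have hb := eventually_ell_inv_mul P (N 0) α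
    have hlim : TendstoInMeasure P
        (fun (n : ℕ) ω => (((ell P (N 0) α n)⁻¹ * (n : ℝ) ^ (-(1 / α)) : ℝ) : ℂ) *
          (dft (parke N ε) n (j n) ω - dftApprox (parkeEta N ε) 1 n (j n) ω))
        atTop (fun _ => 0) := by
      refine (h.tendstoInMeasure_dft_sub hα₁ hα₂ hρ₁ hj).congr' ?_ EventuallyEq.rfl
      filter_upwards [hb] with n hn
      rw [hn]
    refine ⟨hlim, fun hj1 => ?_⟩
    have hinj : Function.Injective fun k : ℕ => ((k + 1 : ℕ) : ℤ) := fun k l hkl => by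
      simp only [Nat.cast_inj] at hkl
      lia
    have hN : Measurable fun (a : ℤ → ℕ) (k : ℕ) => a ((k + 1 : ℕ) : ℤ) :=
      measurable_pi_lambda _ fun k => measurable_pi_apply _
    have hε : Measurable fun (a : ℤ → ℝ) (k : ℕ) => a ((k + 1 : ℕ) : ℤ) :=
      measurable_pi_lambda _ fun k => measurable_pi_apply _
    exact h.tail_N.exists_stable_limit (h.measurable_N 0) hα₁ hα₂ (h.measurable_ε 0)
      h.sq_integrable_ε h.mean_ε (fun k => h.measurable_N ((k + 1 : ℕ) : ℤ))
      (fun k => h.measurable_ε ((k + 1 : ℕ) : ℤ)) (h.indep_N.precomp hinj)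
      (h.indep_ε.precomp hinj) (h.indep_N_ε.comp hN hε) (fun k => h.identDistrib_N _)
      (fun k => h.identDistrib_ε _) (fun k ω => rfl) one_pos hρ₁ hj hj1 hb
      (fun n => h.aemeasurable_dft hα₁ n (j n)) hlim
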